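/- Let $\mathbb R^4$ have coordinates $(x_1,x_2,y_1,y_2)$, let $\lambda_0=\frac12\sum_{i=1}^2(y_i\,dx_i-x_i\,dy_i)$ and $\omega_0=d\lambda_0=\sum_{i=1}^2 dy_i\wedge dx_i$, and let $H=\frac{y_1^2+y_2^2}{2}+\frac{x_1^2+x_2^2}{2}+x_1^2x_2-\frac{x_2^3}{3}$ be the Hénon–Heiles Hamiltonian, with Hamiltonian vector field $X_H$ given by $\iota_{X_H}\omega_0=-dH$. A contact form $\lambda$ on a closed 3-manifold $M$ is called dynamically convex if $c_1(\ker\lambda)$ vanishes on $\pi_2(M)$ and every contractible periodic orbit of its Reeb flow has (generalized) Conley–Zehnder index at least $3$, computed in a trivialization of $\ker\lambda$ along the orbit that extends over a capping disk. Let $L(3,2)$ be the quotient of the unit sphere $S^3\subset\mathbb R^4\equiv\mathbb C^2$ (with $z_j=x_j+iy_j$) by the free $\mathbb Z_3$-action generated by $g_{3,2}(z_1,z_2)=(e^{2\pi i/3}z_1,e^{4\pi i/3}z_2)$, and let $\xi_{\rm std}$ be the contact structure on $L(3,2)$ induced by $\ker\lambda_0|_{S^3}$. Then for every $0<E<\frac16$: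 1. The energy level $H^{-1}(E)$ has exactly one connected component $S_E$ that is a smoothly embedded 3-sphere. 2. $S_E$ is a strictly convex hypersurface: it is the boundary of a strictly convex compact set with non-empty interior, and its second fundamental form with respect to the inner normal is positive definite at every point. 3. In particular, the Hamiltonian flow on $S_E$ is dynamically convex: $\lambda_0|_{S_E}$ is a dynamically convex contact form on $S_E$, and $X_H|_{S_E}$ is a positive multiple of its Reeb vector field. 4. $S_E$ is invariant under the $\mathbb Z_3$-action generated by $\widehat g_{3,1}(x_1+ix_2,\,y_1+iy_2)=(e^{2\pi i/3}(x_1+ix_2),\,e^{2\pi i/3}(y_1+iy_2))$, and the flow descends to a dynamically convex Reeb flow on $S_E/\mathbb Z_3\equiv(L(3,2),\xi_{\rm std})$: there is a diffeomorphism $f:S^3\to S_E$ with $f\circ g_{3,2}=\widehat g_{3,1}\circ f$, hence inducing a diffeomorphism $L(3,2)\to S_E/\mathbb Z_3$, and there is a dynamically convex contact form $\lambda$ on $L(3,2)$ with $\ker\lambda=\xi_{\rm std}$ whose pullback by the projection $S^3\to L(3,2)$ is $f^*(\lambda_0|_{S_E})$. -/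

import Mathlib

open scoped Manifold ContDiff Topology

noncomputable section

/-- `ℝ⁴` with coordinates `(x₁, x₂, y₁, y₂) = (p 0, p 1, p 2, p 3)`. -/
abbrev R4 := EuclideanSpace ℝ (Fin 4)

/-- `ℝ³`, the model space of the 3-manifolds below. -/
abbrev R3 := EuclideanSpace ℝ (Fin 3)

/-- The unit sphere of `ℝ⁴`, with Mathlib's smooth structure. -/
abbrev S3 := Metric.sphere (0 : R4) 1

/-! ### One-forms and contact forms on 3-manifolds -/

section Contact

/-- One-forms on a 3-manifold (smoothness is `OneForm.IsSmooth`). -/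
abbrev OneForm (M : Type) [TopologicalSpace M] [ChartedSpace R3 M] :=
  ∀ p : M, TangentSpace (𝓡 3) p →L[ℝ] ℝ

variable {M : Type} [TopologicalSpace M] [ChartedSpace R3 M]

/-- The expression of a one-form in the preferred chart at `p`, that is, its pullback by the
inverse of this chart. -/
def OneForm.inChart (α : OneForm M) (p : M) (x : R3) : R3 →L[ℝ] ℝ :=
  (α ((extChartAt (𝓡 3) p).symm x)).comp
    (mfderiv 𝓘(ℝ, R3) (𝓡 3) (extChartAt (𝓡 3) p).symm x)

/-- A one-form is smooth if its expressions in charts are. -/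
def OneForm.IsSmooth (α : OneForm M) : Prop :=
  ∀ p : M, ContDiffOn ℝ ∞ (α.inChart p) (extChartAt (𝓡 3) p).target

/-- The exterior derivative `dα` at `p`, computed in the preferred chart at `p` with the convention
`dα(v, w) = v(α(w)) - w(α(v))` for constant vector fields `v`, `w` in the chart. -/
def OneForm.d (α : OneForm M) (p : M) (v w : TangentSpace (𝓡 3) p) : ℝ :=
  let D := fderiv ℝ (α.inChart p) (extChartAt (𝓡 3) p p)
  let v' : R3 := mfderiv (𝓡 3) 𝓘(ℝ, R3) (extChartAt (𝓡 3) p) p v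
  let w' : R3 := mfderiv (𝓡 3) 𝓘(ℝ, R3) (extChartAt (𝓡 3) p) p w
  D v' w' - D w' v'

/-- `α` is a contact form: it is smooth and `α ∧ dα` vanishes nowhere. -/
structure IsContactForm (α : OneForm M) : Prop where
  smooth : α.IsSmooth
  wedge_ne_zero : ∀ p : M, ∃ u v w : TangentSpace (𝓡 3) p,
    α p u * α.d p v w + α p v * α.d p w u + α p w * α.d p u v ≠ 0

/-- `R` is the Reeb vector field of `α`: `α(R) = 1` and `dα(R, ·) = 0`. -/
def IsReebField (α : OneForm M) (R : ∀ p : M, TangentSpace (𝓡 3) p) : Prop :=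
  ∀ p : M, α p (R p) = 1 ∧ ∀ w : TangentSpace (𝓡 3) p, α.d p (R p) w = 0

/-- `φ` is the Reeb flow of `α`. The Reeb vector field of a contact form on a closed manifold is
complete and its flow is smooth, so that there is exactly one such `φ`. -/
structure IsReebFlow (α : OneForm M) (φ : ℝ → M → M) : Prop where
  smooth : ContMDiff (𝓘(ℝ, ℝ).prod (𝓡 3)) (𝓡 3) ∞ (fun q : ℝ × M => φ q.1 q.2)
  zero : ∀ p : M, φ 0 p = p
  integralCurve : ∃ R : ∀ p : M, TangentSpace (𝓡 3) p,
    IsReebField α R ∧ ∀ p : M, IsMIntegralCurve (I := 𝓡 3) (fun t => φ t p) R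

/-! ### The Conley–Zehnder index -/

/-- For a path `Φ` of linear automorphisms of `ℂ = ℝ²` parametrized by `[0, 1]`, the set of all
numbers `(θ_v(1) - θ_v(0)) / 2π`, where `v ≠ 0` and `θ_v` is a continuous argument of `Φ t v`. -/
def rotationSet (Φ : ℝ → ℂ → ℂ) : Set ℝ :=
  {Δ | ∃ v : ℂ, v ≠ 0 ∧ ∃ θ : ℝ → ℝ, ContinuousOn θ (Set.Icc 0 1) ∧
    (∀ t ∈ Set.Icc (0 : ℝ) 1, Φ t v = (‖Φ t v‖ : ℂ) * Complex.exp ((θ t : ℂ) * Complex.I)) ∧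
    Δ = (θ 1 - θ 0) / (2 * Real.pi)}

open Classical in
/-- The (generalized) Conley–Zehnder index of a path `Φ` in `Sp(2)` starting at the identity. With
`J` the rotation set, which is a compact interval of length less than `1/2`, the index is `2k` if
`k ∈ J - ε` for all small `ε > 0`, and `2k - 1` if `J - ε ⊆ (k - 1, k)` for all small `ε > 0`.
Exactly one of these happens, for exactly one integer `k`; the value `0` in the remaining case
is never used for such a path. -/
def conleyZehnderIndex (Φ : ℝ → ℂ → ℂ) : ℤ :=
  if h : ∃ k : ℤ, ∀ᶠ ε in 𝓝[>] (0 : ℝ), ∃ Δ ∈ rotationSet Φ, Δ - ε = k then 2 * h.choose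
  else if h : ∃ k : ℤ, ∀ᶠ ε in 𝓝[>] (0 : ℝ), ∀ Δ ∈ rotationSet Φ,
      Δ - ε ∈ Set.Ioo ((k : ℝ) - 1) k then 2 * h.choose - 1
  else 0

/-- The closed unit disk. -/
abbrev ClosedDisk := Metric.closedBall (0 : ℂ) 1

/-- The boundary point `e^{2πit}` of the closed unit disk. -/
def diskBoundary (t : ℝ) : ClosedDisk :=
  ⟨Complex.exp (((2 * Real.pi * t : ℝ) : ℂ) * Complex.I), by
    simpa only [mem_closedBall_zero_iff] using (Complex.norm_exp_ofReal_mul_I _).le⟩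

/-- `u` is a capping disk of the loop `t ↦ φ_{Tt}(x)`, `t ∈ ℝ/ℤ`. -/
def IsCappingDisk (φ : ℝ → M → M) (x : M) (T : ℝ) (u : ClosedDisk → M) : Prop :=
  Continuous u ∧ ∀ t : ℝ, u (diskBoundary t) = φ (T * t) x

variable [IsManifold (𝓡 3) ∞ M]

/-- A `dα`-symplectic trivialization of the plane bundle `u^*(ker α)`, given as a
continuous frame. -/
structure IsSymplecticFrame (α : OneForm M) (u : ClosedDisk → M)
    (e₁ e₂ : ∀ z : ClosedDisk, TangentSpace (𝓡 3) (u z)) : Prop where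
  continuous_fst : Continuous (fun z => (⟨u z, e₁ z⟩ : TangentBundle (𝓡 3) M))
  continuous_snd : Continuous (fun z => (⟨u z, e₂ z⟩ : TangentBundle (𝓡 3) M))
  mem_fst : ∀ z, α (u z) (e₁ z) = 0
  mem_snd : ∀ z, α (u z) (e₂ z) = 0
  symplectic : ∀ z, α.d (u z) (e₁ z) (e₂ z) = 1

/-- The path of `2 × 2` matrices `Ψ_t ∘ dφ_{Tt} ∘ Ψ_0⁻¹` representing the linearized flow along the
loop `t ↦ φ_{Tt}(x)`, where `Ψ` is the trivialization of `ker α` given by the symplectic frame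
`e₁, e₂` over the capping disk `u`, with `ℝ² = ℂ`. The coordinates of a vector `w` of `ker α` in a
symplectic frame are `dα(w, e₂)` and `dα(e₁, w)`. -/
def linearizedPath (α : OneForm M) (φ : ℝ → M → M) (x : M) (T : ℝ) (u : ClosedDisk → M)
    (e₁ e₂ : ∀ z : ClosedDisk, TangentSpace (𝓡 3) (u z)) (t : ℝ) (v : ℂ) : ℂ :=
  let w₀ : R3 := v.re • (e₁ (diskBoundary 0) : R3) + v.im • (e₂ (diskBoundary 0) : R3)
  let w : R3 := mfderiv (𝓡 3) (𝓡 3) (φ (T * t)) x w₀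
  ⟨α.d (u (diskBoundary t)) w (e₂ (diskBoundary t)),
    α.d (u (diskBoundary t)) (e₁ (diskBoundary t)) w⟩

/-- `c₁(ker α)` vanishes on `π₂(M)`: the pullback of the oriented plane bundle `ker α` by every
continuous map `S² → M` is trivial, that is, it has a continuous nowhere vanishing section. -/
def ChernClassVanishesOnSpheres (α : OneForm M) : Prop :=
  ∀ u : Metric.sphere (0 : R3) 1 → M, Continuous u →
    ∃ e : ∀ z, TangentSpace (𝓡 3) (u z),
      Continuous (fun z => (⟨u z, e z⟩ : TangentBundle (𝓡 3) M)) ∧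
      ∀ z, α (u z) (e z) = 0 ∧ e z ≠ 0

/-- `α` is a dynamically convex contact form on the closed 3-manifold `M`: the first Chern class of
`ker α` vanishes on `π₂(M)` and every contractible periodic Reeb orbit `(x, T)` has
Conley–Zehnder index at least `3`, computed in a trivialization that extends over a capping disk. -/
structure IsDynamicallyConvex [CompactSpace M] [T2Space M] (α : OneForm M) : Prop where
  contact : IsContactForm α
  chern : ChernClassVanishesOnSpheres α
  index : ∀ φ : ℝ → M → M, IsReebFlow α φ → ∀ (x : M) (T : ℝ), 0 < T → φ T x = x →
    ∀ u : ClosedDisk → M, IsCappingDisk φ x T u →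
    ∀ e₁ e₂ : ∀ z : ClosedDisk, TangentSpace (𝓡 3) (u z), IsSymplecticFrame α u e₁ e₂ →
      3 ≤ conleyZehnderIndex (linearizedPath α φ x T u e₁ e₂)

end Contact

/-! ### The Liouville form and hypersurfaces of `ℝ⁴` -/

/-- The Liouville form `λ₀ = ½ ∑ (yᵢ dxᵢ - xᵢ dyᵢ)` at `p`. -/
def liouville (p : R4) : R4 →L[ℝ] ℝ :=
  (1 / 2 : ℝ) • (p 2 • EuclideanSpace.proj 0 - p 0 • EuclideanSpace.proj 2
    + p 3 • EuclideanSpace.proj 1 - p 1 • EuclideanSpace.proj 3)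

/-- The symplectic form `ω₀ = ∑ dyᵢ ∧ dxᵢ = dλ₀`. -/
def omega (v w : R4) : ℝ :=
  (v 2 * w 0 - v 0 * w 2) + (v 3 * w 1 - v 1 * w 3)

/-- `X` is the value at `p` of the Hamiltonian vector field of `H`: `ω₀(X, ·) = -dH`. -/
def IsHamiltonianVector (H : R4 → ℝ) (p X : R4) : Prop :=
  ∀ v : R4, omega X v = -(fderiv ℝ H p v)

/-- `f` is a smooth embedding of the 3-sphere in `ℝ⁴` with image `S`. (An injective immersion of a
compact manifold is an embedding.) -/
structure IsSphereParametrization (f : S3 → R4) (S : Set R4) : Prop where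
  smooth : ContMDiff (𝓡 3) 𝓘(ℝ, R4) ∞ f
  immersion : ∀ z, Function.Injective (mfderiv (𝓡 3) 𝓘(ℝ, R4) f z)
  injective : Function.Injective f
  range_eq : Set.range f = S

/-- `S` is a sphere-like component of `H⁻¹(E)`: a connected component which is an embedded
3-sphere. -/
def IsSphereLikeComponent (H : R4 → ℝ) (E : ℝ) (S : Set R4) : Prop :=
  (∃ p ∈ H ⁻¹' {E}, S = connectedComponentIn (H ⁻¹' {E}) p) ∧
    ∃ f : S3 → R4, IsSphereParametrization f S

/-- `S` is a strictly convex hypersurface: the boundary of a strictly convex compact set `K` with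
nonempty interior, with positive definite second fundamental form with respect to the inner normal:
near each of its points `p` it is a regular level set `{F = 0}`, with `K` given by `F ≤ 0`, such
that the Hessian of `F` at `p` is positive definite on the tangent space `ker dF_p`. -/
def IsStrictlyConvexHypersurface (S : Set R4) : Prop :=
  ∃ K : Set R4, IsCompact K ∧ StrictConvex ℝ K ∧ (interior K).Nonempty ∧ frontier K = S ∧
    ∀ p ∈ S, ∃ (U : Set R4) (F : R4 → ℝ), IsOpen U ∧ p ∈ U ∧ ContDiffOn ℝ ∞ F U ∧
      (∀ q ∈ U, (q ∈ K ↔ F q ≤ 0) ∧ (q ∈ S ↔ F q = 0)) ∧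
      fderiv ℝ F p ≠ 0 ∧
      ∀ v : R4, v ≠ 0 → fderiv ℝ F p v = 0 → 0 < fderiv ℝ (fderiv ℝ F) p v v

/-- The pullback `f^*λ₀` of the Liouville form to the 3-sphere. -/
def liouvillePullback (f : S3 → R4) : OneForm S3 :=
  fun z => (liouville (f z)).comp (mfderiv (𝓡 3) 𝓘(ℝ, R4) f z)

/-- The pullback of a one-form by a map of 3-manifolds. -/
def OneForm.pullback {M N : Type} [TopologicalSpace M] [ChartedSpace R3 M] [TopologicalSpace N]
    [ChartedSpace R3 N] (f : N → M) (α : OneForm M) : OneForm N :=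
  fun z => (α (f z)).comp (mfderiv (𝓡 3) (𝓡 3) f z)

/-! ### The Hénon–Heiles Hamiltonian -/

/-- The Hénon–Heiles potential. -/
def henonPotential (x₁ x₂ : ℝ) : ℝ :=
  (x₁ ^ 2 + x₂ ^ 2) / 2 + x₁ ^ 2 * x₂ - x₂ ^ 3 / 3

/-- The Hénon–Heiles Hamiltonian `½ (y₁² + y₂²) + V(x₁, x₂)`. -/
def henonHeiles (p : R4) : ℝ :=
  (p 2 ^ 2 + p 3 ^ 2) / 2 + henonPotential (p 0) (p 1)

/-- The generator of the `ℤ/3`-symmetry of the Hénon–Heiles Hamiltonian: multiplication of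
`(x₁ + i x₂, y₁ + i y₂)` by `e^{2πi/3}`. -/
def henonRotation (p : R4) : R4 :=
  let c := Real.cos (2 * Real.pi / 3)
  let s := Real.sin (2 * Real.pi / 3)
  !₂[c * p 0 - s * p 1, s * p 0 + c * p 1, c * p 2 - s * p 3, s * p 2 + c * p 3]

/-! ### Lens spaces -/

/-- The map `(z₁, z₂) ↦ (e^{ia} z₁, e^{ib} z₂)` of `ℂ² = ℝ⁴`, where `z₁ = x₁ + i y₁` and
`z₂ = x₂ + i y₂`. -/
def rotFun (a b : ℝ) (p : R4) : R4 :=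
  !₂[Real.cos a * p 0 - Real.sin a * p 2, Real.cos b * p 1 - Real.sin b * p 3,
    Real.sin a * p 0 + Real.cos a * p 2, Real.sin b * p 1 + Real.cos b * p 3]

lemma rotFun_add (a b a' b' : ℝ) (p : R4) :
    rotFun a b (rotFun a' b' p) = rotFun (a + a') (b + b') p := by
  ext i
  fin_cases i <;> simp [rotFun, Real.cos_add, Real.sin_add] <;> ring

lemma rotFun_zero (p : R4) : rotFun 0 0 p = p := by
  ext i
  fin_cases i <;> simp [rotFun]

/-- `rotFun a b` as a linear isometry. -/
def rot (a b : ℝ) : R4 ≃ₗᵢ[ℝ] R4 where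
  toFun := rotFun a b
  invFun := rotFun (-a) (-b)
  map_add' p q := by
    ext i
    fin_cases i <;> simp [rotFun] <;> ring
  map_smul' c p := by
    ext i
    fin_cases i <;> simp [rotFun] <;> ring
  left_inv p := by simp [rotFun_add, rotFun_zero]
  right_inv p := by simp [rotFun_add, rotFun_zero]
  norm_map' p := by
    have h : ‖rotFun a b p‖ ^ 2 = ‖p‖ ^ 2 := by
      simp only [EuclideanSpace.norm_sq_eq, Fin.sum_univ_four, Real.norm_eq_abs, sq_abs]
      simp [rotFun]
      linear_combination (p 0 ^ 2 + p 2 ^ 2) * Real.sin_sq_add_cos_sq a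
        + (p 1 ^ 2 + p 3 ^ 2) * Real.sin_sq_add_cos_sq b
    exact (sq_eq_sq₀ (norm_nonneg _) (norm_nonneg _)).1 h

lemma rot_apply (a b : ℝ) (p : R4) : rot a b p = rotFun a b p := rfl

/-- The generator `g_{p,q}(z₁, z₂) = (e^{2πi/p} z₁, e^{2πiq/p} z₂)`. -/
def lensGenerator (p q : ℕ) : R4 ≃ₗᵢ[ℝ] R4 :=
  rot (2 * Real.pi / p) (2 * Real.pi * q / p)

/-- The group generated by `g_{p,q}`, cyclic of order `p`. -/
abbrev lensGroup (p q : ℕ) : Subgroup (R4 ≃ₗᵢ[ℝ] R4) :=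
  Subgroup.zpowers (lensGenerator p q)

/-- Linear isometries act on the unit sphere. -/
instance sphereAction : MulAction (R4 ≃ₗᵢ[ℝ] R4) S3 where
  smul g z := ⟨g z, by simp⟩
  one_smul z := Subtype.ext rfl
  mul_smul g h z := Subtype.ext rfl

lemma coe_smul_sphere (g : R4 ≃ₗᵢ[ℝ] R4) (z : S3) : ((g • z : S3) : R4) = g z := rfl

instance : ContinuousConstSMul (R4 ≃ₗᵢ[ℝ] R4) S3 where
  continuous_const_smul g := by
    refine Continuous.subtype_mk ?_ _
    exact g.continuous.comp continuous_subtype_val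

instance (Γ : Subgroup (R4 ≃ₗᵢ[ℝ] R4)) : ContinuousConstSMul Γ S3 where
  continuous_const_smul g := continuous_const_smul (g : R4 ≃ₗᵢ[ℝ] R4)

lemma contMDiff_smul_sphere (g : R4 ≃ₗᵢ[ℝ] R4) :
    ContMDiff (𝓡 3) (𝓡 3) ∞ (fun z : S3 => g • z) := by
  have : Fact (Module.finrank ℝ R4 = 3 + 1) := ⟨by simp⟩
  refine ContMDiff.codRestrict_sphere (f := fun z : S3 => g (z : R4)) ?_ _
  exact g.toContinuousLinearEquiv.contDiff.contMDiff.comp contMDiff_coe_sphere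

lemma rot_zpow (a b : ℝ) (k : ℤ) : rot a b ^ k = rot (k * a) (k * b) := by
  have hadd : ∀ a b a' b' : ℝ, rot a b * rot a' b' = rot (a + a') (b + b') := fun a b a' b' => by
    ext1 p
    exact rotFun_add a b a' b' p
  have hzero : rot 0 0 = 1 := by
    ext1 p
    exact rotFun_zero p
  induction k with
  | zero => simp [hzero]
  | succ n ih => rw [zpow_add_one, ih, hadd]; push_cast; congr 1 <;> ring
  | pred n ih =>
    rw [zpow_sub_one, ih, mul_inv_eq_iff_eq_mul, hadd]; push_cast; congr 1 <;> ring

lemma cos_eq_one_of_rot_fix {a x y : ℝ} (h1 : Real.cos a * x - Real.sin a * y = x)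
    (h2 : Real.sin a * x + Real.cos a * y = y) (h : x ≠ 0 ∨ y ≠ 0) : Real.cos a = 1 := by
  have hpos : x ^ 2 + y ^ 2 ≠ 0 := by
    rcases h with h | h <;> positivity
  have h3 : (Real.cos a - 1) * (x ^ 2 + y ^ 2) = 0 := by linear_combination x * h1 + y * h2
  have := (mul_eq_zero.1 h3).resolve_right hpos
  linarith

lemma lensGenerator_zpow_eq_one {p q : ℕ} (hp : p ≠ 0) {k : ℤ} (hk : (p : ℤ) ∣ k) :
    lensGenerator p q ^ k = 1 := by
  obtain ⟨n, rfl⟩ := hk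
  have hp' : (p : ℝ) ≠ 0 := by exact_mod_cast hp
  have ha : (((p * n : ℤ) : ℝ)) * (2 * Real.pi / p) = (n : ℤ) * (2 * Real.pi) := by
    push_cast; field_simp
  have hb : (((p * n : ℤ) : ℝ)) * (2 * Real.pi * q / p) = ((n * q : ℤ) : ℝ) * (2 * Real.pi) := by
    push_cast; field_simp
  have hs : ∀ m : ℤ, Real.sin ((m : ℝ) * (2 * Real.pi)) = 0 := fun m => by
    have := Real.sin_int_mul_pi (m * 2)
    rw [← this]; push_cast; ring_nf
  rw [lensGenerator, rot_zpow, ha, hb]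
  ext1 z
  rw [rot_apply]
  ext i
  fin_cases i <;> simp [rotFun, Real.cos_int_mul_two_pi, hs, -Int.cast_mul]

lemma lensGenerator_zpow_eq_one_of_fix {p q : ℕ} (hp : p ≠ 0) (hpq : p.Coprime q) {k : ℤ} {z : S3}
    (hz : (lensGenerator p q ^ k) (z : R4) = z) : lensGenerator p q ^ k = 1 := by
  have hp' : (p : ℝ) ≠ 0 := by exact_mod_cast hp
  apply lensGenerator_zpow_eq_one hp
  rw [lensGenerator, rot_zpow, rot_apply] at hz
  set w : R4 := (z : R4) with hw
  have hw0 : w ≠ 0 := by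
    have hn : ‖w‖ = 1 := by simp [hw]
    intro h
    rw [h] at hn
    simp at hn
  have e0 := congrArg (fun v : R4 => v 0) hz
  have e1 := congrArg (fun v : R4 => v 1) hz
  have e2 := congrArg (fun v : R4 => v 2) hz
  have e3 := congrArg (fun v : R4 => v 3) hz
  simp [rotFun] at e0 e1 e2 e3
  by_cases h : w 0 ≠ 0 ∨ w 2 ≠ 0
  · obtain ⟨n, hn⟩ := (Real.cos_eq_one_iff _).1 (cos_eq_one_of_rot_fix e0 e2 h)
    refine ⟨n, ?_⟩
    field_simp at hn
    have : (k : ℝ) = p * n := by linarith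
    exact_mod_cast this
  · have h' : w 1 ≠ 0 ∨ w 3 ≠ 0 := by
      by_contra hcon
      push Not at h hcon
      apply hw0
      ext i
      fin_cases i <;> simp [h.1, h.2, hcon.1, hcon.2]
    obtain ⟨n, hn⟩ := (Real.cos_eq_one_iff _).1 (cos_eq_one_of_rot_fix e1 e3 h')
    field_simp at hn
    have h2 : (k : ℝ) * q = p * n := by linarith
    have h3 : k * q = p * n := by exact_mod_cast h2
    have hc : IsCoprime (p : ℤ) (q : ℤ) := Nat.isCoprime_iff_coprime.2 hpq
    exact hc.dvd_of_dvd_mul_right ⟨n, h3⟩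

instance (p q : ℕ) [NeZero p] : Finite (lensGroup p q) := by
  have h : lensGenerator p q ^ p = 1 := by
    have := lensGenerator_zpow_eq_one (q := q) (NeZero.ne p) (dvd_refl (p : ℤ))
    exact_mod_cast this
  exact (isOfFinOrder_iff_pow_eq_one.2 ⟨p, Nat.pos_of_ne_zero (NeZero.ne p), h⟩).finite_zpowers

instance (p q : ℕ) [NeZero p] [Fact (p.Coprime q)] : IsCancelSMul (lensGroup p q) S3 := by
  refine isCancelSMul_iff_eq_one_of_smul_eq.2 ?_
  rintro ⟨g, k, rfl⟩ z hz
  refine Subtype.ext ?_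
  exact lensGenerator_zpow_eq_one_of_fix (NeZero.ne p) Fact.out (congrArg Subtype.val hz)

section Quotient

variable {M : Type*} [TopologicalSpace M] {G : Type*} [Group G] [MulAction G M]
  [ProperlyDiscontinuousSMul G M] [ContinuousConstSMul G M] [IsCancelSMul G M]
  [T2Space M] [LocallyCompactSpace M] [ChartedSpace R3 M] [IsManifold (𝓡 3) ∞ M]

/-- The quotient of a 3-manifold by a free, properly discontinuous, smooth action, with Mathlib's
charts (local inverses of the projection followed by charts), is a smooth manifold. -/
theorem isManifold_orbitQuotient
    (hG : ∀ g : G, ContMDiff (𝓡 3) (𝓡 3) ∞ (fun z : M => g • z)) :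
    IsManifold (𝓡 3) ∞ (MulAction.orbitRel.Quotient G M) := by
  have hq : IsQuotientCoveringMap (Quotient.mk (MulAction.orbitRel G M)) G :=
    isQuotientCoveringMap_quotientMk_of_properlyDiscontinuousSMul
  have hl := hq.isCoveringMap.isLocalHomeomorph
  set π : M → MulAction.orbitRel.Quotient G M := Quotient.mk (MulAction.orbitRel G M) with hπ
  apply isManifold_of_contDiffOn
  rintro e e' ⟨a, rfl⟩ ⟨b, rfl⟩
  have hsurj : Function.Surjective π := Quotient.mk_surjective
  generalize hsurj.hasRightInverse.choose a = z
  generalize hsurj.hasRightInverse.choose b = z'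
  change ContDiffOn ℝ ∞ ((((hl.localInverseAt z).trans (chartAt R3 z)).symm.trans
    ((hl.localInverseAt z').trans (chartAt R3 z'))))
    ((((hl.localInverseAt z).trans (chartAt R3 z)).symm.trans
    ((hl.localInverseAt z').trans (chartAt R3 z'))).source ∩ Set.range id)
  rintro x ⟨hx, -⟩
  simp only [OpenPartialHomeomorph.trans_source, OpenPartialHomeomorph.symm_source,
    OpenPartialHomeomorph.trans_target, Set.mem_inter_iff, Set.mem_preimage,
    OpenPartialHomeomorph.coe_trans_symm, Function.comp_apply,
    IsLocalHomeomorph.localInverseAt_symm] at hx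
  obtain ⟨⟨hx1, hx2⟩, hx3, hx4⟩ := hx
  set y := (chartAt R3 z).symm x with hy
  have hyπ : π (hl.localInverseAt z' (π y)) = π y := hl.apply_localInverseAt_of_mem hx3
  obtain ⟨g, hg⟩ := hq.apply_eq_iff_mem_orbit.1 hyπ
  have hg' : g • y = hl.localInverseAt z' (π y) := hg
  have hmem : g • y ∈ (hl.localInverseAt z').target := by
    rw [hg']; exact (hl.localInverseAt z').map_source hx3
  have hcont : ContinuousAt (chartAt R3 z).symm x :=
    (chartAt R3 z).continuousAt_symm hx1
  have hev : ∀ᶠ x' in 𝓝 x, (((hl.localInverseAt z).trans (chartAt R3 z)).symm.trans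
      ((hl.localInverseAt z').trans (chartAt R3 z'))) x' =
      chartAt R3 z' (g • (chartAt R3 z).symm x') := by
    have h1 : ∀ᶠ x' in 𝓝 x, g • (chartAt R3 z).symm x' ∈ (hl.localInverseAt z').target :=
      ((continuous_const_smul g).continuousAt.comp hcont).eventually
        ((hl.localInverseAt z').open_target.mem_nhds hmem)
    filter_upwards [h1] with x' h1
    simp only [OpenPartialHomeomorph.coe_trans_symm, OpenPartialHomeomorph.coe_trans,
      Function.comp_apply, IsLocalHomeomorph.localInverseAt_symm]
    congr 1
    have h2 : π ((chartAt R3 z).symm x') = π (g • (chartAt R3 z).symm x') :=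
      (hq.map_smul g).symm
    change hl.localInverseAt z' (π ((chartAt R3 z).symm x')) = _
    rw [h2]
    have h3 := (hl.localInverseAt z').right_inv h1
    rwa [IsLocalHomeomorph.localInverseAt_symm] at h3
  have hd : ContDiffAt ℝ ∞ (fun x' => chartAt R3 z' (g • (chartAt R3 z).symm x')) x := by
    rw [← contMDiffAt_iff_contDiffAt]
    have c1 : ContMDiffAt 𝓘(ℝ, R3) (𝓡 3) ∞ (chartAt R3 z).symm x :=
      (contMDiffOn_chart_symm (I := 𝓡 3) (x := z)).contMDiffAt
        ((chartAt R3 z).open_target.mem_nhds hx1)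
    have c2 := (hG g).contMDiffAt (x := (chartAt R3 z).symm x)
    have c3 : ContMDiffAt (𝓡 3) 𝓘(ℝ, R3) ∞ (chartAt R3 z') (g • (chartAt R3 z).symm x) :=
      (contMDiffOn_chart (I := 𝓡 3) (x := z')).contMDiffAt
        ((chartAt R3 z').open_source.mem_nhds (by rw [← hy, hg']; exact hx4))
    exact c3.comp x (c2.comp x c1)
  exact (hd.congr_of_eventuallyEq hev).contDiffWithinAt

end Quotient

/-- The lens space `L(p, q)`, the orbit space of the action on the 3-sphere generated by `g_{p,q}`. -/
abbrev LensSpace (p q : ℕ) := MulAction.orbitRel.Quotient (lensGroup p q) S3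

/-- The projection `S³ → L(p, q)`. -/
def lensProj (p q : ℕ) : S3 → LensSpace p q := Quotient.mk _

instance (p q : ℕ) [NeZero p] [Fact (p.Coprime q)] : IsManifold (𝓡 3) ∞ (LensSpace p q) :=
  isManifold_orbitQuotient fun g => contMDiff_smul_sphere (g : R4 ≃ₗᵢ[ℝ] R4)

instance : Fact (Nat.Coprime 3 2) := ⟨by norm_num⟩

/-- The standard contact structure `ξ_std` on `L(p, q)`, as a subset of the tangent bundle: the image
of the contact structure `ker λ₀` of the 3-sphere under the projection. -/
def lensContactStructure (p q : ℕ) [NeZero p] [Fact (p.Coprime q)] :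
    Set (TangentBundle (𝓡 3) (LensSpace p q)) :=
  tangentMap (𝓡 3) (𝓡 3) (lensProj p q) ''
    {w : TangentBundle (𝓡 3) S3 | liouvillePullback (fun z => (z : R4)) w.proj w.snd = 0}

end

/-!
Below the energy `1/6` of its saddles, the Hénon–Heiles potential confines the configurations of the
bounded part of `H = E` to the unit disc (`configSq_ne_one`). The bounded part is parametrized by the
radial projection from the unit sphere: along a ray the energy equation is a cubic with exactly one
suitable root, which depends smoothly on the direction (`isSphereParametrization_henonRadial`). All other
components are noncompact, as configurations outside the disc can be scaled up at constant energy
(`not_isCompact_connectedComponentIn`), so the bounded part `henonSphere E` is the only spherical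
component.

*Convexity.* The Hessian of `H` is positive definite on the tangent spaces of `henonSphere E`
(`inner_henonHess_pos`); for a vector with nonzero configuration part this comes down to the positivity
of a polynomial in `|x|²` and `|y|²`. Local convexity implies global convexity by continuity
(`henonHeiles_segment_lt`): a segment between points of the body, scaled towards the origin, cannot touch
the boundary from inside while it is scaled back.

*The lens space.* In the coordinates `z_j = x_j + i y_j` of `ℂ²`, the map `henonRotation` is unitary, and
`eigenRotation` is a unitary change of basis that diagonalizes it, with eigenvalues `e^{±2πi/3}`. The radial parametrization composed with it is
therefore equivariant, and it multiplies `λ₀` by a positive function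
(`liouvillePullback_henonRadial`), so that the induced contact structure on `L(3,2)` is the standard one.

The contact geometry is done once, for all smooth coverings `π : S³ → M` whose deck transformations act
on the energy surface by linear symmetries (`IsHenonCover`); it is applied to the identity of `S³` and to
`S³ → L(3,2)`. Such an `M` is locally a piece of the energy surface, with the restriction of `λ₀`
(`IsLiouvilleModel`). The contact condition and the form of the Reeb vector field are computed in these
models, and the first Chern class vanishes because the projection of `j p` to the contact structure,
`contactSection`, is a global nowhere vanishing section.

*The index.* Let `γ` be a closed Reeb orbit, `N` the gradient of `H` along it, and `v` a solution of the
linearized equation that is not parallel to the orbit direction `i N`. The vectors `j N, k N` trivialize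
the tangent plane modulo `i N`, and it is to be shown that the coordinates `V` of `v` make more than one
full turn (`IsConvexOrbit.two_pi_lt_of_closed`). It suffices to consider the time between two consecutive
visits of a point `γ(c)`. At time `t` let `σ = γ(c) - γ(t)`, and let `B` be the combination of `v` and
`i N` that is `ω₀`-orthogonal to `σ` (`secantVector`). By strict convexity `σ` is transverse to the
tangent spaces at `γ(t)` and at `γ(c)`. The projection of `B` along `σ` to the tangent space at `γ(c)` has
coordinates `ψ` in a fixed frame, and the positivity of the Hessian makes `ψ` turn counterclockwise
(`im_conj_frameCoord_projectedVector_pos`). On the other hand, the coordinates `w` of `B` in the frame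
`j σ, k σ` make an acute angle with `ψ` and with `-V` (`re_conj_frameCoord_mul_pos`). The expansions of
`w` and `ψ` at the end points show that the argument of `ψ` accounts for that of `V` except for one full
turn (`two_pi_lt_of_comparison`). Over a capping disk, which lifts to `S³`, this frame is isotopic to any
other orientation preserving trivialization, and the property of making more than a full turn is invariant under such isotopies
(`two_pi_lt_of_frame_change`). A path that turns every vector by more than `2π` has index at least `3`
(`three_le_conleyZehnderIndex`).
-/

noncomputable section

/-! ### Continuous arguments of complex-valued functions -/

/-- A nowhere vanishing continuous function on a convex set has a continuous logarithm. -/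
lemma Convex.exists_continuous_exp_eq {V : Type*} [NormedAddCommGroup V] [NormedSpace ℝ V]
    {S : Set V} (hS : Convex ℝ S) (hne : S.Nonempty) (g : S → ℂ) (hg : Continuous g)
    (h0 : ∀ x, g x ≠ 0) : ∃ l : S → ℂ, Continuous l ∧ ∀ x, Complex.exp (l x) = g x := by
  have : LocallyPathConnectedSpace S := hS.locallyPathConnectedSpace
  have : ContractibleSpace S := hS.contractibleSpace hne
  obtain ⟨x₀, hx₀⟩ := hne
  obtain ⟨F, ⟨-, hF⟩, -⟩ := Complex.isCoveringMapOn_exp.existsUnique_continuousMap_lifts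
    ⟨g, hg⟩ (a₀ := ⟨x₀, hx₀⟩) (Complex.exp_log (h0 ⟨x₀, hx₀⟩)) (fun x => h0 x)
  exact ⟨F, F.continuous, fun x => congrFun hF x⟩

/-- `θ` is a continuous argument of `z` on `S`. -/
structure IsArgOn (z : ℝ → ℂ) (θ : ℝ → ℝ) (S : Set ℝ) : Prop where
  cont : ContinuousOn θ S
  eq : ∀ t ∈ S, z t = (‖z t‖ : ℂ) * Complex.exp ((θ t : ℂ) * Complex.I)

lemma exp_mul_I_eq_iff {a b : ℝ} :
    Complex.exp ((a : ℂ) * Complex.I) = Complex.exp ((b : ℂ) * Complex.I) ↔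
      ∃ n : ℤ, a = b + n * (2 * Real.pi) := by
  rw [Complex.exp_eq_exp_iff_exists_int]
  refine exists_congr fun n => ?_
  rw [show (b : ℂ) * Complex.I + n * (2 * Real.pi * Complex.I)
    = ((b + n * (2 * Real.pi) : ℝ) : ℂ) * Complex.I by push_cast; ring]
  rw [mul_left_inj' Complex.I_ne_zero, Complex.ofReal_inj]

/-- A continuous function on a preconnected set with values in `2πℤ` is constant. -/
lemma eq_of_continuousOn_of_mem_two_pi_int {X : Type*} [TopologicalSpace X] {S : Set X}
    (hS : IsPreconnected S) {f : X → ℝ} (hf : ContinuousOn f S)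
    (h : ∀ t ∈ S, ∃ n : ℤ, f t = n * (2 * Real.pi)) {s t : X} (hs : s ∈ S) (ht : t ∈ S) :
    f s = f t := by
  have hc : ContinuousOn (fun t => f t / (2 * Real.pi)) S := hf.div_const _
  have hd : DiscreteTopology (Set.range ((↑) : ℤ → ℝ)) :=
    (Int.isClosedEmbedding_coe_real.isEmbedding.toHomeomorph.symm.isEmbedding).discreteTopology
  have hm : Set.MapsTo (fun t => f t / (2 * Real.pi)) S (Set.range ((↑) : ℤ → ℝ)) := by
    intro t ht
    obtain ⟨n, hn⟩ := h t ht
    refine ⟨n, ?_⟩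
    simp only [hn]
    field_simp
  have := hS.constant_of_mapsTo ⟨hd⟩ hc hm hs ht
  simpa [div_left_inj', Real.pi_ne_zero] using this

lemma IsArgOn.sub_eq_sub {z : ℝ → ℂ} {θ θ' : ℝ → ℝ} {S : Set ℝ} (hS : IsPreconnected S)
    (h : IsArgOn z θ S) (h' : IsArgOn z θ' S) (h0 : ∀ t ∈ S, z t ≠ 0) {s t : ℝ} (hs : s ∈ S)
    (ht : t ∈ S) : θ t - θ s = θ' t - θ' s := by
  have := eq_of_continuousOn_of_mem_two_pi_int hS (h.cont.sub h'.cont) (fun t ht => by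
    have e := (h.eq t ht).symm.trans (h'.eq t ht)
    have hz : (‖z t‖ : ℂ) ≠ 0 := by simpa using h0 t ht
    obtain ⟨n, hn⟩ := exp_mul_I_eq_iff.1 (mul_left_cancel₀ hz e)
    exact ⟨n, by rw [Pi.sub_apply, hn]; ring⟩) hs ht
  simp only [Pi.sub_apply] at this
  linarith

lemma IsArgOn.mono {z : ℝ → ℂ} {θ : ℝ → ℝ} {S T : Set ℝ} (h : IsArgOn z θ S) (hT : T ⊆ S) :
    IsArgOn z θ T := ⟨h.cont.mono hT, fun t ht => h.eq t (hT ht)⟩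

lemma IsArgOn.exp_eq {z : ℝ → ℂ} {θ : ℝ → ℝ} {S : Set ℝ} (h : IsArgOn z θ S) {t : ℝ} (ht : t ∈ S)
    (h0 : z t ≠ 0) : Complex.exp ((θ t : ℂ) * Complex.I) = z t / ‖z t‖ := by
  have hz : (‖z t‖ : ℂ) ≠ 0 := by simpa using h0
  rw [eq_div_iff hz, mul_comm]
  exact (h.eq t ht).symm

lemma exp_arg_mul_I {z : ℂ} (hz : z ≠ 0) :
    Complex.exp ((Complex.arg z : ℂ) * Complex.I) = z / ‖z‖ := by
  have h : (‖z‖ : ℂ) ≠ 0 := by simpa using hz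
  rw [eq_div_iff h, mul_comm]
  exact Complex.norm_mul_exp_arg_mul_I z

/-- A continuous argument of a differentiable nonvanishing curve is differentiable. -/
lemma IsArgOn.hasDerivAt {z : ℝ → ℂ} {θ : ℝ → ℝ} {S : Set ℝ} (hS : IsOpen S) (h : IsArgOn z θ S)
    {t : ℝ} (ht : t ∈ S) (h0 : ∀ t ∈ S, z t ≠ 0) {z' : ℂ} (hz : HasDerivAt z z' t) :
    HasDerivAt θ (z' / z t).im t := by
  have hzt := h0 t ht
  have hd : HasDerivAt (fun s => z s / z t) (z' / z t) t := hz.div_const _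
  have hl : HasDerivAt (fun s => Complex.log (z s / z t)) (z' / z t) t := by
    have := hd.clog_real (by rw [div_self hzt]; exact Complex.one_mem_slitPlane)
    simpa [div_self hzt] using this
  have him : HasDerivAt (fun s => θ t + (Complex.log (z s / z t)).im) (z' / z t).im t := by
    have := (Complex.imCLM.hasFDerivAt.comp_hasDerivAt t hl).const_add (θ t)
    simpa using this
  refine him.congr_of_eventuallyEq ?_
  have hc : ContinuousAt (fun s => θ s - θ t) t :=
    (h.cont.continuousAt (hS.mem_nhds ht)).sub continuousAt_const
  have h1 : ∀ᶠ s in 𝓝 t, θ s - θ t ∈ Set.Ioo (-Real.pi) Real.pi :=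
    hc.eventually_mem (by simpa using Ioo_mem_nhds (neg_lt_zero.2 Real.pi_pos) Real.pi_pos)
  filter_upwards [h1, hS.mem_nhds ht] with s hs hsS
  have hzs := h0 s hsS
  have e : z s / z t = (‖z s‖ / ‖z t‖ : ℝ) * Complex.exp (((θ s - θ t : ℝ) : ℂ) * Complex.I) := by
    push_cast
    rw [sub_mul, Complex.exp_sub, h.exp_eq hsS hzs, h.exp_eq ht hzt]
    have a1 : (‖z s‖ : ℂ) ≠ 0 := by simpa using hzs
    have a2 : (‖z t‖ : ℂ) ≠ 0 := by simpa using hzt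
    field_simp
  rw [Complex.log_im, e, Complex.arg_real_mul _ (by positivity), Complex.arg_exp_mul_I,
    (toIocMod_eq_self _).2 ⟨hs.1, by linarith [hs.2]⟩]
  ring

lemma im_div_pos_iff {z w : ℂ} (hw : w ≠ 0) : 0 < (z / w).im ↔ 0 < (starRingEnd ℂ w * z).im := by
  rw [div_eq_mul_inv, Complex.inv_def, ← mul_assoc, Complex.im_mul_ofReal, mul_comm z]
  exact mul_pos_iff_of_pos_right (inv_pos.2 (Complex.normSq_pos.2 hw))

lemma re_div_pos_iff {z w : ℂ} (hw : w ≠ 0) : 0 < (z / w).re ↔ 0 < (starRingEnd ℂ w * z).re := by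
  rw [div_eq_mul_inv, Complex.inv_def, ← mul_assoc, Complex.re_mul_ofReal, mul_comm z]
  exact mul_pos_iff_of_pos_right (inv_pos.2 (Complex.normSq_pos.2 hw))

/-- A curve that turns counterclockwise has an increasing argument. -/
lemma IsArgOn.strictMonoOn {z z' : ℝ → ℂ} {θ : ℝ → ℝ} {S : Set ℝ} (hS : IsOpen S)
    (hS' : Convex ℝ S) (h : IsArgOn z θ S) (hz : ∀ t ∈ S, HasDerivAt z (z' t) t)
    (hpos : ∀ t ∈ S, 0 < (starRingEnd ℂ (z t) * z' t).im) : StrictMonoOn θ S := by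
  have h0 : ∀ t ∈ S, z t ≠ 0 := fun t ht e => by
    have := hpos t ht
    simp [e] at this
  refine strictMonoOn_of_deriv_pos hS' h.cont fun t ht => ?_
  rw [hS.interior_eq] at ht
  rw [(h.hasDerivAt hS ht h0 (hz t ht)).deriv, im_div_pos_iff (h0 t ht)]
  exact hpos t ht

/-! ### A winding estimate -/

/-- Two limits of `arg (w / ψ)` and `arg (-V / w)` at an endpoint where, with `τ` the signed distance to
it, `w ∼ -iκτ³V` and `ψ ∼ κ'τ⁴V`. -/
lemma tendsto_arg_of_expansion {V w ψ : ℝ → ℂ} {c κ κ' : ℝ} (hκ : 0 < κ) (hκ' : 0 < κ')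
    {l : Filter ℝ} {ε : ℝ} (hε : ε = 1 ∨ ε = -1)
    (hl : ∀ᶠ t in l, 0 < ε * (t - c)) (hV : Filter.Tendsto V l (𝓝 (V c))) (hVc : V c ≠ 0)
    (hw : Filter.Tendsto (fun t => (((t - c) ^ 3)⁻¹ : ℝ) • w t) l
      (𝓝 (-(Complex.I * κ * V c))))
    (hψ : Filter.Tendsto (fun t => (((t - c) ^ 4)⁻¹ : ℝ) • ψ t) l (𝓝 (κ' * V c))) :
    Filter.Tendsto (fun t => Complex.arg (w t / ψ t)) l (𝓝 (-ε * (Real.pi / 2))) ∧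
    Filter.Tendsto (fun t => Complex.arg (-V t / w t)) l (𝓝 (-ε * (Real.pi / 2))) := by
  have hκc : (κ : ℂ) ≠ 0 := by exact_mod_cast hκ.ne'
  have hκc' : (κ' : ℂ) ≠ 0 := by exact_mod_cast hκ'.ne'
  have hε2 : ε * ε = 1 := by rcases hε with h | h <;> rw [h] <;> norm_num
  have harg : ∀ r : ℝ, 0 < r → Complex.arg (((-ε * r : ℝ) : ℂ) * Complex.I) = -ε * (Real.pi / 2) := by
    intro r hr
    rcases hε with h | h <;> subst h
    · rw [show (((-1 * r : ℝ) : ℂ) * Complex.I) = (r : ℂ) * (-Complex.I) by push_cast; ring,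
        Complex.arg_real_mul _ hr, Complex.arg_neg_I]; ring
    · rw [show (((- -1 * r : ℝ) : ℂ) * Complex.I) = (r : ℂ) * (Complex.I) by push_cast; ring,
        Complex.arg_real_mul _ hr, Complex.arg_I]; ring
  have hslit : ∀ r : ℝ, 0 < r → (((-ε * r : ℝ) : ℂ) * Complex.I) ∈ Complex.slitPlane := by
    intro r hr
    right
    simp
    refine ⟨by rintro rfl; norm_num at hε, hr.ne'⟩
  constructor
  · have h1 := (hw.div hψ (mul_ne_zero hκc' hVc)).const_mul (ε : ℂ)
    have e1 : (ε : ℂ) * (-(Complex.I * κ * V c) / (κ' * V c)) =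
        ((-ε * (κ / κ') : ℝ) : ℂ) * Complex.I := by
      push_cast; field_simp
    rw [e1] at h1
    have h2 := (Complex.continuousAt_arg (hslit _ (div_pos hκ hκ'))).tendsto.comp h1
    rw [harg _ (div_pos hκ hκ')] at h2
    refine h2.congr' ?_
    filter_upwards [hl] with t ht
    have ht0 : ((t - c : ℝ) : ℂ) ≠ 0 := by
      intro h
      have : t - c = 0 := by exact_mod_cast h
      simp [this] at ht
    have : (ε : ℂ) * ((((t - c) ^ 3)⁻¹ : ℝ) • w t / ((((t - c) ^ 4)⁻¹ : ℝ) • ψ t)) =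
        ((ε * (t - c) : ℝ) : ℂ) * (w t / ψ t) := by
      simp only [Complex.real_smul]
      push_cast at ht0 ⊢
      field_simp
    simp only [Function.comp_apply, Pi.div_apply]
    rw [this, Complex.arg_real_mul _ ht]
  · have h1 := (hV.neg.div hw (neg_ne_zero.2 (mul_ne_zero (mul_ne_zero Complex.I_ne_zero hκc)
      hVc))).const_mul (ε : ℂ)
    have e1 : (ε : ℂ) * (-(V c) / -(Complex.I * κ * V c)) =
        ((-ε * κ⁻¹ : ℝ) : ℂ) * Complex.I := by
      push_cast
      field_simp
      rw [Complex.I_sq]; ring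
    rw [e1] at h1
    have h2 := (Complex.continuousAt_arg (hslit _ (inv_pos.2 hκ))).tendsto.comp h1
    rw [harg _ (inv_pos.2 hκ)] at h2
    refine h2.congr' ?_
    filter_upwards [hl] with t ht
    have ht0 : ((t - c : ℝ) : ℂ) ≠ 0 := by
      intro h
      have : t - c = 0 := by exact_mod_cast h
      simp [this] at ht
    have : (ε : ℂ) * (-V t / ((((t - c) ^ 3)⁻¹ : ℝ) • w t)) =
        ((ε * (t - c) * (t - c) ^ 2 : ℝ) : ℂ) * (-V t / w t) := by
      simp only [Complex.real_smul]
      push_cast at ht0 ⊢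
      field_simp
    have hp : 0 < ε * (t - c) * (t - c) ^ 2 := by
      refine mul_pos ht (sq_pos_of_ne_zero ?_)
      exact_mod_cast ht0
    simp only [Function.comp_apply, Pi.div_apply]
    rw [this, Complex.arg_real_mul _ hp]

/-- If `w` stays within a right angle of `ψ` and of `-V`, where `ψ` turns counterclockwise, and if the
asymptotics at the endpoints are `w ∼ -iκτ³V` and `ψ ∼ κ'τ⁴V`, then `V` makes more than a full turn:
an argument of `ψ` is `Θ - π - arg (w / ψ) - arg (-V / w)`, which is increasing and tends to `Θ a` at
`a` and to `Θ b - 2π` at `b`. -/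
lemma two_pi_lt_of_comparison {V w ψ ψ' : ℝ → ℂ} {Θ : ℝ → ℝ} {a b : ℝ} (hab : a < b)
    (hVc : ContinuousOn V (Set.Icc a b)) (hV0 : ∀ t ∈ Set.Icc a b, V t ≠ 0)
    (hΘ : IsArgOn V Θ (Set.Icc a b))
    (hw : ContinuousOn w (Set.Ioo a b)) (hψ : ∀ t ∈ Set.Ioo a b, HasDerivAt ψ (ψ' t) t)
    (hpos : ∀ t ∈ Set.Ioo a b, 0 < (starRingEnd ℂ (ψ t) * ψ' t).im)
    (hwψ : ∀ t ∈ Set.Ioo a b, 0 < (starRingEnd ℂ (w t) * ψ t).re)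
    (hwV : ∀ t ∈ Set.Ioo a b, (starRingEnd ℂ (w t) * V t).re < 0)
    (hlim : ∀ c, c = a ∨ c = b → ∃ κ κ' : ℝ, 0 < κ ∧ 0 < κ' ∧
      Filter.Tendsto (fun t => (((t - c) ^ 3)⁻¹ : ℝ) • w t) (𝓝[≠] c)
        (𝓝 (-(Complex.I * κ * V c))) ∧
      Filter.Tendsto (fun t => (((t - c) ^ 4)⁻¹ : ℝ) • ψ t) (𝓝[≠] c) (𝓝 (κ' * V c))) :
    2 * Real.pi < Θ b - Θ a := by
  have hw0 : ∀ t ∈ Set.Ioo a b, w t ≠ 0 := fun t ht h => by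
    have := hwψ t ht
    simp [h] at this
  have hψ0 : ∀ t ∈ Set.Ioo a b, ψ t ≠ 0 := fun t ht h => by
    have := hwψ t ht
    simp [h] at this
  have hsub : Set.Ioo a b ⊆ Set.Icc a b := Set.Ioo_subset_Icc_self
  have hs1 : ∀ t ∈ Set.Ioo a b, w t / ψ t ∈ Complex.slitPlane := fun t ht => by
    left
    rw [re_div_pos_iff (hψ0 t ht)]
    have := hwψ t ht
    simp at this ⊢
    linarith
  have hs2 : ∀ t ∈ Set.Ioo a b, -V t / w t ∈ Complex.slitPlane := fun t ht => by
    left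
    rw [re_div_pos_iff (hw0 t ht)]
    have := hwV t ht
    simp at this ⊢
    linarith
  have hψc : ContinuousOn ψ (Set.Ioo a b) := fun t ht => (hψ t ht).continuousAt.continuousWithinAt
  set β : ℝ → ℝ := fun t => Θ t - Real.pi - Complex.arg (w t / ψ t) - Complex.arg (-V t / w t)
    with hβ
  have hargβ : IsArgOn ψ β (Set.Ioo a b) := by
    constructor
    · refine (((hΘ.cont.mono hsub).sub continuousOn_const).sub ?_).sub ?_
      · exact fun t ht => (Complex.continuousAt_arg (hs1 t ht)).comp_continuousWithinAt
          (f := fun t => w t / ψ t)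
          ((hw.div hψc hψ0) t ht)
      · exact fun t ht => (Complex.continuousAt_arg (hs2 t ht)).comp_continuousWithinAt
          (f := fun t => -V t / w t)
          (((hVc.mono hsub).neg.div hw hw0) t ht)
    · intro t ht
      have h1 := hV0 t (hsub ht)
      have h2 := hw0 t ht
      have h3 := hψ0 t ht
      have n1 : (‖V t‖ : ℂ) ≠ 0 := by simpa using h1
      have n2 : (‖w t‖ : ℂ) ≠ 0 := by simpa using h2
      have n3 : (‖ψ t‖ : ℂ) ≠ 0 := by simpa using h3
      have : Complex.exp ((β t : ℂ) * Complex.I) = ψ t / ‖ψ t‖ := by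
        simp only [hβ]
        push_cast
        rw [sub_mul, sub_mul, sub_mul, Complex.exp_sub, Complex.exp_sub, Complex.exp_sub,
          hΘ.exp_eq (hsub ht) h1, Complex.exp_pi_mul_I,
          exp_arg_mul_I (Complex.slitPlane_ne_zero (hs1 t ht)),
          exp_arg_mul_I (Complex.slitPlane_ne_zero (hs2 t ht)), norm_div, norm_div, norm_neg]
        push_cast
        field_simp
      rw [this]
      field_simp
  have hmono := hargβ.strictMonoOn isOpen_Ioo (convex_Ioo a b) hψ hpos
  have hla : Filter.Tendsto β (𝓝[>] a) (𝓝 (Θ a)) := by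
    obtain ⟨κ, κ', hκ, hκ', h1, h2⟩ := hlim a (Or.inl rfl)
    have hle : 𝓝[>] a ≤ 𝓝[≠] a := nhdsWithin_mono _ fun t (ht : a < t) => ht.ne'
    have hle' : 𝓝[>] a ≤ 𝓝[Set.Icc a b] a := by
      rw [← nhdsWithin_Ioo_eq_nhdsGT hab]; exact nhdsWithin_mono _ hsub
    have ha : a ∈ Set.Icc a b := Set.left_mem_Icc.2 hab.le
    obtain ⟨t1, t2⟩ := tendsto_arg_of_expansion (c := a) hκ hκ' (l := 𝓝[>] a) (ε := 1)
      (Or.inl rfl) (by filter_upwards [self_mem_nhdsWithin] with t (ht : a < t); linarith)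
      ((hVc a ha).tendsto.mono_left hle') (hV0 a ha) (h1.mono_left hle) (h2.mono_left hle)
    have := ((((hΘ.cont a ha).tendsto.mono_left hle').sub_const Real.pi).sub t1).sub t2
    convert! this using 2
    ring
  have hlb : Filter.Tendsto β (𝓝[<] b) (𝓝 (Θ b - 2 * Real.pi)) := by
    obtain ⟨κ, κ', hκ, hκ', h1, h2⟩ := hlim b (Or.inr rfl)
    have hle : 𝓝[<] b ≤ 𝓝[≠] b := nhdsWithin_mono _ fun t (ht : t < b) => ht.ne
    have hle' : 𝓝[<] b ≤ 𝓝[Set.Icc a b] b := by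
      rw [← nhdsWithin_Ioo_eq_nhdsLT hab]; exact nhdsWithin_mono _ hsub
    have hb : b ∈ Set.Icc a b := Set.right_mem_Icc.2 hab.le
    obtain ⟨t1, t2⟩ := tendsto_arg_of_expansion (c := b) hκ hκ' (l := 𝓝[<] b) (ε := -1)
      (Or.inr rfl) (by filter_upwards [self_mem_nhdsWithin] with t (ht : t < b); linarith)
      ((hVc b hb).tendsto.mono_left hle') (hV0 b hb) (h1.mono_left hle) (h2.mono_left hle)
    have := ((((hΘ.cont b hb).tendsto.mono_left hle').sub_const Real.pi).sub t1).sub t2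
    convert! this using 2
    ring
  obtain ⟨c, hac, hcb⟩ := exists_between hab
  obtain ⟨d, hcd, hdb⟩ := exists_between hcb
  have h1 : Θ a ≤ β c := le_of_tendsto hla (by
    filter_upwards [Ioo_mem_nhdsGT hac] with t ht
    exact (hmono ⟨ht.1, ht.2.trans hcb⟩ ⟨hac, hcb⟩ ht.2).le)
  have h2 : β c < β d := hmono ⟨hac, hcb⟩ ⟨hac.trans hcd, hdb⟩ hcd
  have h3 : β d ≤ Θ b - 2 * Real.pi := ge_of_tendsto hlb (by
    filter_upwards [Ioo_mem_nhdsLT hdb] with t ht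
    exact (hmono ⟨hac.trans hcd, hdb⟩ ⟨(hac.trans hcd).trans ht.1, ht.2⟩ ht.1).le)
  linarith

/-! ### Quaternionic frames of `ℝ⁴` -/

/-- The complex structure `J` of `ℝ⁴` with `ω₀(u, J w) = ⟪u, w⟫`; it maps the gradient of a Hamiltonian
to its Hamiltonian vector field. -/
def mulI : R4 →L[ℝ] R4 := LinearMap.toContinuousLinearMap
  { toFun := fun p => !₂[p 2, p 3, -p 0, -p 1]
    map_add' := fun p q => by ext i; fin_cases i <;> simp <;> ring
    map_smul' := fun c p => by ext i; fin_cases i <;> simp }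

/-- A second complex structure of `ℝ⁴`, which anticommutes with `mulI`. -/
def mulJ : R4 →L[ℝ] R4 := LinearMap.toContinuousLinearMap
  { toFun := fun p => !₂[-p 1, p 0, p 3, -p 2]
    map_add' := fun p q => by ext i; fin_cases i <;> simp <;> ring
    map_smul' := fun c p => by ext i; fin_cases i <;> simp }

/-- The product of `mulI` and `mulJ`. -/
def mulK : R4 →L[ℝ] R4 := mulI.comp mulJ

lemma mulI_apply (p : R4) : mulI p = !₂[p 2, p 3, -p 0, -p 1] := rfl
lemma mulJ_apply (p : R4) : mulJ p = !₂[-p 1, p 0, p 3, -p 2] := rfl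
lemma mulK_apply (p : R4) : mulK p = !₂[p 3, -p 2, p 1, -p 0] := by
  simp [mulK, mulI_apply, mulJ_apply]

lemma inner_R4 (u w : R4) : inner ℝ u w = u 0 * w 0 + u 1 * w 1 + u 2 * w 2 + u 3 * w 3 := by
  simp [PiLp.inner_apply, Fin.sum_univ_four, mul_comm]

lemma norm_sq_R4 (u : R4) : ‖u‖ ^ 2 = u 0 ^ 2 + u 1 ^ 2 + u 2 ^ 2 + u 3 ^ 2 := by
  rw [← real_inner_self_eq_norm_sq, inner_R4]; ring

lemma omega_mulI_right (u w : R4) : omega u (mulI w) = inner ℝ u w := by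
  simp [inner_R4, omega, mulI_apply]; ring

lemma omega_mulI_left (u w : R4) : omega (mulI u) w = -inner ℝ u w := by
  simp [inner_R4, omega, mulI_apply]; ring

lemma omega_swap (u w : R4) : omega u w = -omega w u := by simp only [omega]; ring
lemma omega_self (u : R4) : omega u u = 0 := by simp only [omega]; ring
lemma omega_add_left (u u' w : R4) : omega (u + u') w = omega u w + omega u' w := by
  simp [omega]; ring
lemma omega_sub_left (u u' w : R4) : omega (u - u') w = omega u w - omega u' w := by
  simp [omega]; ring
lemma omega_add_right (u w w' : R4) : omega u (w + w') = omega u w + omega u w' := by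
  simp [omega]; ring
lemma omega_sub_right (u w w' : R4) : omega u (w - w') = omega u w - omega u w' := by
  simp [omega]; ring
lemma omega_smul_left (c : ℝ) (u w : R4) : omega (c • u) w = c * omega u w := by
  simp [omega]; ring
lemma omega_smul_right (c : ℝ) (u w : R4) : omega u (c • w) = c * omega u w := by
  simp [omega]; ring

lemma omega_neg_right (u w : R4) : omega u (-w) = -omega u w := by
  simp [omega]; ring

lemma mulI_mulI (u : R4) : mulI (mulI u) = -u := by
  ext i; fin_cases i <;> simp [mulI_apply]

lemma inner_mulI_self (u : R4) : inner ℝ u (mulI u) = 0 := by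
  simp [inner_R4, mulI_apply, mul_comm]

/-- The coordinates of `u` with respect to `mulJ m` and `mulK m`, as a complex number. They are not
normalized: `frameCoord m` is linear in `m` too. For `m ≠ 0` its kernel is
spanned by `m` and `mulI m`. -/
def frameCoord (m u : R4) : ℂ := ⟨inner ℝ u (mulJ m), inner ℝ u (mulK m)⟩

lemma frameCoord_add (m u u' : R4) : frameCoord m (u + u') = frameCoord m u + frameCoord m u' := by
  apply Complex.ext <;> simp [frameCoord, inner_add_left]
lemma frameCoord_sub (m u u' : R4) : frameCoord m (u - u') = frameCoord m u - frameCoord m u' := by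
  apply Complex.ext <;> simp [frameCoord, inner_sub_left]
lemma frameCoord_smul (m : R4) (c : ℝ) (u : R4) : frameCoord m (c • u) = c * frameCoord m u := by
  apply Complex.ext <;> simp [frameCoord, real_inner_smul_left]
lemma frameCoord_smul_left (m : R4) (c : ℝ) (u : R4) :
    frameCoord (c • m) u = c * frameCoord m u := by
  apply Complex.ext <;> simp [frameCoord, real_inner_smul_right]
lemma frameCoord_mulI_self (m : R4) : frameCoord m (mulI m) = 0 := by
  apply Complex.ext <;> simp [frameCoord, inner_R4, mulJ_apply, mulK_apply, mulI_apply] <;> ring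
lemma frameCoord_mulI_left (m u : R4) : frameCoord (mulI m) u = Complex.I * frameCoord m u := by
  apply Complex.ext <;> simp [frameCoord, inner_R4, mulJ_apply, mulK_apply, mulI_apply]
  all_goals ring

lemma continuous_frameCoord : Continuous (fun q : R4 × R4 => frameCoord q.1 q.2) := by
  have : (fun q : R4 × R4 => frameCoord q.1 q.2) = fun q : R4 × R4 =>
      Complex.equivRealProdCLM.symm (inner ℝ q.2 (mulJ q.1), inner ℝ q.2 (mulK q.1)) := by
    ext q
    apply Complex.ext <;> simp [frameCoord]
  rw [this]
  fun_prop

lemma tendsto_frameCoord {X : Type*} {l : Filter X} {m u : X → R4} {m₀ u₀ : R4}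
    (hm : Filter.Tendsto m l (𝓝 m₀)) (hu : Filter.Tendsto u l (𝓝 u₀)) :
    Filter.Tendsto (fun t => frameCoord (m t) (u t)) l (𝓝 (frameCoord m₀ u₀)) :=
  by simpa only [Function.comp_def] using
    (continuous_frameCoord.tendsto (m₀, u₀)).comp (hm.prodMk_nhds hu)

/-- `frameCoord m` as a continuous linear map. -/
def frameCoordL (m : R4) : R4 →L[ℝ] ℂ := LinearMap.toContinuousLinearMap
  { toFun := frameCoord m
    map_add' := frameCoord_add m
    map_smul' := fun c u => by simp [frameCoord_smul] }

lemma hasDerivAt_frameCoord {u : ℝ → R4} {u' : R4} {t : ℝ} (m : R4) (h : HasDerivAt u u' t) :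
    HasDerivAt (fun t => frameCoord m (u t)) (frameCoord m u') t :=
  (frameCoordL m).hasFDerivAt.comp_hasDerivAt t h

/-- On the orthogonal complement of `m`, the form `ω₀` is up to a factor the area form in the coordinates
`frameCoord m`. -/
lemma im_conj_frameCoord_mul {m u w : R4} (hu : inner ℝ m u = 0) (hw : inner ℝ m w = 0) :
    (starRingEnd ℂ (frameCoord m u) * frameCoord m w).im = ‖m‖ ^ 2 * omega u w := by
  have key : (starRingEnd ℂ (frameCoord m u) * frameCoord m w).im = ‖m‖ ^ 2 * omega u w
      - inner ℝ m u * inner ℝ (mulI m) w + inner ℝ m w * inner ℝ (mulI m) u := by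
    rw [norm_sq_R4]
    simp [frameCoord, inner_R4, mulI_apply, mulJ_apply, mulK_apply, omega]
    ring
  rw [key, hu, hw]; ring

/-- The expansion of `B` in the orthogonal frame `σ, mulI σ, mulJ σ, mulK σ`, where the coefficient of
`mulI σ` is `ω₀(B, σ) = 0`. -/
lemma norm_sq_smul_eq_of_omega_eq_zero {B σ : R4} (h : omega B σ = 0) :
    ‖σ‖ ^ 2 • B = (frameCoord σ B).re • mulJ σ + (frameCoord σ B).im • mulK σ + inner ℝ B σ • σ := by
  rw [norm_sq_R4]
  simp only [omega] at h
  ext i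
  fin_cases i <;>
    simp [frameCoord, inner_R4, mulJ_apply, mulK_apply]
  · linear_combination (-σ 2) * h
  · linear_combination (-σ 3) * h
  · linear_combination (σ 0) * h
  · linear_combination (σ 1) * h

/-- If `B` is `ω₀`-orthogonal to `σ`, then the coordinates of `B` in the frame of `σ` make an acute angle
with the coordinates, in the frame of `N`, of the projection of `⟪N, σ⟫ B` along `σ` to the orthogonal
complement of `N`. -/
lemma norm_sq_mul_re_conj_frameCoord_mul {B σ N : R4} (h : omega B σ = 0) :
    ‖σ‖ ^ 2 * (starRingEnd ℂ (frameCoord σ B) *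
      frameCoord N (inner ℝ N σ • B - inner ℝ N B • σ)).re =
    inner ℝ N σ ^ 2 * Complex.normSq (frameCoord σ B) +
      ((frameCoord σ B).re * inner ℝ N (mulJ σ) + (frameCoord σ B).im * inner ℝ N (mulK σ)) ^ 2 := by
  have key : ∀ z₁ z₂ c : ℝ, ∀ B' : R4, B' = z₁ • mulJ σ + z₂ • mulK σ + c • σ →
      (starRingEnd ℂ ⟨z₁, z₂⟩ * frameCoord N (inner ℝ N σ • B' - inner ℝ N B' • σ)).re =
      inner ℝ N σ ^ 2 * (z₁ * z₁ + z₂ * z₂) +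
        (z₁ * inner ℝ N (mulJ σ) + z₂ * inner ℝ N (mulK σ)) ^ 2 := by
    rintro z₁ z₂ c _ rfl
    simp [frameCoord, inner_R4, mulJ_apply, mulK_apply]
    ring
  have := key _ _ _ _ (norm_sq_smul_eq_of_omega_eq_zero h)
  rw [Complex.normSq_apply, ← this, real_inner_smul_right]
  rw [show inner ℝ N σ • ‖σ‖ ^ 2 • B - (‖σ‖ ^ 2 * inner ℝ N B) • σ =
    (‖σ‖ ^ 2) • (inner ℝ N σ • B - inner ℝ N B • σ) by module, frameCoord_smul, Complex.eta,
    mul_left_comm, Complex.re_ofReal_mul]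

lemma re_conj_frameCoord_mul_pos {B σ N : R4} (h : omega B σ = 0) (hN : inner ℝ N σ ≠ 0)
    (hB : frameCoord σ B ≠ 0) :
    0 < (starRingEnd ℂ (frameCoord σ B) *
      frameCoord N (inner ℝ N σ • B - inner ℝ N B • σ)).re := by
  have h1 := norm_sq_mul_re_conj_frameCoord_mul (N := N) h
  have hσ : 0 < ‖σ‖ ^ 2 := by
    have : σ ≠ 0 := by rintro rfl; simp at hN
    positivity
  have h2 : 0 < inner ℝ N σ ^ 2 * Complex.normSq (frameCoord σ B) :=
    mul_pos (by positivity) (Complex.normSq_pos.2 hB)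
  by_contra hcon
  push Not at hcon
  nlinarith [mul_nonneg hσ.le (neg_nonneg.2 hcon), sq_nonneg ((frameCoord σ B).re *
    inner ℝ N (mulJ σ) + (frameCoord σ B).im * inner ℝ N (mulK σ))]

/-! ### Rotation of the linearized flow along an orbit on a convex hypersurface -/

/-- If `f` vanishes at `c` and `f' t ∼ (t - c) ℓ`, then `f t ∼ (t - c)² ℓ / 2`. -/
lemma tendsto_inv_sq_smul_of_hasDerivAt {W : Type*} [NormedAddCommGroup W] [NormedSpace ℝ W]
    {f f' : ℝ → W} {c : ℝ} {ℓ : W} (hf : ∀ t, HasDerivAt f (f' t) t) (h0 : f c = 0) (h0' : f' c = 0)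
    (h : Filter.Tendsto (fun t => (t - c)⁻¹ • f' t) (𝓝[≠] c) (𝓝 ℓ)) :
    Filter.Tendsto (fun t => ((t - c) ^ 2)⁻¹ • f t) (𝓝[≠] c) (𝓝 ((1 / 2 : ℝ) • ℓ)) := by
  rw [Metric.tendsto_nhdsWithin_nhds] at h ⊢
  intro ε hε
  obtain ⟨δ, hδ, hh⟩ := h (ε / 2) (half_pos hε)
  refine ⟨δ, hδ, fun {t} ht htδ => ?_⟩
  have htc : 0 < |t - c| := abs_pos.2 (sub_ne_zero.2 ht)
  have hb : ∀ s ∈ Metric.closedBall c |t - c|,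
      ‖f' s - (s - c) • ℓ‖ ≤ ε / 2 * |t - c| := by
    intro s hs
    rw [Metric.mem_closedBall, Real.dist_eq] at hs
    by_cases hsc : s = c
    · subst hsc
      simp only [h0', sub_self, zero_smul, norm_zero]
      positivity
    · have h1 := hh (x := s) hsc (by rw [Real.dist_eq] at htδ ⊢; linarith)
      have hsc' : s - c ≠ 0 := sub_ne_zero.2 hsc
      have h2 : f' s - (s - c) • ℓ = (s - c) • ((s - c)⁻¹ • f' s - ℓ) := by
        rw [smul_sub, smul_inv_smul₀ hsc']
      rw [h2, norm_smul, Real.norm_eq_abs]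
      rw [dist_eq_norm] at h1
      nlinarith [abs_nonneg (s - c), norm_nonneg ((s - c)⁻¹ • f' s - ℓ)]
  have hd : ∀ s ∈ Metric.closedBall c |t - c|, HasDerivWithinAt
      (fun s => f s - ((s - c) ^ 2 / 2) • ℓ) (f' s - (s - c) • ℓ) (Metric.closedBall c |t - c|) s := by
    intro s _
    refine ((hf s).sub ?_).hasDerivWithinAt
    have : HasDerivAt (fun s : ℝ => (s - c) ^ 2 / 2) (s - c) s := by
      have := (((hasDerivAt_id s).sub_const c).pow 2).div_const 2
      simpa using this
    exact this.smul_const ℓ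
  have hm := Convex.norm_image_sub_le_of_norm_hasDerivWithin_le hd hb
    (convex_closedBall c _) (Metric.mem_closedBall_self (abs_nonneg _))
    (y := t) (by rw [Metric.mem_closedBall, Real.dist_eq])
  simp only [h0, sub_self, Real.norm_eq_abs] at hm
  have hsq : 0 < (t - c) ^ 2 := by rw [← sq_abs]; positivity
  rw [dist_eq_norm]
  have e : ((t - c) ^ 2)⁻¹ • f t - (1 / 2 : ℝ) • ℓ =
      ((t - c) ^ 2)⁻¹ • (f t - ((t - c) ^ 2 / 2) • ℓ) := by
    have htne : t - c ≠ 0 := sub_ne_zero.2 ht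
    rw [smul_sub, smul_smul]
    congr 2
    field_simp
  rw [e, norm_smul, norm_inv, Real.norm_eq_abs, abs_of_pos hsq, inv_mul_lt_iff₀ hsq]
  norm_num at hm
  have : |t - c| * |t - c| = (t - c) ^ 2 := by rw [abs_mul_abs_self]; ring
  nlinarith

/-- Data along an orbit `γ` on an energy hypersurface: `N` is the gradient of the Hamiltonian, whose
Hessian `A` is positive definite on the tangent spaces of the hypersurface, `g` is the factor by which
the Hamiltonian vector field `J N` is reparametrized, and `v` is a solution, tangent to the
hypersurface, of the linearized equation; the term `κ J N` accounts for the derivative of the factor. -/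
structure IsConvexOrbit (γ N v : ℝ → R4) (A : ℝ → R4 →ₗ[ℝ] R4) (g κ : ℝ → ℝ) : Prop where
  speed_pos : ∀ t, 0 < g t
  continuous_speed : Continuous g
  hasDerivAt_curve : ∀ t, HasDerivAt γ (g t • mulI (N t)) t
  hasDerivAt_normal : ∀ t, HasDerivAt N (g t • A t (mulI (N t))) t
  continuous_deriv_normal : Continuous fun t => g t • A t (mulI (N t))
  hasDerivAt_vector : ∀ t, HasDerivAt v (g t • mulI (A t (v t)) + κ t • mulI (N t)) t
  continuous_deriv_vector : Continuous fun t => g t • mulI (A t (v t)) + κ t • mulI (N t)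
  symm : ∀ t u w, inner ℝ (A t u) w = inner ℝ u (A t w)
  pos : ∀ t u, inner ℝ (N t) u = 0 → u ≠ 0 → 0 < inner ℝ (A t u) u
  tangent : ∀ t, inner ℝ (N t) (v t) = 0
  frameCoord_ne_zero : ∀ t, frameCoord (N t) (v t) ≠ 0

namespace IsConvexOrbit

variable {γ N v : ℝ → R4} {A : ℝ → R4 →ₗ[ℝ] R4} {g κ : ℝ → ℝ}

lemma normal_ne_zero (h : IsConvexOrbit γ N v A g κ) (t : ℝ) : N t ≠ 0 := fun e =>
  h.frameCoord_ne_zero t (by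
    rw [e]; apply Complex.ext <;> simp [frameCoord])

lemma continuous_normal (h : IsConvexOrbit γ N v A g κ) : Continuous N :=
  continuous_iff_continuousAt.2 fun t => (h.hasDerivAt_normal t).continuousAt

lemma continuous_vector (h : IsConvexOrbit γ N v A g κ) : Continuous v :=
  continuous_iff_continuousAt.2 fun t => (h.hasDerivAt_vector t).continuousAt

lemma continuous_curve (h : IsConvexOrbit γ N v A g κ) : Continuous γ :=
  continuous_iff_continuousAt.2 fun t => (h.hasDerivAt_curve t).continuousAt

/-- The projection of `v` along the orbit direction to the `ω₀`-orthogonal complement of `γ(c) - γ(t)`,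
up to a factor. -/
def secantVector (γ N v : ℝ → R4) (c t : ℝ) : R4 :=
  (-inner ℝ (N t) (γ c - γ t)) • v t - omega (v t) (γ c - γ t) • mulI (N t)

/-- The projection of `secantVector` along `γ(c) - γ(t)` to the orthogonal complement of `N(c)`, up to a
factor. -/
def projectedVector (γ N v : ℝ → R4) (c t : ℝ) : R4 :=
  inner ℝ (N c) (γ c - γ t) • secantVector γ N v c t -
    inner ℝ (N c) (secantVector γ N v c t) • (γ c - γ t)

lemma omega_secantVector (c t : ℝ) : omega (secantVector γ N v c t) (γ c - γ t) = 0 := by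
  rw [secantVector, omega_sub_left, omega_smul_left, omega_smul_left, omega_mulI_left]
  ring

lemma inner_normal_secantVector (h : IsConvexOrbit γ N v A g κ) (c t : ℝ) :
    inner ℝ (N t) (secantVector γ N v c t) = 0 := by
  rw [secantVector, inner_sub_right, real_inner_smul_right, real_inner_smul_right, h.tangent,
    inner_mulI_self]
  ring

lemma frameCoord_secantVector (c t : ℝ) : frameCoord (N t) (secantVector γ N v c t) =
    ((-inner ℝ (N t) (γ c - γ t) : ℝ) : ℂ) * frameCoord (N t) (v t) := by
  rw [secantVector, frameCoord_sub, frameCoord_smul, frameCoord_smul, frameCoord_mulI_self]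
  ring

lemma frameCoord_secant_ne_zero (h : IsConvexOrbit γ N v A g κ) {c t : ℝ}
    (hP : inner ℝ (N t) (γ c - γ t) < 0) :
    frameCoord (γ c - γ t) (secantVector γ N v c t) ≠ 0 := by
  intro e
  have h1 := norm_sq_smul_eq_of_omega_eq_zero (omega_secantVector (γ := γ) (N := N) (v := v) c t)
  rw [e] at h1
  simp only [Complex.zero_re, Complex.zero_im, zero_smul, zero_add] at h1
  have h2 := congrArg (inner ℝ (N t)) h1
  rw [real_inner_smul_right, h.inner_normal_secantVector, real_inner_smul_right, mul_zero] at h2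
  have h3 := (mul_eq_zero.1 h2.symm).resolve_right hP.ne
  rw [h3, zero_smul, smul_eq_zero] at h1
  rcases h1 with h1 | h1
  · have : γ c - γ t = 0 := by simpa using h1
    rw [this] at hP
    simp at hP
  · have h4 := frameCoord_secantVector (γ := γ) (N := N) (v := v) c t
    rw [h1] at h4
    have h5 : frameCoord (N t) 0 = 0 := by apply Complex.ext <;> simp [frameCoord]
    rw [h5] at h4
    have := mul_ne_zero (Complex.ofReal_ne_zero.2 (neg_ne_zero.2 hP.ne)) (h.frameCoord_ne_zero t)
    exact this h4.symm

/-- The derivative of `t ↦ ω₀(v(t), γ(c) - γ(t))`. -/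
lemma hasDerivAt_omega (h : IsConvexOrbit γ N v A g κ) (c t : ℝ) :
    HasDerivAt (fun t => omega (v t) (γ c - γ t))
      (omega (g t • mulI (A t (v t)) + κ t • mulI (N t)) (γ c - γ t)) t := by
  have hco : ∀ {u : ℝ → R4} {u' : R4}, HasDerivAt u u' t → ∀ i, HasDerivAt (fun t => u t i) (u' i) t :=
    fun hu i => (EuclideanSpace.proj (𝕜 := ℝ) i).hasFDerivAt.comp_hasDerivAt t hu
  have hv := hco (h.hasDerivAt_vector t)
  have hσ := hco ((h.hasDerivAt_curve t).const_sub (γ c))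
  have e := ((((hv 2).mul (hσ 0)).sub ((hv 0).mul (hσ 2))).add
    (((hv 3).mul (hσ 1)).sub ((hv 1).mul (hσ 3))))
  refine e.congr_deriv ?_
  have hz : omega (v t) (-(g t • mulI (N t))) = 0 := by
    rw [← neg_smul, omega_smul_right, omega_mulI_right, real_inner_comm, h.tangent, mul_zero]
  rw [← add_zero (omega _ (γ c - γ t)), ← hz]
  simp only [omega]
  ring

lemma hasDerivAt_secantVector (h : IsConvexOrbit γ N v A g κ) (c t : ℝ) :
    HasDerivAt (secantVector γ N v c)
      ((-(g t * inner ℝ (A t (mulI (N t))) (γ c - γ t))) • v t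
        + (-inner ℝ (N t) (γ c - γ t)) • (g t • mulI (A t (v t)) + κ t • mulI (N t))
        - omega (g t • mulI (A t (v t)) + κ t • mulI (N t)) (γ c - γ t) • mulI (N t)
        - omega (v t) (γ c - γ t) • (g t • mulI (A t (mulI (N t))))) t := by
  have hP : HasDerivAt (fun t => inner ℝ (N t) (γ c - γ t))
      (g t * inner ℝ (A t (mulI (N t))) (γ c - γ t)) t := by
    refine ((h.hasDerivAt_normal t).inner ℝ ((h.hasDerivAt_curve t).const_sub (γ c))).congr_deriv ?_
    rw [← smul_neg, real_inner_smul_right, inner_neg_right, inner_mulI_self, real_inner_smul_left]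
    ring
  have hX : HasDerivAt (fun t => mulI (N t)) (g t • mulI (A t (mulI (N t)))) t := by
    refine (mulI.hasFDerivAt.comp_hasDerivAt t (h.hasDerivAt_normal t)).congr_deriv ?_
    rw [map_smul]
  refine ((hP.neg.smul (h.hasDerivAt_vector t)).sub ((h.hasDerivAt_omega c t).smul hX)).congr_deriv ?_
  simp only [Pi.neg_apply]
  abel

/-- The projected vector turns counterclockwise. -/
lemma im_conj_frameCoord_projectedVector_pos (h : IsConvexOrbit γ N v A g κ) {c t : ℝ}
    (hP : inner ℝ (N t) (γ c - γ t) < 0) (hQ : 0 < inner ℝ (N c) (γ c - γ t)) :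
    ∃ D : R4, HasDerivAt (projectedVector γ N v c) D t ∧
      0 < (starRingEnd ℂ (frameCoord (N c) (projectedVector γ N v c t)) * frameCoord (N c) D).im := by
  set σ := γ c - γ t with hσ
  set B := secantVector γ N v c t with hB
  have hB' := h.hasDerivAt_secantVector c t
  rw [← hσ] at hB'
  set B' := ((-(g t * inner ℝ (A t (mulI (N t))) σ)) • v t
        + (-inner ℝ (N t) σ) • (g t • mulI (A t (v t)) + κ t • mulI (N t))
        - omega (g t • mulI (A t (v t)) + κ t • mulI (N t)) σ • mulI (N t)
        - omega (v t) σ • (g t • mulI (A t (mulI (N t))))) with hB'def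
  have hσ' : HasDerivAt (fun t => γ c - γ t) (-(g t • mulI (N t))) t :=
    (h.hasDerivAt_curve t).const_sub (γ c)
  have hQ' : HasDerivAt (fun t => inner ℝ (N c) (γ c - γ t)) (inner ℝ (N c) (-(g t • mulI (N t)))) t := by
    simpa using (hasDerivAt_const t (N c)).inner ℝ hσ'
  have hη' : HasDerivAt (fun t => inner ℝ (N c) (secantVector γ N v c t)) (inner ℝ (N c) B') t := by
    simpa using (hasDerivAt_const t (N c)).inner ℝ hB'
  refine ⟨_, (hQ'.smul hB').sub (hη'.smul hσ'), ?_⟩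
  rw [← hσ, ← hB]
  -- by the two orthogonality relations of `B`, only the Hessian contributes to `ω₀(B, B')`
  have hBσ : omega B σ = 0 := omega_secantVector c t
  have hNB : inner ℝ (N t) B = 0 := h.inner_normal_secantVector c t
  have hBX : omega B (mulI (N t)) = 0 := by rw [omega_mulI_right, real_inner_comm, hNB]
  have hvX : omega (v t) (mulI (N t)) = 0 := by rw [omega_mulI_right, real_inner_comm, h.tangent]
  have hBv : omega B (v t) = 0 := by
    rw [hB, secantVector, omega_sub_left, omega_smul_left, omega_smul_left, omega_self,
      omega_swap (mulI _), hvX]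
    ring
  have hAB : A t B = (-inner ℝ (N t) σ) • A t (v t) - omega (v t) σ • A t (mulI (N t)) := by
    rw [hB, secantVector, map_sub, map_smul, map_smul]
  have hBB' : omega B B' = g t * inner ℝ (A t B) B := by
    rw [real_inner_comm, hAB, hB'def]
    simp only [omega_add_right, omega_sub_right, omega_smul_right, hBX, hBv, omega_mulI_right,
      inner_sub_right, real_inner_smul_right]
    ring
  have hB'σ : omega B' σ = 0 := by
    rw [hB'def]
    simp only [omega_add_left, omega_sub_left, omega_smul_left, omega_mulI_left]
    ring
  have hσB' : omega σ B' = 0 := by rw [omega_swap, hB'σ, neg_zero]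
  have hσB : omega σ B = 0 := by rw [omega_swap, hBσ, neg_zero]
  have hσX : omega σ (mulI (N t)) = inner ℝ (N t) σ := by
    rw [omega_mulI_right, real_inner_comm]
  have hB0 : B ≠ 0 := by
    intro e
    have := h.frameCoord_secant_ne_zero hP
    rw [← hB, e] at this
    exact this (by apply Complex.ext <;> simp [frameCoord])
  have hpv : projectedVector γ N v c t = inner ℝ (N c) σ • B - inner ℝ (N c) B • σ := rfl
  rw [im_conj_frameCoord_mul]
  · have h1 : 0 < inner ℝ (A t B) B := h.pos t B hNB hB0
    have hN0 : 0 < ‖N c‖ ^ 2 := by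
      have := h.normal_ne_zero c
      positivity
    refine mul_pos hN0 ?_
    rw [hpv]
    simp only [omega_add_right, omega_sub_right, omega_smul_right, omega_sub_left, omega_smul_left,
      omega_self, hBσ, hσB, hBB', hσB', omega_neg_right, hσX, hBX]
    have h2 := mul_pos (mul_pos (mul_pos hQ hQ) (h.speed_pos t)) h1
    have h3 := mul_nonneg (mul_nonneg (mul_self_nonneg (inner ℝ (N c) B)) (h.speed_pos t).le)
      (neg_nonneg.2 hP.le)
    nlinarith
  · rw [hpv, inner_sub_right, real_inner_smul_right, real_inner_smul_right]
    ring
  · simp only [inner_sub_right, inner_add_right, real_inner_smul_right]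
    ring

/-- The asymptotics of the secant vector and its projection at a return to the starting point. -/
lemma tendsto_frameCoord_secantVector (h : IsConvexOrbit γ N v A g κ) (c : ℝ) :
    ∃ k k' : ℝ, 0 < k ∧ 0 < k' ∧
      Filter.Tendsto (fun t => (((t - c) ^ 3)⁻¹ : ℝ) •
        frameCoord (γ c - γ t) (secantVector γ N v c t)) (𝓝[≠] c)
        (𝓝 (-(Complex.I * k * frameCoord (N c) (v c)))) ∧
      Filter.Tendsto (fun t => (((t - c) ^ 4)⁻¹ : ℝ) •
        frameCoord (N c) (projectedVector γ N v c t)) (𝓝[≠] c)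
        (𝓝 (k' * frameCoord (N c) (v c))) := by
  set X := mulI (N c) with hX
  set q := g c * (g c * inner ℝ (A c X) X) with hq
  have hX0 : X ≠ 0 := fun e => h.normal_ne_zero c (by
    have := mulI_mulI (N c)
    rw [← hX, e, map_zero] at this
    simpa using this.symm)
  have hqpos : 0 < q := by
    have := h.speed_pos c
    have := h.pos c X (inner_mulI_self _) hX0
    positivity
  have hslope : ∀ {u : ℝ → R4} {u' : R4}, HasDerivAt u u' c →
      Filter.Tendsto (fun t => (t - c)⁻¹ • (u t - u c)) (𝓝[≠] c) (𝓝 u') := fun hu => by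
    refine (hasDerivAt_iff_tendsto_slope.1 hu).congr fun t => ?_
    rw [slope_def_module]
  have hσ : Filter.Tendsto (fun t => (t - c)⁻¹ • (γ c - γ t)) (𝓝[≠] c) (𝓝 (-(g c • X))) := by
    refine (hslope (h.hasDerivAt_curve c)).neg.congr fun t => ?_
    rw [← smul_neg, neg_sub]
  have hNc := (h.continuous_deriv_normal.tendsto c).mono_left (nhdsWithin_le_nhds (s := {c}ᶜ))
  have hvc := (h.continuous_deriv_vector.tendsto c).mono_left (nhdsWithin_le_nhds (s := {c}ᶜ))
  have hgc := (h.continuous_speed.tendsto c).mono_left (nhdsWithin_le_nhds (s := {c}ᶜ))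
  have hN := (h.continuous_normal.tendsto c).mono_left (nhdsWithin_le_nhds (s := {c}ᶜ))
  have hv := (h.continuous_vector.tendsto c).mono_left (nhdsWithin_le_nhds (s := {c}ᶜ))
  -- the limit of `-⟪N, σ⟫ / τ²`
  have hP : Filter.Tendsto (fun t => ((t - c) ^ 2)⁻¹ • (-inner ℝ (N t) (γ c - γ t))) (𝓝[≠] c)
      (𝓝 ((1 / 2 : ℝ) • q)) := by
    refine tendsto_inv_sq_smul_of_hasDerivAt
      (f' := fun t => -(inner ℝ (g t • A t (mulI (N t))) (γ c - γ t))) (fun t => ?_)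
      (by simp) (by simp) ?_
    · refine ((h.hasDerivAt_normal t).inner ℝ
        ((h.hasDerivAt_curve t).const_sub (γ c))).neg.congr_deriv ?_
      rw [← smul_neg, real_inner_smul_right, inner_neg_right, inner_mulI_self]
      ring
    · have := (Filter.Tendsto.inner (𝕜 := ℝ) hNc hσ).neg
      convert! this using 2 with t
      · simp only [real_inner_smul_right]
        rw [smul_eq_mul]; ring
      · rw [inner_neg_right, real_inner_smul_right, real_inner_smul_left, hq]; ring
  have hω : ∃ r : ℝ, Filter.Tendsto (fun t => ((t - c) ^ 2)⁻¹ • omega (v t) (γ c - γ t)) (𝓝[≠] c)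
      (𝓝 r) := by
    refine ⟨_, tendsto_inv_sq_smul_of_hasDerivAt (fun t => h.hasDerivAt_omega c t)
      (by simp [omega]) (by simp [omega]) (ℓ := -inner ℝ
        (mulI (g c • mulI (A c (v c)) + κ c • mulI (N c))) (g c • X)) ?_⟩
    have := Filter.Tendsto.inner (𝕜 := ℝ) ((mulI.continuous.tendsto _).comp hvc) hσ
    convert! this using 2 with t
    · simp only [Function.comp_apply]
      rw [real_inner_smul_right, real_inner_comm, ← omega_mulI_right, mulI_mulI, omega_swap]
      simp only [omega, PiLp.neg_apply, smul_eq_mul]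
      ring
    · rw [inner_neg_right]
  obtain ⟨r, hr⟩ := hω
  have hQ : Filter.Tendsto (fun t => ((t - c) ^ 2)⁻¹ • inner ℝ (N c) (γ c - γ t)) (𝓝[≠] c)
      (𝓝 ((1 / 2 : ℝ) • q)) := by
    refine tendsto_inv_sq_smul_of_hasDerivAt
      (f' := fun t => -(g t * inner ℝ (N c) (mulI (N t)))) (fun t => ?_)
      (by simp) (by simp [inner_mulI_self]) ?_
    · refine ((hasDerivAt_const t (N c)).inner ℝ
        ((h.hasDerivAt_curve t).const_sub (γ c))).congr_deriv ?_
      rw [inner_neg_right, real_inner_smul_right]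
      simp
    · have := hgc.mul
        (Filter.Tendsto.inner (𝕜 := ℝ) (hslope (h.hasDerivAt_normal c)) (tendsto_const_nhds (x := X)))
      convert! this using 2 with t
      · rw [real_inner_smul_left, inner_sub_left, hX, inner_mulI_self, smul_eq_mul,
          ← omega_mulI_right, ← omega_mulI_right, mulI_mulI, mulI_mulI]
        simp only [omega, PiLp.neg_apply]
        ring
      · rw [real_inner_smul_left, hq]
  have hσN : Filter.Tendsto (fun t => ((t - c) ^ 2)⁻¹ • frameCoord (N c) (γ c - γ t)) (𝓝[≠] c)
      (𝓝 ((1 / 2 : ℝ) • (-((g c : ℂ) * frameCoord (N c) (mulI (g c • A c (mulI (N c)))))))) := by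
    refine tendsto_inv_sq_smul_of_hasDerivAt
      (f' := fun t => -((g t : ℂ) * frameCoord (N c) (mulI (N t)))) (fun t => ?_)
      (by rw [sub_self]; exact map_zero (frameCoordL (N c)))
      (by rw [frameCoord_mulI_self]; simp) ?_
    · refine (hasDerivAt_frameCoord (N c) ((h.hasDerivAt_curve t).const_sub (γ c))).congr_deriv ?_
      rw [← neg_smul, frameCoord_smul]
      push_cast
      ring
    · have h1 : Filter.Tendsto (fun t => frameCoord (N c) (mulI ((t - c)⁻¹ • (N t - N c)))) (𝓝[≠] c)
          (𝓝 (frameCoord (N c) (mulI (g c • A c (mulI (N c)))))) :=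
        tendsto_frameCoord tendsto_const_nhds
          ((mulI.continuous.tendsto _).comp (hslope (h.hasDerivAt_normal c)))
      have := (((Complex.continuous_ofReal.tendsto _).comp hgc).mul h1).neg
      convert! this using 2 with t
      rw [map_smul, map_sub, frameCoord_smul, frameCoord_sub, frameCoord_mulI_self,
        Complex.real_smul]
      simp only [Function.comp_apply]
      ring
  have hB : Filter.Tendsto (fun t => ((t - c) ^ 2)⁻¹ • secantVector γ N v c t) (𝓝[≠] c)
      (𝓝 (((1 / 2 : ℝ) • q) • v c - r • X)) := by
    have := (hP.smul hv).sub (hr.smul ((mulI.continuous.tendsto _).comp hN))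
    convert! this using 2 with t
    simp only [secantVector, smul_sub, smul_smul, smul_eq_mul, Function.comp_apply]
  have hP' : 0 < (1 / 2 : ℝ) • q := by rw [smul_eq_mul]; positivity
  set p := (1 / 2 : ℝ) • q with hp
  have hBN : frameCoord (N c) (p • v c - r • X) = p * frameCoord (N c) (v c) := by
    rw [frameCoord_sub, frameCoord_smul, frameCoord_smul, hX, frameCoord_mulI_self]; ring
  refine ⟨g c * p, p * p, mul_pos (h.speed_pos c) hP', mul_pos hP' hP', ?_, ?_⟩
  · have := tendsto_frameCoord hσ hB
    convert! this using 2 with t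
    · rw [frameCoord_smul, frameCoord_smul_left, Complex.real_smul]
      push_cast
      rw [← mul_assoc, ← mul_inv]
      ring
    · rw [← neg_smul, frameCoord_smul_left, hX, frameCoord_mulI_left, ← hX, hBN]
      push_cast
      ring
  · have hη : Filter.Tendsto (fun t => inner ℝ (N c) (((t - c) ^ 2)⁻¹ • secantVector γ N v c t))
        (𝓝[≠] c) (𝓝 0) := by
      have := Filter.Tendsto.inner (𝕜 := ℝ) (tendsto_const_nhds (x := N c)) hB
      rwa [inner_sub_right, real_inner_smul_right, real_inner_smul_right, h.tangent,
        hX, inner_mulI_self, mul_zero, mul_zero, sub_zero] at this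
    have h1 := (((Complex.continuous_ofReal.tendsto _).comp hQ).mul
      (tendsto_frameCoord (tendsto_const_nhds (x := N c)) hB)).sub
      (((Complex.continuous_ofReal.tendsto _).comp hη).mul hσN)
    convert! h1 using 2 with t
    · simp only [projectedVector, frameCoord_sub, frameCoord_smul, Function.comp_apply,
        real_inner_smul_right, Complex.real_smul, smul_eq_mul]
      push_cast
      by_cases ht : (t : ℂ) - c = 0
      · simp [ht]
      · field_simp
    · rw [hBN]; push_cast; ring

/-- Between two consecutive visits of a point of a convex hypersurface, a solution of the linearized
equation makes more than a full turn in the quaternionic frame. -/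
theorem two_pi_lt_of_return (h : IsConvexOrbit γ N v A g κ)
    (hconv : ∀ s t, γ s ≠ γ t → inner ℝ (N t) (γ s - γ t) < 0)
    (hN : ∀ s t, γ s = γ t → N s = N t) {Θ : ℝ → ℝ} {a b : ℝ} (hab : a < b) (hγ : γ b = γ a)
    (hret : ∀ t ∈ Set.Ioo a b, γ t ≠ γ a)
    (hΘ : IsArgOn (fun t => frameCoord (N t) (v t)) Θ (Set.Icc a b)) :
    2 * Real.pi < Θ b - Θ a := by
  have hP : ∀ t ∈ Set.Ioo a b, inner ℝ (N t) (γ a - γ t) < 0 :=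
    fun t ht => hconv a t (hret t ht).symm
  have hQ : ∀ t ∈ Set.Ioo a b, 0 < inner ℝ (N a) (γ a - γ t) := fun t ht => by
    have := hconv t a (hret t ht)
    rw [← neg_sub, inner_neg_right] at this
    linarith
  have hV : Continuous fun t => frameCoord (N t) (v t) :=
    continuous_iff_continuousAt.2 fun t => tendsto_frameCoord h.continuous_normal.continuousAt
      h.continuous_vector.continuousAt
  choose! D hD hDpos using fun t (ht : t ∈ Set.Ioo a b) =>
    h.im_conj_frameCoord_projectedVector_pos (hP t ht) (hQ t ht)
  refine two_pi_lt_of_comparison (V := fun t => frameCoord (N t) (v t))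
    (w := fun t => frameCoord (γ a - γ t) (secantVector γ N v a t))
    (ψ := fun t => frameCoord (N a) (projectedVector γ N v a t))
    (ψ' := fun t => frameCoord (N a) (D t)) hab hV.continuousOn
    (fun t _ => h.frameCoord_ne_zero t) hΘ ?_ ?_ hDpos ?_ ?_ ?_
  · exact fun t _ => (tendsto_frameCoord
      (h.continuous_curve.continuousAt.const_sub _ : ContinuousAt (fun t => γ a - γ t) t)
      (h.hasDerivAt_secantVector a t).continuousAt).mono_left nhdsWithin_le_nhds
  · exact fun t ht => hasDerivAt_frameCoord (N a) (hD t ht)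
  · exact fun t ht => re_conj_frameCoord_mul_pos (omega_secantVector a t) (hQ t ht).ne'
      (h.frameCoord_secant_ne_zero (hP t ht))
  · intro t ht
    have h1 := re_conj_frameCoord_mul_pos (N := N t) (omega_secantVector (N := N) (v := v) a t)
      (hP t ht).ne (h.frameCoord_secant_ne_zero (hP t ht))
    rw [h.inner_normal_secantVector, zero_smul, sub_zero, frameCoord_smul, frameCoord_secantVector,
      mul_left_comm, mul_left_comm _ ((-inner ℝ (N t) (γ a - γ t) : ℝ) : ℂ),
      Complex.re_ofReal_mul, Complex.re_ofReal_mul] at h1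
    have h2 := hP t ht
    by_contra hcon
    push Not at hcon
    have h3 := mul_nonneg (mul_self_nonneg (inner ℝ (N t) (γ a - γ t))) hcon
    nlinarith
  · rintro c (rfl | rfl)
    · exact h.tendsto_frameCoord_secantVector c
    · obtain ⟨k, k', h1, h2, h3, h4⟩ := h.tendsto_frameCoord_secantVector c
      refine ⟨k, k', h1, h2, ?_, ?_⟩
      · simpa only [secantVector, hγ] using h3
      · simpa only [projectedVector, secantVector, hγ, hN _ _ hγ] using h4
end IsConvexOrbit

/-- Along a closed orbit on a convex hypersurface, which may be traversed several times, a solution of the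
linearized equation makes more than a full turn in the quaternionic frame. -/
theorem IsConvexOrbit.two_pi_lt_of_closed {γ N v : ℝ → R4} {A : ℝ → R4 →ₗ[ℝ] R4} {g κ : ℝ → ℝ}
    (h : IsConvexOrbit γ N v A g κ)
    (hconv : ∀ s t, γ s ≠ γ t → inner ℝ (N t) (γ s - γ t) < 0)
    (hN : ∀ s t, γ s = γ t → N s = N t) {Θ : ℝ → ℝ} (hγ : γ 1 = γ 0)
    (hΘ : IsArgOn (fun t => frameCoord (N t) (v t)) Θ (Set.Icc 0 1)) :
    2 * Real.pi < Θ 1 - Θ 0 := by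
  -- the orbit returns finitely often, and each return contributes more than a full turn
  set R : Set ℝ := {t ∈ Set.Icc (0 : ℝ) 1 | γ t = γ 0} with hR
  have hfin : R.Finite := by
    by_contra hinf
    obtain ⟨x, -, hx⟩ := Set.Infinite.exists_accPt_of_subset_isCompact hinf isCompact_Icc
      (Set.sep_subset _ _)
    rw [accPt_iff_frequently_nhdsNE] at hx
    have hne : g x • mulI (N x) ≠ 0 := by
      refine smul_ne_zero (h.speed_pos x).ne' fun e => h.normal_ne_zero x ?_
      have := mulI_mulI (N x)
      rw [e, map_zero] at this
      simpa using this.symm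
    have := (h.hasDerivAt_curve x).eventually_ne (c := γ 0) hne
    exact hx (this.mono fun y hy hyR => hy hyR.2)
  have key : ∀ n : ℕ, ∀ a ∈ R, a < 1 → (R ∩ Set.Ioi a).ncard ≤ n → 2 * Real.pi < Θ 1 - Θ a := by
    intro n
    induction n with
    | zero =>
      intro a ha ha1 hn
      have h1 : (1 : ℝ) ∈ R ∩ Set.Ioi a := ⟨⟨by simp, hγ⟩, ha1⟩
      rw [Nat.le_zero, Set.ncard_eq_zero (hfin.inter_of_left _)] at hn
      rw [hn] at h1
      exact h1.elim
    | succ n ih =>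
      intro a ha ha1 hn
      have h1 : (1 : ℝ) ∈ R ∩ Set.Ioi a := ⟨⟨by simp, hγ⟩, ha1⟩
      obtain ⟨b, ⟨hbR, hab⟩, hb⟩ := Set.exists_min_image (R ∩ Set.Ioi a) id
        (hfin.inter_of_left _) ⟨1, h1⟩
      have hab' : a < b := hab
      have step : 2 * Real.pi < Θ b - Θ a := by
        refine h.two_pi_lt_of_return hconv hN hab' (hbR.2.trans ha.2.symm) ?_
          (hΘ.mono (Set.Icc_subset_Icc ha.1.1 hbR.1.2))
        intro t ht htγ
        have := hb t ⟨⟨⟨ha.1.1.trans ht.1.le, ht.2.le.trans hbR.1.2⟩, htγ.trans ha.2⟩, ht.1⟩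
        exact absurd ht.2 (not_lt.2 this)
      rcases hbR.1.2.eq_or_lt with hb1 | hb1
      · rwa [hb1] at step
      · have hlt : (R ∩ Set.Ioi b).ncard < (R ∩ Set.Ioi a).ncard := by
          refine Set.ncard_lt_ncard ⟨fun t ht => ⟨ht.1, hab'.trans ht.2⟩, fun hsub => ?_⟩
            (hfin.inter_of_left _)
          exact lt_irrefl b (hsub ⟨hbR, hab⟩).2
        have := ih b hbR hb1 (by omega)
        have hpi := Real.pi_pos
        linarith
  exact key _ 0 ⟨by simp, rfl⟩ one_pos le_rfl

/-! ### The Conley–Zehnder index and the rotation set -/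

/-- A path whose rotation set is a compact interval in `(1, ∞)` has index at least `3`. -/
lemma three_le_conleyZehnderIndex_of_rotationSet {Φ : ℝ → ℂ → ℂ} {m M : ℝ}
    (hJ : rotationSet Φ = Set.Icc m M) (hmM : m ≤ M) (hm : 1 < m) : 3 ≤ conleyZehnderIndex Φ := by
  have hsmall : ∀ δ > (0 : ℝ), ∀ᶠ ε in 𝓝[>] (0 : ℝ), ε ∈ Set.Ioo 0 δ := fun δ hδ =>
    Ioo_mem_nhdsGT hδ
  unfold conleyZehnderIndex
  split_ifs with h1 h2
  · obtain ⟨ε, ⟨Δ, hΔ, e⟩, hε⟩ := (h1.choose_spec.and (hsmall (m - 1) (by linarith))).exists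
    rw [hJ] at hΔ
    have : (1 : ℝ) < h1.choose := by rw [← e]; linarith [hΔ.1, hε.2]
    have : 1 < h1.choose := by exact_mod_cast this
    omega
  · obtain ⟨ε, h, hε⟩ := (h2.choose_spec.and (hsmall (m - 1) (by linarith))).exists
    have := h m (by rw [hJ]; exact ⟨le_rfl, hmM⟩)
    have : (1 : ℝ) < h2.choose := by linarith [this.2, hε.2]
    have : 1 < h2.choose := by exact_mod_cast this
    omega
  · exfalso
    by_cases hk : ∃ k : ℤ, m ≤ k ∧ (k : ℝ) < M
    · obtain ⟨k, hk1, hk2⟩ := hk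
      refine h1 ⟨k, ?_⟩
      filter_upwards [hsmall (M - k) (by linarith)] with ε hε
      exact ⟨k + ε, by rw [hJ]; exact ⟨by linarith [hε.1], by linarith [hε.2]⟩, by ring⟩
    · push Not at hk
      have hM := hk ⌈m⌉ (Int.le_ceil m)
      refine h2 ⟨⌈m⌉, ?_⟩
      have hlt := Int.ceil_lt_add_one m
      filter_upwards [hsmall (m - (⌈m⌉ - 1)) (by linarith)] with ε hε Δ hΔ
      rw [hJ] at hΔ
      exact ⟨by linarith [hΔ.1, hε.2], by linarith [hΔ.2, hε.1]⟩

/-- If all vectors make more than a full turn along a path of orientation preserving linear maps, then its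
index is at least `3`. -/
lemma three_le_conleyZehnderIndex {Φ : ℝ → ℂ → ℂ} {z₁ z₂ : ℝ → ℂ}
    (hΦ : ∀ t v, Φ t v = v.re * z₁ t + v.im * z₂ t)
    (h₁ : ContinuousOn z₁ (Set.Icc 0 1)) (h₂ : ContinuousOn z₂ (Set.Icc 0 1))
    (hdet : ∀ t ∈ Set.Icc (0 : ℝ) 1, 0 < (starRingEnd ℂ (z₁ t) * z₂ t).im)
    (hrot : ∀ v : ℂ, v ≠ 0 → ∀ θ, IsArgOn (fun t => Φ t v) θ (Set.Icc 0 1) →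
      2 * Real.pi < θ 1 - θ 0) : 3 ≤ conleyZehnderIndex Φ := by
  have hΦ0 : ∀ v : ℂ, v ≠ 0 → ∀ t ∈ Set.Icc (0 : ℝ) 1, Φ t v ≠ 0 := by
    intro v hv t ht h0
    rw [hΦ] at h0
    have hd := hdet t ht
    have e1 := congrArg Complex.re h0
    have e2 := congrArg Complex.im h0
    simp at e1 e2 hd
    apply hv
    apply Complex.ext
    · have : v.re * ((z₁ t).re * (z₂ t).im + -((z₁ t).im * (z₂ t).re)) = 0 := by
        linear_combination (z₂ t).im * e1 - (z₂ t).re * e2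
      exact (mul_eq_zero.1 this).resolve_right (by linarith)
    · have : v.im * ((z₁ t).re * (z₂ t).im + -((z₁ t).im * (z₂ t).re)) = 0 := by
        linear_combination (z₁ t).re * e2 - (z₁ t).im * e1
      exact (mul_eq_zero.1 this).resolve_right (by linarith)
  -- a common choice of the arguments makes the rotation set the image of an interval, hence compact
  set S : Set (ℝ × ℝ) := Set.Icc (0 : ℝ) 1 ×ˢ Set.Icc (0 : ℝ) (2 * Real.pi) with hS
  have h2pi : (0 : ℝ) ≤ 2 * Real.pi := by positivity
  obtain ⟨l, hlc, hl⟩ := Convex.exists_continuous_exp_eq (S := S)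
    ((convex_Icc _ _).prod (convex_Icc _ _)) ⟨(0, 0), by simp [hS, Real.pi_pos.le]⟩
    (fun q => Φ q.1.1 (Complex.exp ((q.1.2 : ℂ) * Complex.I))) (by
      simp only [hΦ]
      have c1 : Continuous fun q : S => z₁ q.1.1 :=
        h₁.comp_continuous (by fun_prop) fun q => q.2.1
      have c2 : Continuous fun q : S => z₂ q.1.1 :=
        h₂.comp_continuous (by fun_prop) fun q => q.2.1
      have c3 : Continuous fun q : S => Complex.exp ((q.1.2 : ℂ) * Complex.I) := by fun_prop
      exact ((Complex.continuous_ofReal.comp (Complex.continuous_re.comp c3)).mul c1).add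
        ((Complex.continuous_ofReal.comp (Complex.continuous_im.comp c3)).mul c2))
    (fun q => hΦ0 _ (Complex.exp_ne_zero _) _ q.2.1)
  classical
  set F : ℝ × ℝ → ℝ := fun q => if hq : q ∈ S then (l ⟨q, hq⟩).im else 0 with hF
  have hFc : ContinuousOn F S := by
    rw [continuousOn_iff_continuous_domRestrict]
    have : S.domRestrict F = fun q => (l q).im := by
      ext q
      simp [hF]
    rw [this]
    exact Complex.continuous_im.comp hlc
  have hFarg : ∀ s ∈ Set.Icc (0 : ℝ) (2 * Real.pi),
      IsArgOn (fun t => Φ t (Complex.exp ((s : ℂ) * Complex.I))) (fun t => F (t, s))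
        (Set.Icc 0 1) := by
    intro s hs
    refine ⟨hFc.comp (by fun_prop) fun t ht => ⟨ht, hs⟩, fun t ht => ?_⟩
    have hq : (t, s) ∈ S := ⟨ht, hs⟩
    have e := hl ⟨(t, s), hq⟩
    simp only at e
    rw [← e, Complex.norm_exp]
    simp only [hF, hq, dif_pos]
    rw [Complex.ofReal_exp, ← Complex.exp_add, Complex.re_add_im]
  have hpre : IsPreconnected (Set.Icc (0 : ℝ) 1) := isPreconnected_Icc
  set Δ : ℝ → ℝ := fun s => (F (1, s) - F (0, s)) / (2 * Real.pi) with hΔ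
  have hΔc : ContinuousOn Δ (Set.Icc 0 (2 * Real.pi)) := by
    refine ContinuousOn.div_const (ContinuousOn.sub ?_ ?_) _
    · exact hFc.comp (by fun_prop) fun s hs => ⟨by simp, hs⟩
    · exact hFc.comp (by fun_prop) fun s hs => ⟨by simp, hs⟩
  have hJ : rotationSet Φ = Δ '' Set.Icc 0 (2 * Real.pi) := by
    ext d
    constructor
    · rintro ⟨v, hv, θ, hθ, hθ', rfl⟩
      obtain ⟨s, hs, hvs⟩ : ∃ s ∈ Set.Icc (0 : ℝ) (2 * Real.pi),
          v = ‖v‖ * Complex.exp ((s : ℂ) * Complex.I) := by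
        by_cases ha : 0 ≤ Complex.arg v
        · exact ⟨_, ⟨ha, by linarith [Complex.arg_le_pi v, Real.pi_pos]⟩,
            (Complex.norm_mul_exp_arg_mul_I v).symm⟩
        · refine ⟨Complex.arg v + 2 * Real.pi,
            ⟨by linarith [Complex.neg_pi_lt_arg v, Real.pi_pos], by linarith⟩, ?_⟩
          push_cast
          rw [add_mul, Complex.exp_add, Complex.exp_two_pi_mul_I, mul_one,
            Complex.norm_mul_exp_arg_mul_I]
      refine ⟨s, hs, ?_⟩
      have hscale : ∀ t, Φ t v = ‖v‖ * Φ t (Complex.exp ((s : ℂ) * Complex.I)) := by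
        intro t
        rw [hΦ, hΦ]
        conv_lhs => rw [hvs]
        rw [Complex.re_ofReal_mul, Complex.im_ofReal_mul]
        push_cast
        ring
      have hA : IsArgOn (fun t => Φ t v) (fun t => F (t, s)) (Set.Icc 0 1) := by
        refine ⟨(hFarg s hs).cont, fun t ht => ?_⟩
        have e := (hFarg s hs).eq t ht
        rw [hscale, norm_mul, Complex.norm_real, norm_norm]
        conv_lhs => rw [e]
        push_cast
        ring
      rw [hΔ]
      simp only
      rw [hA.sub_eq_sub hpre ⟨hθ, hθ'⟩ (hΦ0 v hv) (s := 0) (t := 1) (by simp) (by simp)]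
    · rintro ⟨s, hs, rfl⟩
      exact ⟨_, Complex.exp_ne_zero _, _, (hFarg s hs).cont, (hFarg s hs).eq, rfl⟩
  have hΔ1 : ∀ s ∈ Set.Icc (0 : ℝ) (2 * Real.pi), 1 < Δ s := fun s hs => by
    have := hrot _ (Complex.exp_ne_zero _) _ (hFarg s hs)
    rw [hΔ]
    simp only
    rwa [one_lt_div (by positivity)]
  have hIcc := hΔc.image_Icc h2pi
  have hne : (Δ '' Set.Icc 0 (2 * Real.pi)).Nonempty := ⟨_, 0, by simp [Real.pi_pos.le], rfl⟩
  rw [hIcc] at hne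
  have hle := Set.nonempty_Icc.1 hne
  refine three_le_conleyZehnderIndex_of_rotationSet (hJ.trans hIcc) hle ?_
  have hmem : sInf (Δ '' Set.Icc 0 (2 * Real.pi)) ∈ Δ '' Set.Icc 0 (2 * Real.pi) := by
    have h := Set.left_mem_Icc.2 hle
    rwa [← hIcc] at h
  obtain ⟨s, hs, e⟩ := hmem
  rw [← e]
  exact hΔ1 s hs

lemma continuous_diskBoundary : Continuous diskBoundary :=
  Continuous.subtype_mk (by fun_prop) _

lemma diskBoundary_one : diskBoundary 1 = diskBoundary 0 := by
  apply Subtype.ext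
  simp [diskBoundary, Complex.exp_two_pi_mul_I]

lemma div_mem_slitPlane {V z : ℂ} (hz : z ≠ 0)
    (h : 0 < (starRingEnd ℂ z * V).re ∨ (starRingEnd ℂ z * V).im ≠ 0) :
    V / z ∈ Complex.slitPlane := by
  have hp : 0 < (Complex.normSq z)⁻¹ := inv_pos.2 (Complex.normSq_pos.2 hz)
  rw [div_eq_mul_inv, Complex.inv_def, ← mul_assoc, mul_comm V, Complex.mem_slitPlane_iff,
    Complex.re_mul_ofReal, Complex.im_mul_ofReal]
  rcases h with h | h
  · exact Or.inl (mul_pos h hp)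
  · exact Or.inr (mul_ne_zero h hp.ne')

/-- An upper triangular matrix with positive diagonal turns no vector by a half turn. -/
lemma upperTriangular_div_mem_slitPlane {r p q : ℝ} (hr : 0 < r) (hq : 0 < q) {z : ℂ} (hz : z ≠ 0) :
    (⟨r * z.re + p * z.im, q * z.im⟩ : ℂ) / z ∈ Complex.slitPlane := by
  refine div_mem_slitPlane hz ?_
  simp
  by_cases hy : z.im = 0
  · left
    have hx : z.re ≠ 0 := fun hx => hz (Complex.ext hx hy)
    rw [hy]
    have : 0 < z.re ^ 2 := by positivity
    nlinarith
  · by_cases hi : z.re * (q * z.im) + -(z.im * (r * z.re + p * z.im)) = 0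
    · left
      have h1 : q * z.re = r * z.re + p * z.im := by
        apply mul_left_cancel₀ hy
        linear_combination hi
      rw [← h1]
      have : 0 < z.im ^ 2 := by positivity
      nlinarith [mul_nonneg hq.le (sq_nonneg z.re), mul_pos hq this]
    · exact Or.inr hi

/-- The property of making more than a full turn does not depend on the choice of a frame that extends
over the disk: as the disk is simply connected, a frame change is homotopic, through frame changes with
fixed values at the ends, to one by upper triangular matrices with positive diagonal. -/
lemma two_pi_lt_of_frame_change {c₁ c₂ : ClosedDisk → ℂ} (h₁ : Continuous c₁) (h₂ : Continuous c₂)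
    (hdet : ∀ x, 0 < (starRingEnd ℂ (c₁ x) * c₂ x).im) {z : ℝ → ℂ} (hz : ContinuousOn z (Set.Icc 0 1))
    (hz0 : ∀ t ∈ Set.Icc (0 : ℝ) 1, z t ≠ 0) {θ : ℝ → ℝ} (hθ : IsArgOn z θ (Set.Icc 0 1))
    (hV : ∀ Θ, IsArgOn (fun t => (z t).re * c₁ (diskBoundary t) + (z t).im * c₂ (diskBoundary t)) Θ
      (Set.Icc 0 1) → 2 * Real.pi < Θ 1 - Θ 0) : 2 * Real.pi < θ 1 - θ 0 := by
  have hc0 : ∀ x, c₁ x ≠ 0 := fun x e => by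
    have := hdet x
    simp [e] at this
  obtain ⟨l, hlc, hl⟩ := Convex.exists_continuous_exp_eq (S := Metric.closedBall (0 : ℂ) 1)
    (convex_closedBall _ _) ⟨0, by simp⟩ c₁ h₁ hc0
  set φ : ClosedDisk → ℝ := fun x => (l x).im with hφ
  set ρ : ClosedDisk → ℂ := fun x => Complex.exp (-((φ x : ℂ) * Complex.I)) with hρ
  have hφc : Continuous φ := Complex.continuous_im.comp hlc
  set r : ClosedDisk → ℝ := fun x => Real.exp (l x).re with hr
  set p : ClosedDisk → ℝ := fun x => (c₂ x * ρ x).re with hp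
  set q : ClosedDisk → ℝ := fun x => (c₂ x * ρ x).im with hq
  have hc₁ : ∀ x, c₁ x * ρ x = r x := fun x => by
    rw [← hl x, hρ]
    simp only
    rw [← Complex.exp_add, hr, Complex.ofReal_exp]
    congr 1
    apply Complex.ext <;> simp [hφ]
  have hρn : ∀ x, Complex.normSq (ρ x) = 1 := fun x => by
    rw [Complex.normSq_eq_norm_sq, hρ]
    simp only
    rw [← neg_mul, ← Complex.ofReal_neg, Complex.norm_exp_ofReal_mul_I]
    norm_num
  have hqpos : ∀ x, 0 < q x := fun x => by
    have h3 : (starRingEnd ℂ (c₁ x * ρ x) * (c₂ x * ρ x)) = starRingEnd ℂ (c₁ x) * c₂ x := by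
      have : starRingEnd ℂ (ρ x) * ρ x = 1 := by
        rw [mul_comm, Complex.mul_conj, hρn]; simp
      rw [map_mul]
      linear_combination (starRingEnd ℂ (c₁ x) * c₂ x) * this
    have h4 := hdet x
    rw [← h3, hc₁, Complex.conj_ofReal, Complex.im_ofReal_mul] at h4
    exact pos_of_mul_pos_right h4 (Real.exp_pos _).le
  -- the frame change, multiplied by `exp (-φ i)`, is upper triangular with positive diagonal
  set U : ClosedDisk → ℂ → ℂ := fun x w => ⟨r x * w.re + p x * w.im, q x * w.im⟩ with hU
  have hUeq : ∀ x w, (w.re * c₁ x + w.im * c₂ x) * ρ x = U x w := fun x w => by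
    rw [add_mul, mul_assoc, mul_assoc, hc₁]
    apply Complex.ext
    · simp [hU, hp]; ring
    · simp [hU, hq]; ring
  have hslit : ∀ x w, w ≠ 0 → U x w / w ∈ Complex.slitPlane := fun x w hw =>
    upperTriangular_div_mem_slitPlane (Real.exp_pos _) (hqpos x) hw
  have hrc : Continuous r := Real.continuous_exp.comp (Complex.continuous_re.comp hlc)
  have hρc : Continuous ρ := by fun_prop
  have hpc : Continuous p := Complex.continuous_re.comp (h₂.mul hρc)
  have hqc : Continuous q := Complex.continuous_im.comp (h₂.mul hρc)
  have hUeq' : ∀ x w, U x w = ((r x * w.re + p x * w.im : ℝ) : ℂ) + ((q x * w.im : ℝ) : ℂ) *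
      Complex.I := fun x w => by
    apply Complex.ext <;> simp [hU]
  have hdb := continuous_diskBoundary
  have hUz : ContinuousOn (fun t => U (diskBoundary t) (z t)) (Set.Icc 0 1) := by
    simp only [hUeq']
    have e1 : ContinuousOn (fun t => (z t).re) (Set.Icc 0 1) := Complex.continuous_re.comp_continuousOn hz
    have e2 : ContinuousOn (fun t => (z t).im) (Set.Icc 0 1) := Complex.continuous_im.comp_continuousOn hz
    have e3 : ContinuousOn (fun t => r (diskBoundary t)) (Set.Icc 0 1) := (hrc.comp hdb).continuousOn
    have e4 : ContinuousOn (fun t => p (diskBoundary t)) (Set.Icc 0 1) := (hpc.comp hdb).continuousOn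
    have e5 : ContinuousOn (fun t => q (diskBoundary t)) (Set.Icc 0 1) := (hqc.comp hdb).continuousOn
    fun_prop
  have hΘ : IsArgOn (fun t => (z t).re * c₁ (diskBoundary t) + (z t).im * c₂ (diskBoundary t))
      (fun t => θ t + Complex.arg (U (diskBoundary t) (z t) / z t) + φ (diskBoundary t))
      (Set.Icc 0 1) := by
    constructor
    · refine (hθ.cont.add ?_).add (hφc.comp hdb).continuousOn
      exact fun t ht => (Complex.continuousAt_arg (hslit _ _ (hz0 t ht))).comp_continuousWithinAt
        (f := fun t => U (diskBoundary t) (z t) / z t) ((hUz.div hz hz0) t ht)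
    · intro t ht
      have h0 := hz0 t ht
      have hU0 : U (diskBoundary t) (z t) ≠ 0 := fun e => by
        have := Complex.slitPlane_ne_zero (hslit (diskBoundary t) _ h0)
        simp [e] at this
      have hVU : (z t).re * c₁ (diskBoundary t) + (z t).im * c₂ (diskBoundary t) =
          U (diskBoundary t) (z t) * Complex.exp ((φ (diskBoundary t) : ℂ) * Complex.I) := by
        rw [← hUeq, hρ]
        simp only
        rw [mul_assoc, ← Complex.exp_add, neg_add_cancel, Complex.exp_zero, mul_one]
      rw [hVU]
      push_cast
      have n1 : (‖z t‖ : ℂ) ≠ 0 := by simpa using h0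
      have n2 : (‖U (diskBoundary t) (z t)‖ : ℂ) ≠ 0 := by simpa using hU0
      rw [add_mul, add_mul, Complex.exp_add, Complex.exp_add, hθ.exp_eq ht h0,
        exp_arg_mul_I (div_ne_zero hU0 h0), norm_mul, norm_div, Complex.norm_exp_ofReal_mul_I]
      push_cast
      field_simp
  have hgt := hV _ hΘ
  simp only [diskBoundary_one] at hgt
  -- the lift to `ℝ` of the action of an upper triangular matrix on directions is increasing
  set x₀ := diskBoundary 0 with hx₀
  set e : ℝ → ℂ := fun s => Complex.exp ((s : ℂ) * Complex.I) with he
  set G : ℝ → ℝ := fun s => s + Complex.arg (U x₀ (e s) / e s) with hG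
  have he0 : ∀ s, e s ≠ 0 := fun s => Complex.exp_ne_zero _
  have hec : Continuous e := by fun_prop
  have hUe : Continuous fun s => U x₀ (e s) := by
    simp only [hUeq']
    fun_prop
  have hGarg : IsArgOn (fun s => U x₀ (e s)) G Set.univ := by
    constructor
    · refine continuousOn_id.add fun s _ => ContinuousAt.continuousWithinAt ?_
      exact (Complex.continuousAt_arg (hslit _ _ (he0 s))).comp (f := fun s => U x₀ (e s) / e s)
        (hUe.continuousAt.div hec.continuousAt (he0 s))
    · intro s _
      have hU0 : U x₀ (e s) ≠ 0 := fun h0 => by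
        have := Complex.slitPlane_ne_zero (hslit x₀ _ (he0 s))
        simp [h0] at this
      have n2 : (‖U x₀ (e s)‖ : ℂ) ≠ 0 := by simpa using hU0
      have n3 : ‖e s‖ = 1 := Complex.norm_exp_ofReal_mul_I s
      rw [hG]
      push_cast
      rw [add_mul, Complex.exp_add, exp_arg_mul_I (div_ne_zero hU0 (he0 s)), norm_div, n3, div_one,
        show Complex.exp ((s : ℂ) * Complex.I) = e s from rfl]
      have := he0 s
      field_simp
  have hGmono : StrictMonoOn G Set.univ := by
    refine hGarg.strictMonoOn isOpen_univ convex_univ (z' := fun s => U x₀ (e s * Complex.I))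
      (fun s _ => ?_) (fun s _ => ?_)
    · have hd : HasDerivAt e (e s * Complex.I) s := by
        have := ((Complex.ofRealCLM.hasDerivAt (x := s)).mul_const Complex.I).cexp
        simpa [he] using this
      have hre : HasDerivAt (fun s => (e s).re) (e s * Complex.I).re s :=
        Complex.reCLM.hasFDerivAt.comp_hasDerivAt s hd
      have him : HasDerivAt (fun s => (e s).im) (e s * Complex.I).im s :=
        Complex.imCLM.hasFDerivAt.comp_hasDerivAt s hd
      simp only [hUeq']
      exact ((hre.const_mul _).add (him.const_mul _)).ofReal_comp.add
        ((him.const_mul _).ofReal_comp.mul_const _)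
    · have hn : (e s).re ^ 2 + (e s).im ^ 2 = 1 := by
        have : Complex.normSq (e s) = 1 := by
          rw [Complex.normSq_eq_norm_sq, he]
          simp only
          rw [Complex.norm_exp_ofReal_mul_I]; norm_num
        rw [Complex.normSq_apply] at this
        linarith
      have hpos : 0 < r x₀ * q x₀ := mul_pos (Real.exp_pos _) (hqpos x₀)
      have : (starRingEnd ℂ (U x₀ (e s)) * U x₀ (e s * Complex.I)).im = r x₀ * q x₀ := by
        simp [hU]
        linear_combination (r x₀ * q x₀) * hn
      rw [this]
      exact hpos
  have hGper : ∀ s, G (s + 2 * Real.pi) = G s + 2 * Real.pi := fun s => by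
    have : e (s + 2 * Real.pi) = e s := by
      simp only [he]
      push_cast
      rw [add_mul, Complex.exp_add, Complex.exp_two_pi_mul_I, mul_one]
    simp only [hG, this]
    ring
  have hGz : ∀ t ∈ Set.Icc (0 : ℝ) 1, G (θ t) = θ t + Complex.arg (U x₀ (z t) / z t) := by
    intro t ht
    have h0 := hz0 t ht
    have hn : 0 < ‖z t‖ := norm_pos_iff.2 h0
    have hzt : z t = (‖z t‖ : ℂ) * e (θ t) := hθ.eq t ht
    have hUs : U x₀ (z t) / z t = U x₀ (e (θ t)) / e (θ t) := by
      have : U x₀ (z t) = (‖z t‖ : ℂ) * U x₀ (e (θ t)) := by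
        conv_lhs => rw [hzt]
        simp only [hUeq', Complex.re_ofReal_mul, Complex.im_ofReal_mul]
        push_cast
        ring
      rw [this]
      conv_lhs => rw [hzt]
      have n1 : (‖z t‖ : ℂ) ≠ 0 := by simpa using h0
      rw [norm_mul, Complex.norm_real, norm_norm]
      rw [show ‖e (θ t)‖ = 1 from Complex.norm_exp_ofReal_mul_I _, mul_one]
      rw [mul_div_mul_left _ _ n1]
    rw [hUs]
  by_contra hcon
  push Not at hcon
  have h3 : G (θ 1) ≤ G (θ 0 + 2 * Real.pi) :=
    hGmono.monotoneOn trivial trivial (by linarith)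
  rw [hGper, hGz 1 (by simp), hGz 0 (by simp)] at h3
  linarith

/-! ### Convexity of the bounded component of the energy level -/

/-- The gradient of the Hénon–Heiles Hamiltonian. -/
def henonGrad (p : R4) : R4 := !₂[p 0 + 2 * p 0 * p 1, p 1 + p 0 ^ 2 - p 1 ^ 2, p 2, p 3]

/-- The Hessian of the Hénon–Heiles Hamiltonian. -/
def henonHess (p : R4) : R4 →ₗ[ℝ] R4 where
  toFun u := !₂[(1 + 2 * p 1) * u 0 + 2 * p 0 * u 1, 2 * p 0 * u 0 + (1 - 2 * p 1) * u 1, u 2, u 3]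
  map_add' u w := by ext i; fin_cases i <;> simp <;> ring
  map_smul' c u := by ext i; fin_cases i <;> simp <;> ring

/-- The cubic part of the Hénon–Heiles Hamiltonian. -/
def henonCubic (p : R4) : ℝ := p 0 ^ 2 * p 1 - p 1 ^ 3 / 3

/-- The squared distance from the origin in configuration space. -/
def configSq (p : R4) : ℝ := p 0 ^ 2 + p 1 ^ 2

/-- The bounded part of the sublevel set `H ≤ E`. -/
def henonBody (E : ℝ) : Set R4 := {p | henonHeiles p ≤ E ∧ configSq p ≤ 1}

/-- The bounded component of the energy level `H = E`. -/
def henonSphere (E : ℝ) : Set R4 := {p | henonHeiles p = E ∧ configSq p < 1}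

lemma henonHess_apply (p u : R4) : henonHess p u =
    !₂[(1 + 2 * p 1) * u 0 + 2 * p 0 * u 1, 2 * p 0 * u 0 + (1 - 2 * p 1) * u 1, u 2, u 3] := rfl

lemma henonHeiles_eq (p : R4) : henonHeiles p = ‖p‖ ^ 2 / 2 + henonCubic p := by
  simp only [henonHeiles, henonPotential, norm_sq_R4, henonCubic]; ring

/-- The Taylor expansion of the Hamiltonian, which is a cubic polynomial. -/
lemma henonHeiles_add_smul (p v : R4) (τ : ℝ) : henonHeiles (p + τ • v) = henonHeiles p +
    τ * inner ℝ (henonGrad p) v + τ ^ 2 / 2 * inner ℝ (henonHess p v) v + τ ^ 3 * henonCubic v := by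
  simp [henonHeiles, henonPotential, inner_R4, henonGrad, henonHess_apply, henonCubic]
  ring

lemma henonHess_symm (p u w : R4) : inner ℝ (henonHess p u) w = inner ℝ u (henonHess p w) := by
  simp [inner_R4, henonHess_apply]; ring

@[fun_prop] lemma contDiff_henonHeiles {n : WithTop ℕ∞} : ContDiff ℝ n henonHeiles := by
  unfold henonHeiles henonPotential
  fun_prop

@[fun_prop] lemma contDiff_henonGrad {n : WithTop ℕ∞} : ContDiff ℝ n henonGrad := by
  rw [contDiff_euclidean]
  intro i
  fin_cases i <;> simp [henonGrad] <;> fun_prop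

@[fun_prop] lemma contDiff_henonCubic {n : WithTop ℕ∞} : ContDiff ℝ n henonCubic := by
  unfold henonCubic
  fun_prop

@[fun_prop] lemma continuous_configSq : Continuous configSq := by
  unfold configSq
  fun_prop

lemma continuous_henonHeiles : Continuous henonHeiles := contDiff_henonHeiles (n := 0).continuous

/-- A map with a first order Taylor polynomial along lines given by a continuous linear map has this map
as its derivative. -/
lemma fderiv_apply_eq_of_hasDerivAt {W : Type*} [NormedAddCommGroup W] [NormedSpace ℝ W] {f : R4 → W}
    {p v : R4} {d : W} (hf : DifferentiableAt ℝ f p)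
    (h : HasDerivAt (fun τ : ℝ => f (p + τ • v)) d 0) : fderiv ℝ f p v = d := by
  have hl : HasDerivAt (fun τ : ℝ => p + τ • v) v 0 := by
    simpa using ((hasDerivAt_id (0 : ℝ)).smul_const v).const_add p
  have := HasFDerivAt.comp_hasDerivAt (f := fun τ : ℝ => p + τ • v) (x := (0 : ℝ)) (l := f)
    (l' := fderiv ℝ f p) (by simpa using hf.hasFDerivAt) hl
  exact this.unique h

lemma hasDerivAt_cubic (a b c d : ℝ) :
    HasDerivAt (fun τ : ℝ => a + τ * b + τ ^ 2 / 2 * c + τ ^ 3 * d) b 0 := by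
  have h1 := (hasDerivAt_id (0 : ℝ)).mul_const b
  have h2 := (((hasDerivAt_id (0 : ℝ)).pow 2).div_const 2).mul_const c
  have h3 := ((hasDerivAt_id (0 : ℝ)).pow 3).mul_const d
  exact (((h1.const_add a).add h2).add h3).congr_deriv (by simp)

lemma fderiv_henonHeiles_apply (p v : R4) : fderiv ℝ henonHeiles p v = inner ℝ (henonGrad p) v := by
  apply fderiv_apply_eq_of_hasDerivAt ((contDiff_henonHeiles (n := 1)).differentiable (by simp) p)
  simp only [henonHeiles_add_smul]
  exact hasDerivAt_cubic _ _ _ _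

lemma fderiv_henonHeiles (p : R4) : fderiv ℝ henonHeiles p = innerSL ℝ (henonGrad p) := by
  ext v
  rw [fderiv_henonHeiles_apply, innerSL_apply_apply]

lemma fderiv_henonGrad_apply (p v : R4) : fderiv ℝ henonGrad p v = henonHess p v := by
  apply fderiv_apply_eq_of_hasDerivAt ((contDiff_henonGrad (n := 1)).differentiable (by simp) p)
  have he : (fun τ : ℝ => henonGrad (p + τ • v)) = fun τ : ℝ => henonGrad p + τ • henonHess p v +
      τ ^ 2 • (!₂[2 * v 0 * v 1, v 0 ^ 2 - v 1 ^ 2, 0, 0] : R4) := by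
    funext τ
    ext i
    fin_cases i <;> simp [henonGrad, henonHess_apply] <;> ring
  rw [he]
  have h1 := (hasDerivAt_id (0 : ℝ)).smul_const (henonHess p v)
  have h2 := ((hasDerivAt_id (0 : ℝ)).pow 2).smul_const
    (!₂[2 * v 0 * v 1, v 0 ^ 2 - v 1 ^ 2, 0, 0] : R4)
  exact ((h1.const_add (henonGrad p)).add h2).congr_deriv (by simp)

lemma fderiv_fderiv_henonHeiles (p u v : R4) :
    fderiv ℝ (fderiv ℝ henonHeiles) p u v = inner ℝ (henonHess p u) v := by
  have : fderiv ℝ henonHeiles = fun p => innerSL ℝ (henonGrad p) := funext fderiv_henonHeiles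
  rw [this]
  have h := ((innerSL ℝ (E := R4)).hasFDerivAt (x := henonGrad p)).comp p
    ((contDiff_henonGrad (n := 1)).differentiable (by simp) p).hasFDerivAt
  have h' : fderiv ℝ (fun p => innerSL ℝ (henonGrad p)) p =
      (innerSL ℝ (E := R4)).comp (fderiv ℝ henonGrad p) := h.fderiv
  rw [h']
  simp [fderiv_henonGrad_apply]

/-- The potential is at least `1/6`, the value at the saddles, on the unit circle of configuration space,
which therefore separates the bounded part of a lower energy level from the rest. -/
lemma configSq_ne_one {E : ℝ} (hE : E < 1 / 6) {p : R4} (hp : henonHeiles p ≤ E) :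
    configSq p ≠ 1 := by
  intro h
  simp only [configSq] at h
  simp only [henonHeiles, henonPotential] at hp
  have h0 : p 0 ^ 2 = 1 - p 1 ^ 2 := by linarith
  rw [h0] at hp
  have h1 : p 1 ≤ 1 := by nlinarith [sq_nonneg (p 0)]
  nlinarith [mul_nonneg (sub_nonneg.2 h1) (sq_nonneg (1 + 2 * p 1)), sq_nonneg (p 2),
    sq_nonneg (p 3)]

lemma henonBody_configSq_lt {E : ℝ} (hE : E < 1 / 6) {p : R4} (hp : p ∈ henonBody E) :
    configSq p < 1 := lt_of_le_of_ne hp.2 (configSq_ne_one hE hp.1)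

lemma henonSphere_subset_henonBody {E : ℝ} : henonSphere E ⊆ henonBody E :=
  fun _ hp => ⟨hp.1.le, hp.2.le⟩

/-- A symmetric `2 × 2` matrix with nonnegative trace and positive determinant is positive definite. -/
lemma quadratic_pos_of_trace_det {a b d c e : ℝ} (htr : 0 ≤ a + d) (hdet : 0 < a * d - b ^ 2)
    (hq : 0 < c ^ 2 + e ^ 2) : 0 < a * c ^ 2 + 2 * b * c * e + d * e ^ 2 := by
  -- the Cayley–Hamilton identity
  have key : (a + d) * (a * c ^ 2 + 2 * b * c * e + d * e ^ 2) =
      (a * c + b * e) ^ 2 + (b * c + d * e) ^ 2 + (c ^ 2 + e ^ 2) * (a * d - b ^ 2) := by ring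
  have h1 : 0 < (a + d) * (a * c ^ 2 + 2 * b * c * e + d * e ^ 2) := by
    rw [key]; positivity
  exact pos_of_mul_pos_right h1 htr

/-- A quadratic form on the plane that is positive on `(-w, v)` is positive on the vectors annihilated by
the covector `(v, w)`, which are its multiples. -/
lemma quadratic_pos_of_tangent {a b d c e v w : ℝ} (hD : v * c + w * e = 0)
    (hadj : 0 < a * w ^ 2 + d * v ^ 2 - 2 * b * v * w) (hq : 0 < c ^ 2 + e ^ 2) :
    0 < a * c ^ 2 + 2 * b * c * e + d * e ^ 2 := by
  have key : (v ^ 2 + w ^ 2) * (a * c ^ 2 + 2 * b * c * e + d * e ^ 2) =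
      (c ^ 2 + e ^ 2) * (a * w ^ 2 + d * v ^ 2 - 2 * b * v * w) := by
    linear_combination (a * (v * c - w * e) + 2 * b * (v * e + w * c) + d * (w * e - v * c)) * hD
  have h1 : 0 < (v ^ 2 + w ^ 2) * (a * c ^ 2 + 2 * b * c * e + d * e ^ 2) := by
    rw [key]; positivity
  exact pos_of_mul_pos_right h1 (by positivity)

/-- The Hessian is positive definite on the tangent spaces of the bounded component. For a tangent vector
with configuration part `q ≠ 0`, the Cauchy–Schwarz inequality in the momenta reduces this to
`m V''(q, q) + (dV q)² > 0`, where `m = 2 (E - V)`; the determinant of this form is `m` times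
`m (1 - |x|²) + |x|² (1 - 6 E)`. -/
lemma inner_henonHess_pos {E : ℝ} (h0 : 0 < E) (hE : E < 1 / 6) {p : R4} (hp : p ∈ henonSphere E)
    {u : R4} (ht : inner ℝ (henonGrad p) u = 0) (hu : u ≠ 0) : 0 < inner ℝ (henonHess p u) u := by
  obtain ⟨hH, hR⟩ := hp
  simp only [configSq] at hR
  simp only [henonHeiles, henonPotential] at hH
  simp [inner_R4, henonGrad] at ht
  simp only [inner_R4, henonHess_apply]
  simp
  have hu' : ¬(u 0 = 0 ∧ u 1 = 0 ∧ u 2 = 0 ∧ u 3 = 0) := fun h => hu (by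
    ext i
    fin_cases i
    exacts [h.1, h.2.1, h.2.2.1, h.2.2.2])
  generalize p 0 = x at *
  generalize p 1 = y at *
  generalize p 2 = a at *
  generalize p 3 = b at *
  generalize u 0 = c at *
  generalize u 1 = d at *
  generalize u 2 = e at *
  generalize u 3 = f at *
  obtain ⟨R, hRdef⟩ : ∃ R, R = x ^ 2 + y ^ 2 := ⟨_, rfl⟩
  obtain ⟨m, hm⟩ : ∃ m, m = a ^ 2 + b ^ 2 := ⟨_, rfl⟩
  obtain ⟨V₁, hV₁⟩ : ∃ V, V = x + 2 * x * y := ⟨_, rfl⟩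
  obtain ⟨V₂, hV₂⟩ : ∃ V, V = y + x ^ 2 - y ^ 2 := ⟨_, rfl⟩
  have hR0 : 0 ≤ R := by rw [hRdef]; positivity
  have hm0 : 0 ≤ m := by rw [hm]; positivity
  rw [← hRdef] at hR
  have hD : V₁ * c + V₂ * d = -(a * e + b * f) := by rw [hV₁, hV₂]; linarith
  have hCS : (V₁ * c + V₂ * d) ^ 2 ≤ m * (e ^ 2 + f ^ 2) := by
    rw [hD, hm]
    linarith [sq_nonneg (a * f - b * e)]
  have hG : 0 < m * (1 - R) + R * (1 - 6 * E) := by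
    rcases hm0.eq_or_lt with hm' | hm'
    · rcases hR0.eq_or_lt with hR' | hR'
      · exfalso
        have hx : x = 0 := by
          have := sq_nonneg y
          exact pow_eq_zero_iff two_ne_zero |>.1 (le_antisymm (by linarith) (sq_nonneg x))
        have hy : y = 0 := by
          have := sq_nonneg x
          exact pow_eq_zero_iff two_ne_zero |>.1 (le_antisymm (by linarith) (sq_nonneg y))
        rw [hx, hy] at hH
        norm_num at hH
        linarith
      · rw [← hm']
        have := mul_pos hR' (show 0 < 1 - 6 * E by linarith)
        linarith
    · have h1 := mul_pos hm' (show 0 < 1 - R by linarith)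
      have h2 := mul_nonneg hR0 (show 0 ≤ 1 - 6 * E by linarith)
      linarith
  have hadj : (1 + 2 * y) * V₂ ^ 2 + (1 - 2 * y) * V₁ ^ 2 - 2 * (2 * x) * V₁ * V₂ =
      R * (1 - 6 * E) + 3 * m * R := by
    rw [hV₁, hV₂, ← hH, hRdef, hm]; ring
  suffices h : 0 < (1 + 2 * y) * c ^ 2 + 2 * (2 * x) * c * d + (1 - 2 * y) * d ^ 2 +
      (e ^ 2 + f ^ 2) by linarith
  by_cases hq : c = 0 ∧ d = 0
  · obtain ⟨rfl, rfl⟩ := hq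
    have hef : 0 < e ^ 2 + f ^ 2 := by
      by_cases he : e = 0
      · have hf : f ≠ 0 := fun hf => hu' ⟨rfl, rfl, he, hf⟩
        positivity
      · positivity
    linarith
  · have hq' : 0 < c ^ 2 + d ^ 2 := by
      by_cases hc : c = 0
      · have hd : d ≠ 0 := fun hd => hq ⟨hc, hd⟩
        positivity
      · positivity
    have hef : 0 ≤ e ^ 2 + f ^ 2 := by positivity
    rcases hm0.eq_or_lt with hm' | hm'
    · rw [← hm'] at hCS hG hadj
      have hD0 : V₁ * c + V₂ * d = 0 := by
        refine pow_eq_zero_iff two_ne_zero |>.1 (le_antisymm (by linarith) (sq_nonneg _))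
      have := quadratic_pos_of_tangent (a := 1 + 2 * y) (b := 2 * x) (d := 1 - 2 * y) hD0
        (by linarith) hq'
      linarith
    · have h1 := quadratic_pos_of_trace_det (a := m * (1 + 2 * y) + V₁ ^ 2)
        (b := m * (2 * x) + V₁ * V₂) (d := m * (1 - 2 * y) + V₂ ^ 2) (by nlinarith)
        (by
          have e1 : (m * (1 + 2 * y) + V₁ ^ 2) * (m * (1 - 2 * y) + V₂ ^ 2) -
              (m * (2 * x) + V₁ * V₂) ^ 2 = m * (m * (1 - 4 * R) +
              ((1 + 2 * y) * V₂ ^ 2 + (1 - 2 * y) * V₁ ^ 2 - 2 * (2 * x) * V₁ * V₂)) := by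
            rw [hRdef]; ring
          rw [e1, hadj]
          refine mul_pos hm' ?_
          linarith) hq'
      have h2 : 0 < m * ((1 + 2 * y) * c ^ 2 + 2 * (2 * x) * c * d + (1 - 2 * y) * d ^ 2 +
          (e ^ 2 + f ^ 2)) := by linarith
      exact pos_of_mul_pos_right h2 hm0

/-- The energy is less than `E` along rays from the origin inside the body. -/
lemma henonHeiles_smul_lt {E : ℝ} (h0 : 0 < E) {p : R4} (hp : p ∈ henonBody E)
    {s : ℝ} (hs0 : 0 ≤ s) (hs : s < 1) : henonHeiles (s • p) < E := by
  obtain ⟨hH, hR⟩ := hp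
  rw [henonHeiles_eq] at hH ⊢
  have hc : henonCubic (s • p) = s ^ 3 * henonCubic p := by
    simp [henonCubic]; ring
  rw [norm_smul, mul_pow, Real.norm_eq_abs, sq_abs, hc]
  -- `3 x₁² x₂ - x₂³` is the imaginary part of `(x₁ + i x₂)³`, so it is at most `|x|³ ≤ |x|²`
  have h3 : -(3 * henonCubic p) ≤ ‖p‖ ^ 2 := by
    have h1 : (3 * henonCubic p) ^ 2 ≤ configSq p ^ 3 := by
      simp only [henonCubic, configSq]
      nlinarith [sq_nonneg (p 0 ^ 3 - 3 * p 0 * p 1 ^ 2)]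
    have h2 : configSq p ≤ ‖p‖ ^ 2 := by
      rw [norm_sq_R4]; simp only [configSq]
      nlinarith [sq_nonneg (p 2), sq_nonneg (p 3)]
    have hR0 : 0 ≤ configSq p := by simp only [configSq]; positivity
    have h4 : configSq p ^ 3 ≤ configSq p ^ 2 := by nlinarith [sq_nonneg (configSq p)]
    have h5 := abs_le_of_sq_le_sq (h1.trans h4) hR0
    linarith [(abs_le.1 (abs_le_of_sq_le_sq' (h1.trans h4) hR0 |> abs_le.2)).1]
  set n := ‖p‖ ^ 2 with hn
  have hn0 : 0 ≤ n := by positivity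
  set c := henonCubic p
  have hs2 : s ^ 2 < 1 := by nlinarith
  have hs3 : s ^ 3 ≤ s ^ 2 := by nlinarith [sq_nonneg s]
  by_cases hc0 : 0 ≤ c
  · nlinarith [mul_nonneg (sq_nonneg s) hc0, mul_nonneg (sub_nonneg.2 hs3) hc0]
  · push Not at hc0
    have hn' : 0 < n := by linarith
    have e : n / 2 + c - (s ^ 2 * n / 2 + s ^ 3 * c) =
        (1 - s) * ((n + 3 * c) * (1 + s + s ^ 2) / 3 + n * (1 - s) * (1 + 2 * s) / 6) := by ring
    have h6 : 0 ≤ (n + 3 * c) * (1 + s + s ^ 2) / 3 := by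
      have : 0 ≤ n + 3 * c := by linarith
      positivity
    have h7 : 0 < n * (1 - s) * (1 + 2 * s) / 6 := by
      have : 0 < 1 - s := by linarith
      positivity
    have h8 : 0 < (1 - s) * ((n + 3 * c) * (1 + s + s ^ 2) / 3 + n * (1 - s) * (1 + 2 * s) / 6) :=
      mul_pos (by linarith) (by linarith)
    linarith

lemma henonHeiles_zero : henonHeiles 0 = 0 := by simp [henonHeiles, henonPotential]

lemma isClosed_henonBody {E : ℝ} : IsClosed (henonBody E) :=
  (isClosed_le continuous_henonHeiles continuous_const).inter
    (isClosed_le continuous_configSq continuous_const)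

lemma isCompact_henonBody {E : ℝ} : IsCompact (henonBody E) := by
  refine Metric.isCompact_of_isClosed_isBounded isClosed_henonBody ?_
  refine (Metric.isBounded_closedBall (x := (0 : R4)) (r := 2 * |E| + 3)).subset fun p hp => ?_
  obtain ⟨hH, hR⟩ := hp
  rw [henonHeiles_eq] at hH
  rw [mem_closedBall_zero_iff]
  have hc : |henonCubic p| ≤ 1 := by
    have h1 : (3 * henonCubic p) ^ 2 ≤ configSq p ^ 3 := by
      simp only [henonCubic, configSq]
      nlinarith [sq_nonneg (p 0 ^ 3 - 3 * p 0 * p 1 ^ 2)]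
    have hR0 : 0 ≤ configSq p := by simp only [configSq]; positivity
    have h2 : configSq p ^ 3 ≤ 1 := pow_le_one₀ hR0 hR
    rw [← sq_le_one_iff_abs_le_one]
    nlinarith
  have h3 := (abs_le.1 hc).1
  have h4 := le_abs_self E
  by_contra! hlt
  nlinarith [norm_nonneg p, abs_nonneg E]

/-- A segment contained in the body, one of whose interior points has energy `E`, would be tangent to
the energy level there with nonpositive second derivative. -/
lemma henonHeiles_lt_of_segment {E : ℝ} (h0 : 0 < E) (hE : E < 1 / 6) {p w : R4} (hw : w ≠ 0) {ε : ℝ}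
    (hε : 0 < ε) (h : ∀ τ : ℝ, |τ| ≤ ε → p + τ • w ∈ henonBody E) : henonHeiles p < E := by
  have hp : p ∈ henonBody E := by simpa using h 0 (by simpa using hε.le)
  refine lt_of_le_of_ne hp.1 fun hpE => ?_
  have hpS : p ∈ henonSphere E := ⟨hpE, henonBody_configSq_lt hE hp⟩
  have hle : ∀ τ : ℝ, |τ| ≤ ε → henonHeiles p + τ * inner ℝ (henonGrad p) w +
      τ ^ 2 / 2 * inner ℝ (henonHess p w) w + τ ^ 3 * henonCubic w ≤ E := fun τ hτ => by
    rw [← henonHeiles_add_smul]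
    exact (h τ hτ).1
  have hmax : IsLocalMax (fun τ : ℝ => henonHeiles p + τ * inner ℝ (henonGrad p) w +
      τ ^ 2 / 2 * inner ℝ (henonHess p w) w + τ ^ 3 * henonCubic w) 0 := by
    filter_upwards [Metric.closedBall_mem_nhds (0 : ℝ) hε] with τ hτ
    simp only [zero_mul, ne_eq, OfNat.ofNat_ne_zero, not_false_eq_true, zero_pow, zero_div,
      add_zero, hpE]
    have := hle τ (by simpa using hτ)
    rwa [hpE] at this
  have hb := hmax.hasDerivAt_eq_zero (hasDerivAt_cubic _ _ _ _)
  have hpos := inner_henonHess_pos h0 hE hpS hb hw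
  have h1 := hle ε (abs_of_pos hε).le
  have h2 := hle (-ε) (by rw [abs_neg, abs_of_pos hε])
  rw [hb, hpE] at h1 h2
  nlinarith [mul_pos (pow_pos hε 2) hpos]

/-- Every segment with end points in the body lies in the body, and its interior points have energy less
than `E`. Scaled towards the origin the segment lies in the body, and by
`henonHeiles_lt_of_segment` it can never reach the boundary while it is scaled back. -/
lemma henonHeiles_segment_lt {E : ℝ} (h0 : 0 < E) (hE : E < 1 / 6) {p q : R4} (hp : p ∈ henonBody E)
    (hq : q ∈ henonBody E) (hpq : p ≠ q) {t : ℝ} (ht : t ∈ Set.Ioo (0 : ℝ) 1) :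
    p + t • (q - p) ∈ henonBody E ∧ henonHeiles (p + t • (q - p)) < E := by
  have hw : q - p ≠ 0 := sub_ne_zero.2 hpq.symm
  let T : Set ℝ := {s | ∀ t ∈ Set.Icc (0 : ℝ) 1, s • (p + t • (q - p)) ∈ henonBody E}
  have hint : ∀ s : ℝ, 0 < s → s ∈ T → ∀ t ∈ Set.Ioo (0 : ℝ) 1,
      henonHeiles (s • (p + t • (q - p))) < E := by
    intro s hs hsT t ht
    refine henonHeiles_lt_of_segment h0 hE (w := s • (q - p)) (ε := min t (1 - t))
      (smul_ne_zero hs.ne' hw) (lt_min ht.1 (by linarith [ht.2])) fun τ hτ => ?_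
    obtain ⟨h1, h2⟩ := abs_le.1 hτ
    have h3 := min_le_left t (1 - t)
    have h4 := min_le_right t (1 - t)
    have := hsT (t + τ) ⟨by linarith, by linarith⟩
    convert this using 1
    module
  have hlt : ∀ s ∈ T, s ∈ Set.Ico (0 : ℝ) 1 → ∀ t ∈ Set.Icc (0 : ℝ) 1,
      henonHeiles (s • (p + t • (q - p))) < E := by
    intro s hsT hs t ht
    rcases hs.1.eq_or_lt with rfl | hs0
    · rw [zero_smul, henonHeiles_zero]; exact h0
    rcases ht.1.eq_or_lt with rfl | ht0
    · rw [zero_smul, add_zero]; exact henonHeiles_smul_lt h0 hp hs.1 hs.2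
    rcases ht.2.eq_or_lt with rfl | ht1
    · rw [one_smul, add_sub_cancel]; exact henonHeiles_smul_lt h0 hq hs.1 hs.2
    exact hint s hs0 hsT t ⟨ht0, ht1⟩
  have hTclosed : IsClosed T := by
    have : T = ⋂ t ∈ Set.Icc (0 : ℝ) 1, (fun s : ℝ => s • (p + t • (q - p))) ⁻¹' henonBody E := by
      ext s
      simp [T]
    rw [this]
    exact isClosed_biInter fun t _ => isClosed_henonBody.preimage (by fun_prop)
  have hT : Set.Icc (0 : ℝ) 1 ⊆ T := by
    refine IsClosed.Icc_subset_of_forall_mem_nhdsWithin (hTclosed.inter isClosed_Icc) ?_ ?_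
    · intro t _
      rw [zero_smul]
      exact ⟨by rw [henonHeiles_zero]; exact h0.le, by simp [configSq]⟩
    · rintro s ⟨hsT, hs⟩
      apply mem_nhdsWithin_of_mem_nhds
      refine isCompact_Icc.eventually_forall_of_forall_eventually fun t ht => ?_
      have hcont : Continuous fun z : ℝ × ℝ => z.1 • (p + z.2 • (q - p)) := by fun_prop
      have ho : IsOpen {p : R4 | henonHeiles p < E ∧ configSq p < 1} :=
        (isOpen_lt continuous_henonHeiles continuous_const).inter
          (isOpen_lt continuous_configSq continuous_const)
      filter_upwards [(ho.preimage hcont).mem_nhds (x := (s, t))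
        ⟨hlt s hsT hs t ht, henonBody_configSq_lt hE (hsT t ht)⟩] with z hz
      exact ⟨hz.1.le, hz.2.le⟩
  have h1 : (1 : ℝ) ∈ T := hT (by simp)
  have h2 := h1 t ⟨ht.1.le, ht.2.le⟩
  have h3 := hint 1 one_pos h1 t ht
  rw [one_smul] at h2 h3
  exact ⟨h2, h3⟩

/-- The body lies strictly on the inner side of the tangent hyperplanes of its boundary. -/
lemma inner_henonGrad_sub_neg {E : ℝ} (h0 : 0 < E) (hE : E < 1 / 6) {x y : R4}
    (hy : y ∈ henonSphere E) (hx : x ∈ henonBody E) (hxy : x ≠ y) :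
    inner ℝ (henonGrad y) (x - y) < 0 := by
  set b := inner ℝ (henonGrad y) (x - y) with hb
  set a := inner ℝ (henonHess y (x - y)) (x - y) with ha
  set c := henonCubic (x - y)
  have h : ∀ᶠ τ in 𝓝[>] (0 : ℝ), b + τ / 2 * a + τ ^ 2 * c < 0 := by
    filter_upwards [Ioo_mem_nhdsGT (zero_lt_one (α := ℝ))] with τ hτ
    have := (henonHeiles_segment_lt h0 hE (henonSphere_subset_henonBody hy) hx hxy.symm hτ).2
    rw [henonHeiles_add_smul, hy.1, ← ha, ← hb] at this
    have h2 : τ * (b + τ / 2 * a + τ ^ 2 * c) < 0 := by linarith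
    exact (pos_iff_neg_of_mul_neg h2).1 hτ.1
  have ht : Filter.Tendsto (fun τ : ℝ => b + τ / 2 * a + τ ^ 2 * c) (𝓝[>] 0) (𝓝 b) := by
    apply tendsto_nhdsWithin_of_tendsto_nhds
    exact (Continuous.tendsto' (by fun_prop) _ _ (by simp))
  have hb0 : b ≤ 0 := le_of_tendsto ht (h.mono fun _ => le_of_lt)
  refine lt_of_le_of_ne hb0 fun hb' => ?_
  have ha0 := inner_henonHess_pos h0 hE hy (hb.symm.trans hb') (sub_ne_zero.2 hxy)
  have ht2 : Filter.Tendsto (fun τ : ℝ => a / 2 + τ * c) (𝓝[>] 0) (𝓝 (a / 2)) := by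
    apply tendsto_nhdsWithin_of_tendsto_nhds
    exact (Continuous.tendsto' (by fun_prop) _ _ (by simp))
  have : a / 2 ≤ 0 := by
    refine le_of_tendsto ht2 ?_
    filter_upwards [h, self_mem_nhdsWithin] with τ hτ hτ0
    have h2 : τ * (a / 2 + τ * c) < 0 := by rw [hb'] at hτ; linarith
    exact ((pos_iff_neg_of_mul_neg h2).1 hτ0).le
  linarith

lemma zero_mem_henonBody {E : ℝ} (h0 : 0 < E) : (0 : R4) ∈ henonBody E :=
  ⟨by rw [henonHeiles_zero]; exact h0.le, by simp [configSq]⟩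

lemma ne_zero_of_mem_henonSphere {E : ℝ} (h0 : 0 < E) {p : R4} (hp : p ∈ henonSphere E) : p ≠ 0 := by
  rintro rfl
  have := hp.1
  rw [henonHeiles_zero] at this
  exact h0.ne this

/-- The bounded component is transverse to the radial vector field. -/
lemma inner_henonGrad_self_pos {E : ℝ} (h0 : 0 < E) (hE : E < 1 / 6) {p : R4}
    (hp : p ∈ henonSphere E) : 0 < inner ℝ (henonGrad p) p := by
  have := inner_henonGrad_sub_neg h0 hE hp (zero_mem_henonBody h0)
    (ne_zero_of_mem_henonSphere h0 hp).symm
  rw [zero_sub, inner_neg_right] at this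
  linarith

/-- Points of the body of energy less than `E` are interior. A point of energy `E` is not: points slightly
further out on its ray are outside the body, by `henonHeiles_smul_lt`. -/
lemma frontier_henonBody {E : ℝ} (h0 : 0 < E) (hE : E < 1 / 6) :
    frontier (henonBody E) = henonSphere E ∧
      {p | henonHeiles p < E ∧ configSq p < 1} ⊆ interior (henonBody E) := by
  have ho : IsOpen {p : R4 | henonHeiles p < E ∧ configSq p < 1} :=
    (isOpen_lt continuous_henonHeiles continuous_const).inter
      (isOpen_lt continuous_configSq continuous_const)
  have hsub : {p | henonHeiles p < E ∧ configSq p < 1} ⊆ interior (henonBody E) :=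
    interior_maximal (fun p hp => ⟨hp.1.le, hp.2.le⟩) ho
  refine ⟨?_, hsub⟩
  rw [isClosed_henonBody.frontier_eq]
  ext p
  constructor
  · rintro ⟨hp, hpi⟩
    have hR := henonBody_configSq_lt hE hp
    exact ⟨le_antisymm hp.1 (not_lt.1 fun hlt => hpi (hsub ⟨hlt, hR⟩)), hR⟩
  · intro hp
    refine ⟨henonSphere_subset_henonBody hp, fun hpi => ?_⟩
    have hc : Filter.Tendsto (fun s : ℝ => s • p) (𝓝[>] 1) (𝓝 p) := by
      apply tendsto_nhdsWithin_of_tendsto_nhds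
      exact Continuous.tendsto' (by fun_prop) _ _ (by simp)
    obtain ⟨s, hs, hs1⟩ := ((hc.eventually (mem_interior_iff_mem_nhds.1 hpi)).and
      self_mem_nhdsWithin).exists
    have hs1' : (1 : ℝ) < s := hs1
    have := henonHeiles_smul_lt h0 hs (s := s⁻¹) (by positivity) (inv_lt_one_of_one_lt₀ hs1')
    rw [smul_smul, inv_mul_cancel₀ (by positivity), one_smul, hp.1] at this
    exact lt_irrefl _ this

theorem isStrictlyConvexHypersurface_henonSphere {E : ℝ} (h0 : 0 < E) (hE : E < 1 / 6) :
    IsStrictlyConvexHypersurface (henonSphere E) := by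
  obtain ⟨hfr, hint⟩ := frontier_henonBody h0 hE
  refine ⟨henonBody E, isCompact_henonBody, ?_, ⟨0, hint ⟨?_, by simp [configSq]⟩⟩, hfr, ?_⟩
  · intro p hp q hq hpq a b ha hb hab
    have hb1 : b < 1 := by linarith
    have := henonHeiles_segment_lt h0 hE hp hq hpq ⟨hb, hb1⟩
    have e : a • p + b • q = p + b • (q - p) := by
      rw [show a = 1 - b by linarith]; module
    rw [e]
    exact hint ⟨this.2, henonBody_configSq_lt hE this.1⟩
  · rw [henonHeiles_zero]; exact h0
  · intro p hp
    have hfd : fderiv ℝ (fun q => henonHeiles q - E) = fderiv ℝ henonHeiles := by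
      funext q
      exact fderiv_sub_const E
    refine ⟨{q | configSq q < 1}, fun q => henonHeiles q - E,
      isOpen_lt continuous_configSq continuous_const, hp.2,
      (contDiff_henonHeiles.sub contDiff_const).contDiffOn, ?_, ?_, ?_⟩
    · intro q hq
      have hq' : configSq q < 1 := hq
      simp [henonBody, henonSphere, hq', hq'.le, sub_eq_zero]
    · rw [hfd]
      intro h
      have := inner_henonGrad_self_pos h0 hE hp
      rw [← fderiv_henonHeiles_apply, h] at this
      simp at this
    · intro v hv hv0
      rw [hfd] at hv0 ⊢
      rw [fderiv_fderiv_henonHeiles]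
      rw [fderiv_henonHeiles_apply] at hv0
      exact inner_henonHess_pos h0 hE hp hv0 hv

/-! ### Components of the energy level -/

/-- The components of the energy level outside the bounded part are not compact: scaling up the
configuration decreases the potential, so that the momenta can be adjusted to keep the energy. -/
lemma not_isCompact_connectedComponentIn {E : ℝ} (hE : E < 1 / 6) {p : R4} (hp : henonHeiles p = E)
    (hR : 1 < configSq p) : ¬ IsCompact (connectedComponentIn (henonHeiles ⁻¹' {E}) p) := by
  intro hcomp
  -- the sign of the momentum `p 3`, which is kept along the path `γ`
  obtain ⟨σ, hσ, hσp⟩ : ∃ σ : ℝ, σ ^ 2 = 1 ∧ σ * |p 3| = p 3 := by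
    rcases le_total 0 (p 3) with h | h
    · exact ⟨1, by norm_num, by rw [abs_of_nonneg h, one_mul]⟩
    · exact ⟨-1, by norm_num, by rw [abs_of_nonpos h]; ring⟩
  let e : ℝ → ℝ := fun s =>
    p 3 ^ 2 + 2 * (henonPotential (p 0) (p 1) - henonPotential (s * p 0) (s * p 1))
  let γ : ℝ → R4 := fun s => !₂[s * p 0, s * p 1, p 2, σ * √(e s)]
  have he : ∀ s, 1 ≤ s → 0 ≤ e s := by
    intro s hs
    have hV : henonPotential (p 0) (p 1) < 1 / 6 := by
      simp only [henonHeiles] at hp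
      nlinarith [sq_nonneg (p 2), sq_nonneg (p 3)]
    have hc : henonCubic p ≤ -(configSq p / 3) := by
      have : henonPotential (p 0) (p 1) = configSq p / 2 + henonCubic p := by
        simp only [henonPotential, configSq, henonCubic]; ring
      linarith
    have key : henonPotential (p 0) (p 1) - henonPotential (s * p 0) (s * p 1) =
        (s - 1) * ((s ^ 2 + s + 1) * (-(configSq p / 3) - henonCubic p) +
          configSq p * ((s - 1) * (1 + 2 * s) / 6)) := by
      simp only [henonPotential, configSq, henonCubic]; ring
    have h1 : 0 ≤ (s - 1) * ((s ^ 2 + s + 1) * (-(configSq p / 3) - henonCubic p) +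
          configSq p * ((s - 1) * (1 + 2 * s) / 6)) := by
      have h2 : 0 ≤ s - 1 := by linarith
      have h3 : 0 ≤ -(configSq p / 3) - henonCubic p := by linarith
      have h4 : 0 ≤ configSq p := by linarith
      positivity
    simp only [e, key]
    positivity
  have hγ1 : γ 1 = p := by
    ext i
    fin_cases i <;> simp [γ, e, Real.sqrt_sq_eq_abs, hσp]
  have hγE : ∀ s, 1 ≤ s → henonHeiles (γ s) = E := by
    intro s hs
    have : henonHeiles (γ s) = (p 2 ^ 2 + σ ^ 2 * √(e s) ^ 2) / 2 +
        henonPotential (s * p 0) (s * p 1) := by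
      simp [γ, henonHeiles]; ring
    rw [this, Real.sq_sqrt (he s hs), hσ, ← hp]
    simp only [e, henonHeiles]; ring
  have hγc : Continuous γ := by
    have hec : Continuous e := by
      simp only [e, henonPotential]; fun_prop
    refine (PiLp.continuous_toLp 2 _).comp (continuous_pi fun i => ?_)
    fin_cases i <;> simp <;> fun_prop
  have hsub : γ '' Set.Ici 1 ⊆ connectedComponentIn (henonHeiles ⁻¹' {E}) p := by
    refine (isPreconnected_Ici.image γ hγc.continuousOn).subset_connectedComponentIn
      ⟨1, by simp, hγ1⟩ ?_
    rintro _ ⟨s, hs, rfl⟩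
    exact hγE s hs
  obtain ⟨C, hC⟩ := (hcomp.image continuous_configSq).bddAbove
  have h1 : ∀ s, 1 ≤ s → s * configSq p ≤ C := fun s hs => by
    have h2 := hC ⟨γ s, hsub ⟨s, hs, rfl⟩, rfl⟩
    have h3 : configSq (γ s) = s ^ 2 * configSq p := by
      simp [γ, configSq]; ring
    rw [h3] at h2
    have h4 : 0 ≤ s * configSq p * (s - 1) :=
      mul_nonneg (mul_nonneg (by linarith) (by linarith)) (by linarith)
    linarith
  have h2 := h1 (max 1 C) (le_max_left _ _)
  have h3 := le_max_left 1 C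
  have h4 := le_max_right 1 C
  nlinarith

lemma mem_henonSphere_of_mem_connectedComponentIn {E : ℝ} (hE : E < 1 / 6) {p q : R4}
    (hp : p ∈ henonSphere E) (hq : q ∈ connectedComponentIn (henonHeiles ⁻¹' {E}) p) :
    q ∈ henonSphere E := by
  have hqE : henonHeiles q = E := connectedComponentIn_subset (henonHeiles ⁻¹' {E}) p hq
  refine ⟨hqE, not_le.1 fun hR => ?_⟩
  obtain ⟨r, hr, hr1⟩ := isPreconnected_connectedComponentIn.intermediate_value
    (mem_connectedComponentIn (show p ∈ henonHeiles ⁻¹' {E} from hp.1)) hq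
    continuous_configSq.continuousOn ⟨hp.2.le, hR⟩
  have hrE : henonHeiles r = E := connectedComponentIn_subset (henonHeiles ⁻¹' {E}) p hr
  exact configSq_ne_one hE hrE.le hr1

lemma connectedComponentIn_eq_henonSphere {E : ℝ} (hE : E < 1 / 6)
    (hS : IsPreconnected (henonSphere E)) {p : R4} (hp : p ∈ henonSphere E) :
    connectedComponentIn (henonHeiles ⁻¹' {E}) p = henonSphere E := by
  refine Set.Subset.antisymm (fun q hq => mem_henonSphere_of_mem_connectedComponentIn hE hp hq) ?_
  exact hS.subset_connectedComponentIn hp fun q hq => hq.1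

lemma IsSphereParametrization.isCompact {f : S3 → R4} {S : Set R4} (hf : IsSphereParametrization f S) :
    IsCompact S := by
  rw [← hf.range_eq]
  exact isCompact_range hf.smooth.continuous

lemma isConnected_univ_S3 : IsConnected (Set.univ : Set S3) := by
  have h : IsConnected (Metric.sphere (0 : R4) 1) :=
    isConnected_sphere (by
      rw [← Module.finrank_eq_rank]
      simp [finrank_euclideanSpace]) 0 zero_le_one
  have := isConnected_iff_connectedSpace.1 h
  exact isConnected_univ

lemma IsSphereParametrization.isConnected {f : S3 → R4} {S : Set R4}
    (hf : IsSphereParametrization f S) : IsConnected S := by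
  rw [← hf.range_eq, ← Set.image_univ]
  exact isConnected_univ_S3.image f hf.smooth.continuous.continuousOn

theorem isSphereLikeComponent_henonSphere {E : ℝ} (hE : E < 1 / 6) {f : S3 → R4}
    (hf : IsSphereParametrization f (henonSphere E)) :
    IsSphereLikeComponent henonHeiles E (henonSphere E) ∧
      ∀ S', IsSphereLikeComponent henonHeiles E S' → S' = henonSphere E := by
  obtain ⟨p, hp⟩ := hf.isConnected.nonempty
  refine ⟨⟨⟨p, hp.1, (connectedComponentIn_eq_henonSphere hE hf.isConnected.isPreconnected hp).symm⟩,
    f, hf⟩, ?_⟩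
  rintro S' ⟨⟨q, hq, rfl⟩, f', hf'⟩
  have hqE : henonHeiles q = E := hq
  apply connectedComponentIn_eq_henonSphere hE hf.isConnected.isPreconnected
  refine ⟨hqE, not_le.1 fun hR => ?_⟩
  exact not_isCompact_connectedComponentIn hE hqE
    (lt_of_le_of_ne hR (configSq_ne_one hE hqE.le).symm) hf'.isCompact

/-! ### The equivariant radial parametrization -/

lemma cos_two_pi_div_three : Real.cos (2 * Real.pi / 3) = -(1 / 2) := by
  rw [show 2 * Real.pi / 3 = Real.pi - Real.pi / 3 by ring, Real.cos_pi_sub, Real.cos_pi_div_three]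

lemma sin_two_pi_div_three : Real.sin (2 * Real.pi / 3) = √3 / 2 := by
  rw [show 2 * Real.pi / 3 = Real.pi - Real.pi / 3 by ring, Real.sin_pi_sub, Real.sin_pi_div_three]

lemma henonRotation_eq (p : R4) : henonRotation p =
    !₂[-(1 / 2) * p 0 - √3 / 2 * p 1, √3 / 2 * p 0 + -(1 / 2) * p 1,
      -(1 / 2) * p 2 - √3 / 2 * p 3, √3 / 2 * p 2 + -(1 / 2) * p 3] := by
  simp only [henonRotation, cos_two_pi_div_three, sin_two_pi_div_three]

lemma henonCubic_henonRotation (p : R4) : henonCubic (henonRotation p) = henonCubic p := by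
  have h3 : √3 ^ 2 = 3 := Real.sq_sqrt (by norm_num)
  simp only [henonCubic, henonRotation_eq]
  simp only [Matrix.cons_val_zero, Matrix.cons_val_one]
  linear_combination
    (-(1/24) * √3 * p 0 ^ 3 + 3/8 * p 0 ^ 2 * p 1 - 1/8 * p 1 ^ 3 + 1/8 * √3 * p 0 * p 1 ^ 2) * h3

lemma henonRotation_smul (c : ℝ) (p : R4) : henonRotation (c • p) = c • henonRotation p := by
  ext i
  fin_cases i <;> simp [henonRotation] <;> ring

/-- The unitary change of coordinates of `ℂ² = ℝ⁴` to eigenvectors of the rotation by `2π/3` of both the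
configuration plane and the momentum plane, whose eigenvalues are `e^{±2πi/3}`. -/
def eigenRotation : R4 ≃ₗᵢ[ℝ] R4 where
  toFun p := (√2)⁻¹ • !₂[p 0 + p 1, p 2 - p 3, p 2 + p 3, -p 0 + p 1]
  invFun q := (√2)⁻¹ • !₂[q 0 - q 3, q 0 + q 3, q 1 + q 2, -q 1 + q 2]
  map_add' p q := by ext i; fin_cases i <;> simp <;> ring
  map_smul' c p := by ext i; fin_cases i <;> simp <;> ring
  left_inv p := by
    have h2 : (√2)⁻¹ * (√2)⁻¹ = 1 / 2 := by
      rw [← mul_inv, Real.mul_self_sqrt (by norm_num)]; norm_num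
    ext i
    fin_cases i <;> simp <;> ring_nf <;> simp <;> linarith
  right_inv p := by
    ext i
    fin_cases i <;> simp <;> ring_nf <;> simp <;> linarith
  norm_map' p := by
    have h : ‖(√2)⁻¹ • (!₂[p 0 + p 1, p 2 - p 3, p 2 + p 3, -p 0 + p 1] : R4)‖ ^ 2 = ‖p‖ ^ 2 := by
      rw [norm_smul, mul_pow, norm_sq_R4, norm_sq_R4, Real.norm_eq_abs, sq_abs, inv_pow,
        Real.sq_sqrt (by norm_num)]
      simp
      ring
    exact (sq_eq_sq₀ (norm_nonneg _) (norm_nonneg _)).1 h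

lemma eigenRotation_apply (p : R4) :
    eigenRotation p = (√2)⁻¹ • !₂[p 0 + p 1, p 2 - p 3, p 2 + p 3, -p 0 + p 1] := rfl

lemma omega_eigenRotation (p q : R4) : omega (eigenRotation p) (eigenRotation q) = omega p q := by
  have h2 : (√2)⁻¹ ^ 2 = 1 / 2 := by
    rw [inv_pow, Real.sq_sqrt (by norm_num)]; norm_num
  simp only [omega, eigenRotation_apply]
  simp
  linear_combination 2 * ((p 2 * q 0 - p 0 * q 2) + (p 3 * q 1 - p 1 * q 3)) * h2

/-- `eigenRotation` intertwines the two actions of `ℤ₃`. -/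
lemma eigenRotation_lensGenerator (p : R4) :
    eigenRotation (lensGenerator 3 2 p) = henonRotation (eigenRotation p) := by
  have hc : Real.cos (2 * Real.pi * 2 / 3) = -(1 / 2) := by
    rw [show 2 * Real.pi * 2 / 3 = Real.pi / 3 + Real.pi by ring, Real.cos_add_pi,
      Real.cos_pi_div_three]
  have hs : Real.sin (2 * Real.pi * 2 / 3) = -(√3 / 2) := by
    rw [show 2 * Real.pi * 2 / 3 = Real.pi / 3 + Real.pi by ring, Real.sin_add_pi,
      Real.sin_pi_div_three]
  rw [henonRotation_eq, eigenRotation_apply, eigenRotation_apply, lensGenerator, rot_apply, rotFun]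
  push_cast
  rw [cos_two_pi_div_three, sin_two_pi_div_three, hc, hs]
  ext i
  fin_cases i <;> simp <;> ring

open Classical in
/-- The inverse, on the range where it is increasing, of the cubic polynomial `E u³ - u / 2`: the point
`u⁻¹ • w` of the ray through a unit vector `w` with cubic part `c` has energy `E`
if `E u³ - u / 2 = c`. -/
def inverseRadius (E c : ℝ) : ℝ :=
  if h : ∃ u : ℝ, 0 < u ∧ 1 < 6 * E * u ^ 2 ∧ E * u ^ 3 - u / 2 = c then h.choose else 0

lemma eq_of_radius_eq {E u v : ℝ} (hu0 : 0 < u) (hu : 1 < 6 * E * u ^ 2) (hv0 : 0 < v)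
    (hv : 1 < 6 * E * v ^ 2) (h : E * u ^ 3 - u / 2 = E * v ^ 3 - v / 2) : u = v := by
  have h0 : (u - v) * (E * (u ^ 2 + u * v + v ^ 2) - 1 / 2) = 0 := by linarith
  rcases mul_eq_zero.1 h0 with h1 | h1
  · linarith
  · exfalso
    have hE : 0 < E := by
      by_contra! hE
      nlinarith [mul_nonneg (neg_nonneg.2 hE) (sq_nonneg u)]
    -- `6 E u v > 1` as well
    have h2 : 1 < (6 * E * u ^ 2) * (6 * E * v ^ 2) := one_lt_mul_of_lt_of_le hu hv.le
    have h3 : 1 < 6 * E * (u * v) := by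
      by_contra! h4
      have h5 : 0 ≤ 6 * E * (u * v) := by positivity
      nlinarith
    nlinarith

lemma inverseRadius_spec {E c : ℝ} (h0 : 0 < E) (hE : E < 1 / 6) (hc : |c| ≤ 1 / 3) :
    0 < inverseRadius E c ∧ 1 < 6 * E * inverseRadius E c ^ 2 ∧
      E * inverseRadius E c ^ 3 - inverseRadius E c / 2 = c := by
  obtain ⟨hc1, hc2⟩ := abs_le.1 hc
  -- the intermediate value theorem between the critical point `u₀ > 1` and the positive zero `u₁`
  have hex : ∃ u : ℝ, 0 < u ∧ 1 < 6 * E * u ^ 2 ∧ E * u ^ 3 - u / 2 = c := by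
    set u₀ := (√(6 * E))⁻¹ with hu₀
    set u₁ := (√E)⁻¹ with hu₁
    have hs0 : 0 < √(6 * E) := Real.sqrt_pos.2 (by linarith)
    have hs1 : 0 < √E := Real.sqrt_pos.2 h0
    have h1 : √(6 * E) < 1 := by rw [Real.sqrt_lt' one_pos]; linarith
    have h2 : √E < √(6 * E) := Real.sqrt_lt_sqrt h0.le (by linarith)
    have h3 : 6 * E * u₀ ^ 2 = 1 := by
      rw [hu₀, inv_pow, Real.sq_sqrt (by linarith)]; field_simp
    have h4 : E * u₁ ^ 2 = 1 := by
      rw [hu₁, inv_pow, Real.sq_sqrt h0.le]; field_simp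
    have h5 : 1 < u₀ := (one_lt_inv₀ hs0).2 h1
    have h6 : u₀ < u₁ := (inv_lt_inv₀ hs0 hs1).2 h2
    have hcont : ContinuousOn (fun u : ℝ => E * u ^ 3 - u / 2) (Set.Icc u₀ u₁) := by fun_prop
    have h7 : E * u₀ ^ 3 - u₀ / 2 = -(u₀ / 3) := by
      linear_combination (u₀ / 6) * h3
    have h8 : E * u₁ ^ 3 - u₁ / 2 = u₁ / 2 := by
      linear_combination u₁ * h4
    obtain ⟨u, hu, huc⟩ := intermediate_value_Icc h6.le hcont
      (show c ∈ Set.Icc _ _ from ⟨by linarith, by linarith⟩)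
    simp only at huc
    have hlt : u₀ < u := by
      refine lt_of_le_of_ne hu.1 fun h => ?_
      rw [← h] at huc
      linarith
    refine ⟨u, by linarith, ?_, huc⟩
    rw [← h3]
    have : u₀ ^ 2 < u ^ 2 := by nlinarith
    nlinarith
  rw [inverseRadius, dif_pos hex]
  exact hex.choose_spec

lemma inverseRadius_eq {E u : ℝ} (hu0 : 0 < u) (hu : 1 < 6 * E * u ^ 2) :
    inverseRadius E (E * u ^ 3 - u / 2) = u := by
  have hex : ∃ v : ℝ, 0 < v ∧ 1 < 6 * E * v ^ 2 ∧ E * v ^ 3 - v / 2 = E * u ^ 3 - u / 2 :=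
    ⟨u, hu0, hu, rfl⟩
  rw [inverseRadius, dif_pos hex]
  have h := hex.choose_spec
  exact eq_of_radius_eq h.1 h.2.1 hu0 hu h.2.2

lemma contDiffAt_inverseRadius {E c : ℝ} (h0 : 0 < E) (hE : E < 1 / 6) (hc : |c| ≤ 1 / 3) :
    ContDiffAt ℝ ∞ (inverseRadius E) c := by
  obtain ⟨hu0, hu1, huc⟩ := inverseRadius_spec h0 hE hc
  set u := inverseRadius E c
  have hf : ContDiffAt ℝ ∞ (fun u : ℝ => E * u ^ 3 - u / 2) u := by fun_prop
  have hne : 3 * E * u ^ 2 - 1 / 2 ≠ 0 := by linarith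
  have hd : HasFDerivAt (fun u : ℝ => E * u ^ 3 - u / 2)
      ((ContinuousLinearEquiv.unitsEquivAut ℝ (Units.mk0 _ hne) : ℝ ≃L[ℝ] ℝ) : ℝ →L[ℝ] ℝ) u := by
    have h1 := (((hasDerivAt_id u).pow 3).const_mul E).sub ((hasDerivAt_id u).div_const 2)
    have h2 : HasDerivAt (fun u : ℝ => E * u ^ 3 - u / 2) (3 * E * u ^ 2 - 1 / 2) u :=
      h1.congr_deriv (by simp; ring)
    refine h2.hasFDerivAt.congr_fderiv ?_
    ext
    simp
  have hg := hf.to_localInverse (n := ∞) hd (by simp)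
  have hn : (∞ : WithTop ℕ∞) ≠ 0 := by simp
  set e := hf.toOpenPartialHomeomorph _ hd hn with he
  have heq : ∀ᶠ c' in 𝓝 c, inverseRadius E c' = e.symm c' := by
    have hcmem : c ∈ e.target := by
      rw [← huc]
      exact e.map_source (hf.mem_toOpenPartialHomeomorph_source hd hn)
    have hsymm : e.symm c = u := by
      rw [← huc]
      exact e.left_inv (hf.mem_toOpenPartialHomeomorph_source hd hn)
    have hcts : ContinuousAt e.symm c := e.continuousAt_symm hcmem
    have ho : IsOpen {v : ℝ | 0 < v ∧ 1 < 6 * E * v ^ 2} :=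
      (isOpen_lt continuous_const continuous_id).inter
        (isOpen_lt continuous_const (by fun_prop : Continuous fun v : ℝ => 6 * E * v ^ 2))
    have h1 := hcts.eventually (ho.mem_nhds (x := e.symm c) (by rw [hsymm]; exact ⟨hu0, hu1⟩))
    filter_upwards [h1, e.open_target.mem_nhds hcmem] with c' hc' hmem
    have h2 : E * e.symm c' ^ 3 - e.symm c' / 2 = c' := e.right_inv hmem
    rw [← inverseRadius_eq hc'.1 hc'.2, h2]
  rw [huc] at hg
  exact hg.congr_of_eventuallyEq heq

lemma abs_henonCubic_le {p : R4} (hp : ‖p‖ = 1) : |henonCubic p| ≤ 1 / 3 := by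
  have h1 : (3 * henonCubic p) ^ 2 ≤ configSq p ^ 3 := by
    simp only [henonCubic, configSq]
    nlinarith [sq_nonneg (p 0 ^ 3 - 3 * p 0 * p 1 ^ 2)]
  have h2 : configSq p ≤ 1 := by
    have := norm_sq_R4 p
    rw [hp] at this
    simp only [configSq]
    nlinarith [sq_nonneg (p 2), sq_nonneg (p 3)]
  have hR0 : 0 ≤ configSq p := by simp only [configSq]; positivity
  have h3 := h1.trans (pow_le_one₀ hR0 h2)
  have h4 := (sq_le_one_iff_abs_le_one _).1 h3
  rw [abs_mul] at h4
  norm_num at h4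
  linarith

/-- The radius, in the direction `eigenRotation x`, of the bounded component of the energy level. -/
def henonRadius (E : ℝ) (x : R4) : ℝ := (inverseRadius E (henonCubic (eigenRotation x)))⁻¹

/-- The extension to `ℝ⁴` of the radial parametrization. -/
def henonRadialExt (E : ℝ) (x : R4) : R4 := henonRadius E x • eigenRotation x

/-- The radial parametrization of the bounded component of the energy level, composed with a unitary
map that makes it equivariant. -/
def henonRadial (E : ℝ) (z : S3) : R4 := henonRadialExt E z

lemma norm_coe_S3 (z : S3) : ‖(z : R4)‖ = 1 := by simp

lemma abs_henonCubic_eigenRotation_le (z : S3) : |henonCubic (eigenRotation (z : R4))| ≤ 1 / 3 :=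
  abs_henonCubic_le (by rw [LinearIsometryEquiv.norm_map, norm_coe_S3])

lemma henonRadius_pos {E : ℝ} (h0 : 0 < E) (hE : E < 1 / 6) (z : S3) : 0 < henonRadius E z :=
  inv_pos.2 (inverseRadius_spec h0 hE (abs_henonCubic_eigenRotation_le z)).1

lemma contDiffAt_henonRadius {E : ℝ} (h0 : 0 < E) (hE : E < 1 / 6) (z : S3) :
    ContDiffAt ℝ ∞ (henonRadius E) (z : R4) := by
  have hc := abs_henonCubic_eigenRotation_le z
  have h1 : ContDiffAt ℝ ∞ (fun x : R4 => henonCubic (eigenRotation x)) (z : R4) := by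
    have := eigenRotation.toContinuousLinearEquiv.contDiff (n := ∞)
    exact (contDiff_henonCubic.comp this).contDiffAt
  have h2 : ContDiffAt ℝ ∞ (fun x : R4 => inverseRadius E (henonCubic (eigenRotation x))) (z : R4) :=
    ContDiffAt.comp (g := inverseRadius E) (z : R4) (contDiffAt_inverseRadius h0 hE hc) h1
  exact h2.inv (inverseRadius_spec h0 hE hc).1.ne'

lemma contDiffAt_henonRadialExt {E : ℝ} (h0 : 0 < E) (hE : E < 1 / 6) (z : S3) :
    ContDiffAt ℝ ∞ (henonRadialExt E) (z : R4) :=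
  (contDiffAt_henonRadius h0 hE z).smul eigenRotation.toContinuousLinearEquiv.contDiff.contDiffAt

lemma fderiv_henonRadialExt {E : ℝ} (h0 : 0 < E) (hE : E < 1 / 6) (z : S3) (v : R4) :
    fderiv ℝ (henonRadialExt E) z v =
      henonRadius E z • eigenRotation v + fderiv ℝ (henonRadius E) z v • eigenRotation z := by
  have h1 := ((contDiffAt_henonRadius h0 hE z).differentiableAt (by simp)).hasFDerivAt
  have h2 := eigenRotation.toContinuousLinearEquiv.hasFDerivAt (x := (z : R4))
  have h3 : fderiv ℝ (henonRadialExt E) z = _ := (h1.smul h2).fderiv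
  rw [h3]
  rfl

section

variable {M : Type} [TopologicalSpace M] [ChartedSpace R3 M]

/-- The derivative of a map from a 3-manifold to `ℝ⁴`, as a linear map between the model spaces. -/
def vecDeriv (f : M → R4) (p : M) : R3 →L[ℝ] R4 := mfderiv (𝓡 3) 𝓘(ℝ, R4) f p

end

lemma vecDeriv_comp_coe_sphere {F : R4 → R4} {z : S3} (hF : DifferentiableAt ℝ F z) :
    vecDeriv (fun z : S3 => F z) z = (fderiv ℝ F z).comp (vecDeriv (fun z : S3 => (z : R4)) z) := by
  have : Fact (Module.finrank ℝ R4 = 3 + 1) := ⟨by simp⟩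
  have h1 : MDifferentiableAt (𝓡 3) 𝓘(ℝ, R4) (fun z : S3 => (z : R4)) z :=
    (contMDiff_coe_sphere (n := 3) (m := 1)).mdifferentiableAt (by simp)
  have h2 : MDifferentiableAt 𝓘(ℝ, R4) 𝓘(ℝ, R4) F z := hF.mdifferentiableAt
  have h3 := mfderiv_comp z h2 h1
  rw [mfderiv_eq_fderiv] at h3
  exact h3

lemma inner_coe_vecDeriv_coe_sphere (z : S3) (v : R3) :
    inner ℝ (z : R4) (vecDeriv (fun z : S3 => (z : R4)) z v) = 0 := by
  have : Fact (Module.finrank ℝ R4 = 3 + 1) := ⟨by simp⟩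
  have h := range_mvfderiv_subtypeVal (n := 3) z
  have h2 : vecDeriv (fun z : S3 => (z : R4)) z v ∈ (ℝ ∙ (z : R4))ᗮ := by
    rw [← h]
    exact ⟨v, rfl⟩
  exact Submodule.mem_orthogonal_singleton_iff_inner_right.1 h2

lemma vecDeriv_coe_sphere_injective (z : S3) :
    Function.Injective (vecDeriv (fun z : S3 => (z : R4)) z) := by
  have : Fact (Module.finrank ℝ R4 = 3 + 1) := ⟨by simp⟩
  exact injective_mvfderiv_subtypeVal_sphere (n := 3) z

lemma vecDeriv_henonRadial {E : ℝ} (h0 : 0 < E) (hE : E < 1 / 6) (z : S3) (v : R3) :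
    vecDeriv (henonRadial E) z v =
      henonRadius E z • eigenRotation (vecDeriv (fun z : S3 => (z : R4)) z v) +
        fderiv ℝ (henonRadius E) z (vecDeriv (fun z : S3 => (z : R4)) z v) • eigenRotation z := by
  rw [← fderiv_henonRadialExt h0 hE]
  exact DFunLike.congr_fun (vecDeriv_comp_coe_sphere
    ((contDiffAt_henonRadialExt h0 hE z).differentiableAt (by simp))) v

theorem isSphereParametrization_henonRadial {E : ℝ} (h0 : 0 < E) (hE : E < 1 / 6) :
    IsSphereParametrization (henonRadial E) (henonSphere E) where
  smooth := by
    intro z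
    have : Fact (Module.finrank ℝ R4 = 3 + 1) := ⟨by simp⟩
    exact (contDiffAt_henonRadialExt h0 hE z).contMDiffAt.comp z
      (contMDiff_coe_sphere (n := 3) (m := ∞)).contMDiffAt
  immersion z := by
    change Function.Injective (vecDeriv (henonRadial E) z)
    rw [injective_iff_map_eq_zero]
    intro v hv
    rw [vecDeriv_henonRadial h0 hE] at hv
    set w := vecDeriv (fun z : S3 => (z : R4)) z v with hw
    have h2 : inner ℝ (z : R4) w = 0 := inner_coe_vecDeriv_coe_sphere z v
    have h3 : fderiv ℝ (henonRadius E) z w = 0 := by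
      have h4 := congrArg (fun x : R4 => inner ℝ (eigenRotation (z : R4)) x) hv
      simp only [inner_add_right, inner_smul_right, LinearIsometryEquiv.inner_map_map, h2,
        real_inner_self_eq_norm_sq, norm_coe_S3, inner_zero_right] at h4
      linarith
    rw [h3, zero_smul, add_zero] at hv
    have h5 : eigenRotation w = 0 :=
      (smul_eq_zero.1 hv).resolve_left (henonRadius_pos h0 hE z).ne'
    have h6 : w = 0 := by simpa using h5
    exact vecDeriv_coe_sphere_injective z (by rw [← hw, h6, map_zero])
  injective := by
    intro z z' h
    have hz := henonRadius_pos h0 hE z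
    have hz' := henonRadius_pos h0 hE z'
    have h1 : henonRadius E z • eigenRotation (z : R4) = henonRadius E z' • eigenRotation (z' : R4) := h
    have h2 := congrArg norm h1
    rw [norm_smul, norm_smul, LinearIsometryEquiv.norm_map, LinearIsometryEquiv.norm_map, norm_coe_S3,
      norm_coe_S3, mul_one, mul_one, Real.norm_of_nonneg hz.le, Real.norm_of_nonneg hz'.le] at h2
    rw [h2] at h1
    exact Subtype.ext (eigenRotation.injective (smul_right_injective _ hz'.ne' h1))
  range_eq := by
    apply Set.Subset.antisymm
    · rintro _ ⟨z, rfl⟩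
      obtain ⟨hu0, hu1, hu2⟩ := inverseRadius_spec h0 hE (abs_henonCubic_eigenRotation_le z)
      have hn : ‖eigenRotation (z : R4)‖ = 1 := by rw [LinearIsometryEquiv.norm_map, norm_coe_S3]
      change (inverseRadius E (henonCubic (eigenRotation (z : R4))))⁻¹ • eigenRotation (z : R4) ∈ _
      set w := eigenRotation (z : R4)
      set u := inverseRadius E (henonCubic w)
      constructor
      · have hc : henonCubic (u⁻¹ • w) = u⁻¹ ^ 3 * henonCubic w := by simp [henonCubic]; ring
        rw [henonHeiles_eq, hc, norm_smul, hn, ← hu2, Real.norm_of_nonneg (by positivity)]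
        field_simp
        ring
      · have h2 : configSq w ≤ 1 := by
          have := norm_sq_R4 w
          rw [hn] at this
          simp only [configSq]
          nlinarith [sq_nonneg (w 2), sq_nonneg (w 3)]
        have h3 : configSq (u⁻¹ • w) = u⁻¹ ^ 2 * configSq w := by simp [configSq]; ring
        have h4 : 1 < u ^ 2 := by nlinarith [sq_nonneg u]
        rw [h3, inv_pow]
        have h5 : (u ^ 2)⁻¹ < 1 := inv_lt_one_of_one_lt₀ h4
        have h6 : 0 < (u ^ 2)⁻¹ := by positivity
        nlinarith
    · intro p hp
      have hp0 : 0 < ‖p‖ := norm_pos_iff.2 (ne_zero_of_mem_henonSphere h0 hp)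
      obtain ⟨hH, hR⟩ := hp
      rw [henonHeiles_eq] at hH
      have hw : ‖‖p‖⁻¹ • p‖ = 1 := by
        rw [norm_smul, norm_inv, norm_norm, inv_mul_cancel₀ hp0.ne']
      refine ⟨⟨eigenRotation.symm (‖p‖⁻¹ • p), by
        rw [mem_sphere_zero_iff_norm, LinearIsometryEquiv.norm_map, hw]⟩, ?_⟩
      change henonRadius E (eigenRotation.symm (‖p‖⁻¹ • p)) •
        eigenRotation (eigenRotation.symm (‖p‖⁻¹ • p)) = p
      rw [henonRadius, LinearIsometryEquiv.apply_symm_apply]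
      have hc : henonCubic (‖p‖⁻¹ • p) = ‖p‖⁻¹ ^ 3 * henonCubic p := by simp [henonCubic]; ring
      -- the root is on the increasing branch of the cubic, because `|x|³ < |x|²` in the unit disc
      have hlt : ‖p‖ ^ 2 < 6 * E := by
        have h1 : (3 * henonCubic p) ^ 2 ≤ configSq p ^ 3 := by
          simp only [henonCubic, configSq]
          nlinarith [sq_nonneg (p 0 ^ 3 - 3 * p 0 * p 1 ^ 2)]
        have h2 : configSq p ≤ ‖p‖ ^ 2 := by
          rw [norm_sq_R4]; simp only [configSq]
          nlinarith [sq_nonneg (p 2), sq_nonneg (p 3)]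
        have hR0 : 0 ≤ configSq p := by simp only [configSq]; positivity
        have hn2 : 0 < ‖p‖ ^ 2 := by positivity
        rcases hR0.eq_or_lt with h | h
        · rw [← h] at h1
          have : 3 * henonCubic p = 0 := by
            refine pow_eq_zero_iff two_ne_zero |>.1 (le_antisymm (by simpa using h1) (sq_nonneg _))
          linarith
        · have h3 : configSq p ^ 3 < configSq p ^ 2 := by nlinarith [sq_pos_of_pos h]
          have h4 := abs_lt_of_sq_lt_sq (h1.trans_lt h3) h.le
          linarith [(abs_lt.1 h4).1]
      have he : henonCubic (‖p‖⁻¹ • p) = E * ‖p‖⁻¹ ^ 3 - ‖p‖⁻¹ / 2 := by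
        rw [hc, ← hH]
        field_simp
        ring
      rw [he, inverseRadius_eq (by positivity), inv_inv, smul_smul, mul_inv_cancel₀ hp0.ne', one_smul]
      rw [inv_pow, ← div_eq_mul_inv, one_lt_div (by positivity)]
      exact hlt

lemma henonRadial_lensGenerator (E : ℝ) (z : S3) :
    henonRadial E (lensGenerator 3 2 • z) = henonRotation (henonRadial E z) := by
  simp only [henonRadial, henonRadialExt, henonRadius, coe_smul_sphere, eigenRotation_lensGenerator,
    henonCubic_henonRotation, henonRotation_smul]

lemma liouville_apply (p v : R4) : liouville p v = omega p v / 2 := by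
  simp [liouville, omega]; ring

/-- The radial parametrization multiplies the Liouville form by the square of the radius. -/
lemma liouvillePullback_henonRadial {E : ℝ} (h0 : 0 < E) (hE : E < 1 / 6) (z : S3) (v : R3) :
    liouvillePullback (henonRadial E) z v =
      henonRadius E z ^ 2 * liouvillePullback (fun z => (z : R4)) z v := by
  change liouville (henonRadial E z) (vecDeriv (henonRadial E) z v) =
    henonRadius E z ^ 2 * liouville z (vecDeriv (fun z : S3 => (z : R4)) z v)
  rw [liouville_apply, liouville_apply, vecDeriv_henonRadial h0 hE]
  change omega (henonRadius E z • eigenRotation (z : R4)) _ / 2 = _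
  rw [omega_add_right, omega_smul_left, omega_smul_left, omega_smul_right, omega_smul_right,
    omega_eigenRotation, omega_eigenRotation, omega_self]
  ring

/-! ### One-forms with a Liouville primitive -/

section Model

variable {M : Type} [TopologicalSpace M] [ChartedSpace R3 M]
variable {N : Type} [TopologicalSpace N] [ChartedSpace R3 N]

/-- The derivative of a map between 3-manifolds, as a linear map between the model spaces. -/
def manDeriv (g : M → N) (p : M) : R3 →L[ℝ] R3 := mfderiv (𝓡 3) (𝓡 3) g p

/-- The derivative at `q` of the preferred chart at `p`. -/
def chartDeriv (p q : M) : R3 →L[ℝ] R3 := mfderiv (𝓡 3) 𝓘(ℝ, R3) (extChartAt (𝓡 3) p) q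

/-- The derivative of the inverse of the preferred chart at `p`. -/
def chartSymmDeriv (p : M) (x : R3) : R3 →L[ℝ] R3 :=
  mfderiv 𝓘(ℝ, R3) (𝓡 3) (extChartAt (𝓡 3) p).symm x

/-- The value of a one-form as a linear form on the model space. -/
def OneForm.at (α : OneForm M) (p : M) : R3 →L[ℝ] ℝ := α p

/-- The value of the exterior derivative on vectors of the model space. -/
def OneForm.dAt (α : OneForm M) (p : M) (v w : R3) : ℝ := α.d p v w

lemma liouville_sub_swap (v w : R4) : liouville v w - liouville w v = omega v w := by
  rw [liouville_apply, liouville_apply, omega_swap w v]; ring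

/-- The Liouville form `p ↦ λ₀(p)`, which depends linearly on the point. -/
def liouvilleL : R4 →L[ℝ] R4 →L[ℝ] ℝ :=
  LinearMap.toContinuousLinearMap
    { toFun := liouville
      map_add' _ _ := by ext v; simp [liouville]; ring
      map_smul' _ _ := by ext v; simp [liouville]; ring }

lemma liouvilleL_apply (p : R4) : liouvilleL p = liouville p := rfl

lemma eventually_mem_extChartAt_symm {p₀ p : M} (hp : p ∈ (extChartAt (𝓡 3) p₀).source)
    {s : M → Prop} (hs : ∀ᶠ q in 𝓝 p, s q) :
    ∀ᶠ x in 𝓝 (extChartAt (𝓡 3) p₀ p), s ((extChartAt (𝓡 3) p₀).symm x) := by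
  have h := continuousAt_extChartAt_symm'' (I := 𝓡 3) ((extChartAt (𝓡 3) p₀).map_source hp)
  rw [ContinuousAt, (extChartAt (𝓡 3) p₀).left_inv hp] at h
  exact h.eventually hs

variable [IsManifold (𝓡 3) ∞ M] [IsManifold (𝓡 3) ∞ N]

lemma contMDiffAt_extChartAt_symm_model {p₀ : M} {x : R3} (hx : x ∈ (extChartAt (𝓡 3) p₀).target) :
    ContMDiffAt 𝓘(ℝ, R3) (𝓡 3) ∞ (extChartAt (𝓡 3) p₀).symm x :=
  (contMDiffOn_extChartAt_symm p₀).contMDiffAt ((isOpen_extChartAt_target p₀).mem_nhds hx)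

lemma contDiffAt_comp_extChartAt_symm {F : M → R4} {p₀ : M} {x : R3}
    (hx : x ∈ (extChartAt (𝓡 3) p₀).target)
    (hF : ContMDiffAt (𝓡 3) 𝓘(ℝ, R4) ∞ F ((extChartAt (𝓡 3) p₀).symm x)) :
    ContDiffAt ℝ ∞ (fun x => F ((extChartAt (𝓡 3) p₀).symm x)) x :=
  (hF.comp x (contMDiffAt_extChartAt_symm_model hx)).contDiffAt

/-- The derivative of a map read in a chart. -/
lemma vecDeriv_eq_comp_chartDeriv {F : M → R4} {p₀ q : M} (hq : q ∈ (extChartAt (𝓡 3) p₀).source)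
    (hF : ContMDiffAt (𝓡 3) 𝓘(ℝ, R4) ∞ F q) :
    vecDeriv F q = (fderiv ℝ (fun x => F ((extChartAt (𝓡 3) p₀).symm x))
      (extChartAt (𝓡 3) p₀ q)).comp (chartDeriv p₀ q) := by
  have hx := (extChartAt (𝓡 3) p₀).map_source hq
  have hG : MDifferentiableAt 𝓘(ℝ, R3) 𝓘(ℝ, R4) (fun x => F ((extChartAt (𝓡 3) p₀).symm x))
      (extChartAt (𝓡 3) p₀ q) :=
    ((contDiffAt_comp_extChartAt_symm hx (by rwa [(extChartAt (𝓡 3) p₀).left_inv hq])).differentiableAt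
      (by simp)).mdifferentiableAt
  have he : MDifferentiableAt (𝓡 3) 𝓘(ℝ, R3) (extChartAt (𝓡 3) p₀) q :=
    mdifferentiableAt_extChartAt (by rwa [extChartAt_source] at hq)
  have h := mfderiv_comp q hG he
  rw [mfderiv_eq_fderiv] at h
  have heq : F =ᶠ[𝓝 q] (fun x => F ((extChartAt (𝓡 3) p₀).symm x)) ∘ extChartAt (𝓡 3) p₀ := by
    filter_upwards [(isOpen_extChartAt_source p₀).mem_nhds hq] with q' hq'
    simp only [Function.comp_apply, (extChartAt (𝓡 3) p₀).left_inv hq']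
  exact heq.mfderiv_eq.trans h

lemma fderiv_comp_extChartAt_symm {F : M → R4} {p₀ : M} {x : R3}
    (hx : x ∈ (extChartAt (𝓡 3) p₀).target)
    (hF : ContMDiffAt (𝓡 3) 𝓘(ℝ, R4) ∞ F ((extChartAt (𝓡 3) p₀).symm x)) :
    fderiv ℝ (fun x => F ((extChartAt (𝓡 3) p₀).symm x)) x =
      (vecDeriv F ((extChartAt (𝓡 3) p₀).symm x)).comp
        (chartSymmDeriv p₀ x) := by
  have h := mfderiv_comp x (hF.mdifferentiableAt (by simp))
    ((contMDiffAt_extChartAt_symm_model hx).mdifferentiableAt (by simp))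
  rw [← mfderiv_eq_fderiv]
  exact h

lemma chartDeriv_surjective {p₀ q : M} (hq : q ∈ (extChartAt (𝓡 3) p₀).source) :
    Function.Surjective (chartDeriv p₀ q) :=
  (isInvertible_mfderiv_extChartAt (I := 𝓡 3) hq).surjective

/-- Near `p` the one-form `α` is the pullback of the Liouville form of `ℝ⁴` by the smooth map `F`. -/
structure IsLiouvilleModel (α : OneForm M) (F : M → R4) (p : M) : Prop where
  smooth : ∀ᶠ q in 𝓝 p, ContMDiffAt (𝓡 3) 𝓘(ℝ, R4) ∞ F q
  eq : ∀ᶠ q in 𝓝 p, α.at q = (liouville (F q)).comp (vecDeriv F q)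

namespace IsLiouvilleModel

variable {α : OneForm M} {F : M → R4} {p₀ p : M}

lemma inChart_eventuallyEq (h : IsLiouvilleModel α F p) (hp : p ∈ (extChartAt (𝓡 3) p₀).source) :
    α.inChart p₀ =ᶠ[𝓝 (extChartAt (𝓡 3) p₀ p)] fun x =>
      (liouvilleL (F ((extChartAt (𝓡 3) p₀).symm x))).comp
        (fderiv ℝ (fun x => F ((extChartAt (𝓡 3) p₀).symm x)) x) := by
  filter_upwards [eventually_mem_extChartAt_symm hp h.smooth, eventually_mem_extChartAt_symm hp h.eq,
    (isOpen_extChartAt_target p₀).mem_nhds ((extChartAt (𝓡 3) p₀).map_source hp)] with x hs he hx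
  rw [fderiv_comp_extChartAt_symm hx hs, liouvilleL_apply, ← ContinuousLinearMap.comp_assoc, ← he]
  rfl

lemma eventually_contDiffAt (h : IsLiouvilleModel α F p) (hp : p ∈ (extChartAt (𝓡 3) p₀).source) :
    ∀ᶠ x in 𝓝 (extChartAt (𝓡 3) p₀ p),
      ContDiffAt ℝ ∞ (fun x => F ((extChartAt (𝓡 3) p₀).symm x)) x := by
  filter_upwards [eventually_mem_extChartAt_symm hp h.smooth,
    (isOpen_extChartAt_target p₀).mem_nhds ((extChartAt (𝓡 3) p₀).map_source hp)] with x hs hx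
  exact contDiffAt_comp_extChartAt_symm hx hs

lemma contDiffAt_inChart (h : IsLiouvilleModel α F p) (hp : p ∈ (extChartAt (𝓡 3) p₀).source) :
    ContDiffAt ℝ ∞ (α.inChart p₀) (extChartAt (𝓡 3) p₀ p) := by
  refine ContDiffAt.congr_of_eventuallyEq ?_ (h.inChart_eventuallyEq hp)
  have h1 := (h.eventually_contDiffAt hp).self_of_nhds
  exact (liouvilleL.contDiff.contDiffAt.comp _ h1).clm_comp (h1.fderiv_right (by simp))

lemma isSmooth (h : ∀ p : M, ∃ F, IsLiouvilleModel α F p) : α.IsSmooth := by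
  intro p₀ x hx
  obtain ⟨F, hF⟩ := h ((extChartAt (𝓡 3) p₀).symm x)
  have := hF.contDiffAt_inChart ((extChartAt (𝓡 3) p₀).map_target hx)
  rw [(extChartAt (𝓡 3) p₀).right_inv hx] at this
  exact this.contDiffWithinAt

/-- The exterior derivative is the pullback of `ω₀`. The second derivatives of the map cancel by
symmetry. -/
lemma dAt_eq (h : IsLiouvilleModel α F p) (v w : R3) :
    α.dAt p v w = omega (vecDeriv F p v) (vecDeriv F p w) := by
  have hp := mem_extChartAt_source (I := 𝓡 3) p
  set G : R3 → R4 := fun x => F ((extChartAt (𝓡 3) p).symm x) with hG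
  set x := extChartAt (𝓡 3) p p with hx
  have h1 : ContDiffAt ℝ ∞ G x := (h.eventually_contDiffAt hp).self_of_nhds
  have h2 : HasFDerivAt (fderiv ℝ G) (fderiv ℝ (fderiv ℝ G) x) x :=
    ((h1.fderiv_right (m := ∞) (by simp)).differentiableAt (by simp)).hasFDerivAt
  have h3 : HasFDerivAt (fun x => liouvilleL (G x)) (liouvilleL.comp (fderiv ℝ G x)) x :=
    liouvilleL.hasFDerivAt.comp x (h1.differentiableAt (by simp)).hasFDerivAt
  have h4 := (h3.clm_comp h2).congr_of_eventuallyEq (h.inChart_eventuallyEq hp)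
  have hsymm : ∀ v w, fderiv ℝ (fderiv ℝ G) x v w = fderiv ℝ (fderiv ℝ G) x w v :=
    h1.isSymmSndFDerivAt (by
      rw [minSmoothness_of_isRCLikeNormedField]; exact WithTop.coe_le_coe.2 le_top)
  have h5 : α.dAt p v w = fderiv ℝ (α.inChart p) x (chartDeriv p p v) (chartDeriv p p w) -
      fderiv ℝ (α.inChart p) x (chartDeriv p p w) (chartDeriv p p v) := rfl
  rw [h5, h4.fderiv, vecDeriv_eq_comp_chartDeriv hp h.smooth.self_of_nhds]
  simp only [add_apply, ContinuousLinearMap.comp_apply,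
    ContinuousLinearMap.compL_apply, ContinuousLinearMap.flip_apply, liouvilleL_apply]
  rw [hsymm (chartDeriv p p w) (chartDeriv p p v)]
  rw [add_sub_add_left_eq_sub]
  exact liouville_sub_swap _ _

end IsLiouvilleModel

/-- Continuity of a family of tangent vectors at a point, read in the chart at the point. -/
lemma continuousAt_tangentBundle_iff {Z : Type*} [TopologicalSpace Z] {u : Z → M}
    {e : ∀ z, TangentSpace (𝓡 3) (u z)} {z₀ : Z} :
    ContinuousAt (fun z => (⟨u z, e z⟩ : TangentBundle (𝓡 3) M)) z₀ ↔
      ContinuousAt u z₀ ∧ ContinuousAt (fun z => chartDeriv (u z₀) (u z) (e z)) z₀ := by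
  rw [FiberBundle.continuousAt_totalSpace]
  refine and_congr_right fun hu => continuousAt_congr ?_
  filter_upwards [hu.eventually ((chartAt R3 (u z₀)).open_source.mem_nhds (mem_chart_source R3 (u z₀)))]
    with z hz
  have h := TangentBundle.continuousLinearMapAt_trivializationAt (I := 𝓡 3) (x₀ := u z₀) hz
  have h2 := DFunLike.congr_fun h (e z)
  rw [Bundle.Trivialization.continuousLinearMapAt_apply, Bundle.Trivialization.linearMapAt_apply,
    if_pos (show u z ∈ (trivializationAt R3 (TangentSpace (𝓡 3)) (u z₀)).baseSet from hz)] at h2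
  exact h2

/-- A smooth map transforms continuous families of tangent vectors to continuous families. -/
lemma continuousAt_vecDeriv {Z : Type*} [TopologicalSpace Z] {u : Z → M}
    {e : ∀ z, TangentSpace (𝓡 3) (u z)} {z₀ : Z}
    (he : ContinuousAt (fun z => (⟨u z, e z⟩ : TangentBundle (𝓡 3) M)) z₀) {F : M → R4}
    (hF : ∀ᶠ q in 𝓝 (u z₀), ContMDiffAt (𝓡 3) 𝓘(ℝ, R4) ∞ F q) :
    ContinuousAt (fun z => vecDeriv F (u z) (e z)) z₀ := by
  obtain ⟨hu, he⟩ := continuousAt_tangentBundle_iff.1 he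
  have hp := mem_extChartAt_source (I := 𝓡 3) (u z₀)
  have hG : ContDiffAt ℝ ∞ (fun x => F ((extChartAt (𝓡 3) (u z₀)).symm x))
      (extChartAt (𝓡 3) (u z₀) (u z₀)) :=
    contDiffAt_comp_extChartAt_symm ((extChartAt (𝓡 3) (u z₀)).map_source hp)
      (by rw [(extChartAt (𝓡 3) (u z₀)).left_inv hp]; exact hF.self_of_nhds)
  have h1 := (hG.fderiv_right (m := ∞) (by simp)).continuousAt
  have h2 : ContinuousAt (fun z => extChartAt (𝓡 3) (u z₀) (u z)) z₀ :=
    ContinuousAt.comp (f := u) (continuousAt_extChartAt (u z₀)) hu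
  have h3 : ContinuousAt (fun z => fderiv ℝ (fun x => F ((extChartAt (𝓡 3) (u z₀)).symm x))
      (extChartAt (𝓡 3) (u z₀) (u z)) (chartDeriv (u z₀) (u z) (e z))) z₀ :=
    (ContinuousAt.comp (f := fun z => extChartAt (𝓡 3) (u z₀) (u z)) h1 h2).clm_apply he
  refine h3.congr ?_
  filter_upwards [hu.eventually hF, hu.eventually ((isOpen_extChartAt_source (u z₀)).mem_nhds hp)]
    with z hz hz'
  rw [vecDeriv_eq_comp_chartDeriv hz' hz]
  rfl

/-- A family of tangent vectors is continuous if its image by a smooth immersion is. -/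
lemma continuousAt_of_vecDeriv {Z : Type*} [TopologicalSpace Z] {u : Z → M}
    {e : ∀ z, TangentSpace (𝓡 3) (u z)} {z₀ : Z} (hu : ContinuousAt u z₀) {F : M → R4}
    (hF : ∀ᶠ q in 𝓝 (u z₀), ContMDiffAt (𝓡 3) 𝓘(ℝ, R4) ∞ F q)
    (hinj : Function.Injective (vecDeriv F (u z₀)))
    (he : ContinuousAt (fun z => vecDeriv F (u z) (e z)) z₀) :
    ContinuousAt (fun z => (⟨u z, e z⟩ : TangentBundle (𝓡 3) M)) z₀ := by
  rw [continuousAt_tangentBundle_iff]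
  refine ⟨hu, ?_⟩
  have hp := mem_extChartAt_source (I := 𝓡 3) (u z₀)
  set G := fun x => F ((extChartAt (𝓡 3) (u z₀)).symm x) with hGdef
  have hG : ContDiffAt ℝ ∞ G (extChartAt (𝓡 3) (u z₀) (u z₀)) :=
    contDiffAt_comp_extChartAt_symm ((extChartAt (𝓡 3) (u z₀)).map_source hp)
      (by rw [(extChartAt (𝓡 3) (u z₀)).left_inv hp]; exact hF.self_of_nhds)
  have h1 := (hG.fderiv_right (m := ∞) (by simp)).continuousAt
  have h2 : ContinuousAt (fun z => extChartAt (𝓡 3) (u z₀) (u z)) z₀ :=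
    ContinuousAt.comp (f := u) (continuousAt_extChartAt (u z₀)) hu
  have h3 : ContinuousAt (fun z => fderiv ℝ G (extChartAt (𝓡 3) (u z₀) (u z))) z₀ :=
    ContinuousAt.comp (f := fun z => extChartAt (𝓡 3) (u z₀) (u z)) h1 h2
  have hG0 : Function.Injective (fderiv ℝ G (extChartAt (𝓡 3) (u z₀) (u z₀))) := by
    rw [vecDeriv_eq_comp_chartDeriv hp hF.self_of_nhds] at hinj
    intro x y hxy
    obtain ⟨x', rfl⟩ := chartDeriv_surjective hp x
    obtain ⟨y', rfl⟩ := chartDeriv_surjective hp y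
    rw [hinj (show _ from hxy)]
  -- a left inverse at the point makes the derivative invertible nearby
  obtain ⟨l, hl⟩ := ((fderiv ℝ G (extChartAt (𝓡 3) (u z₀) (u z₀))) : R3 →ₗ[ℝ] R4).exists_leftInverse_of_injective
    (LinearMap.ker_eq_bot.2 hG0)
  let L : R4 →L[ℝ] R3 := LinearMap.toContinuousLinearMap l
  let B : Z → R3 →L[ℝ] R3 := fun z => L.comp (fderiv ℝ G (extChartAt (𝓡 3) (u z₀) (u z)))
  have hB : ContinuousAt B z₀ := continuousAt_const.clm_comp h3
  have hB0 : B z₀ = 1 := by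
    ext1 v
    exact DFunLike.congr_fun hl v
  have hinv : ContinuousAt (fun z => Ring.inverse (B z)) z₀ := by
    have hc := NormedRing.inverse_continuousAt (1 : (R3 →L[ℝ] R3)ˣ)
    refine ContinuousAt.comp (f := B) (g := Ring.inverse) ?_ hB
    rw [hB0]
    exact hc
  have h4 : ContinuousAt (fun z => Ring.inverse (B z) (L (vecDeriv F (u z) (e z)))) z₀ :=
    hinv.clm_apply (L.continuous.continuousAt.comp he)
  refine h4.congr ?_
  have hunit : ∀ᶠ z in 𝓝 z₀, IsUnit (B z) :=
    hB.eventually ((Units.isOpen).mem_nhds (by rw [Set.mem_ofPred_eq, hB0]; exact isUnit_one))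
  filter_upwards [hu.eventually hF, hu.eventually ((isOpen_extChartAt_source (u z₀)).mem_nhds hp),
    hunit] with z hz hz' hzu
  have h5 : L (vecDeriv F (u z) (e z)) = B z (chartDeriv (u z₀) (u z) (e z)) := by
    rw [vecDeriv_eq_comp_chartDeriv hz' hz]
    rfl
  rw [h5]
  have h6 := DFunLike.congr_fun (Ring.inverse_mul_cancel _ hzu) (chartDeriv (u z₀) (u z) (e z))
  exact h6

end Model

/-! ### Contact geometry of quotients of the energy surface -/

section Cover

variable {M : Type} [TopologicalSpace M] [ChartedSpace R3 M]

/-- A linear symmetry of the energy level and of the complex structures used in the argument. -/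
structure IsHenonSymmetry (ρ : R4 →L[ℝ] R4) : Prop where
  inner : ∀ p q, inner ℝ (ρ p) (ρ q) = inner ℝ p q
  omega : ∀ p q, omega (ρ p) (ρ q) = omega p q
  grad : ∀ p, henonGrad (ρ p) = ρ (henonGrad p)
  mulJ : ∀ p, mulJ (ρ p) = ρ (mulJ p)

/-- The map `π : S³ → M` is a smooth covering with smooth local sections, `f` is an immersion of `S³` in
the bounded component of the energy level `E`, and points with the same image under `π` are related by
symmetries. -/
structure IsHenonCovering (E : ℝ) (π : S3 → M) (f : S3 → R4) : Prop where
  cov : IsCoveringMap π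
  surjective : Function.Surjective π
  smooth_proj : ContMDiff (𝓡 3) (𝓡 3) ∞ π
  exists_section : ∀ z, ∃ σ : M → S3,
    (∀ᶠ q in 𝓝 (π z), ContMDiffAt (𝓡 3) (𝓡 3) ∞ σ q ∧ π (σ q) = q) ∧ ∀ᶠ w in 𝓝 z, σ (π w) = w
  smooth : ContMDiff (𝓡 3) 𝓘(ℝ, R4) ∞ f
  immersion : ∀ z, Function.Injective (vecDeriv f z)
  mem : ∀ z, f z ∈ henonSphere E
  deck : ∀ z z', π z = π z' → ∃ (g : S3 → S3) (ρ : R4 →L[ℝ] R4), ContMDiff (𝓡 3) (𝓡 3) ∞ g ∧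
    (∀ w, π (g w) = π w) ∧ g z = z' ∧ (∀ w, f (g w) = ρ (f w)) ∧ IsHenonSymmetry ρ

/-- The one-form `α` on `M` is covered by the Liouville form: `π^*α = f^*λ₀`. -/
structure IsHenonCover (E : ℝ) (π : S3 → M) (f : S3 → R4) (α : OneForm M) : Prop
    extends IsHenonCovering E π f where
  form_eq : ∀ z, (α.at (π z)).comp (manDeriv π z) = (liouville (f z)).comp (vecDeriv f z)

/-- The derivative at `π z` of the composition of `f` with the local section of `π` through `z`. -/
def liftDeriv (π : S3 → M) (f : S3 → R4) (z : S3) : R3 →L[ℝ] R4 :=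
  (vecDeriv f z).comp (manDeriv π z).inverse

lemma manDeriv_comp {M₁ M₂ M₃ : Type} [TopologicalSpace M₁] [ChartedSpace R3 M₁] [TopologicalSpace M₂]
    [ChartedSpace R3 M₂] [TopologicalSpace M₃] [ChartedSpace R3 M₃] {g : M₂ → M₃} {h : M₁ → M₂} {p : M₁}
    (hg : ContMDiffAt (𝓡 3) (𝓡 3) ∞ g (h p)) (hh : ContMDiffAt (𝓡 3) (𝓡 3) ∞ h p) :
    manDeriv (fun q => g (h q)) p = (manDeriv g (h p)).comp (manDeriv h p) :=
  mfderiv_comp p (hg.mdifferentiableAt (by simp)) (hh.mdifferentiableAt (by simp))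

lemma vecDeriv_comp {M₁ M₂ : Type} [TopologicalSpace M₁] [ChartedSpace R3 M₁] [TopologicalSpace M₂]
    [ChartedSpace R3 M₂] {g : M₂ → R4} {h : M₁ → M₂} {p : M₁}
    (hg : ContMDiffAt (𝓡 3) 𝓘(ℝ, R4) ∞ g (h p)) (hh : ContMDiffAt (𝓡 3) (𝓡 3) ∞ h p) :
    vecDeriv (fun q => g (h q)) p = (vecDeriv g (h p)).comp (manDeriv h p) :=
  mfderiv_comp p (hg.mdifferentiableAt (by simp)) (hh.mdifferentiableAt (by simp))

lemma manDeriv_congr {M₁ M₂ : Type} [TopologicalSpace M₁] [ChartedSpace R3 M₁] [TopologicalSpace M₂]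
    [ChartedSpace R3 M₂] {g h : M₁ → M₂} {p : M₁} (hgh : g =ᶠ[𝓝 p] h) : manDeriv g p = manDeriv h p :=
  hgh.mfderiv_eq

lemma vecDeriv_congr {M₁ : Type} [TopologicalSpace M₁] [ChartedSpace R3 M₁]
    {g h : M₁ → R4} {p : M₁} (hgh : g =ᶠ[𝓝 p] h) : vecDeriv g p = vecDeriv h p :=
  hgh.mfderiv_eq

lemma manDeriv_id (p : M) : manDeriv (fun q : M => q) p = ContinuousLinearMap.id ℝ R3 :=
  mfderiv_id

section Covering

variable {E : ℝ} {π : S3 → M} {f : S3 → R4}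

namespace IsHenonCovering

lemma isInvertible (h : IsHenonCovering E π f) (z : S3) : (manDeriv π z).IsInvertible := by
  obtain ⟨σ, h1, h2⟩ := h.exists_section z
  have h3 := manDeriv_comp (g := σ) h1.self_of_nhds.1 h.smooth_proj.contMDiffAt
  rw [manDeriv_congr (g := fun w => σ (π w)) (h := fun w => w) h2, manDeriv_id] at h3
  have hinj : Function.Injective (manDeriv π z) := by
    intro v w hvw
    have hv := DFunLike.congr_fun h3 v
    have hw := DFunLike.congr_fun h3 w
    simp only [ContinuousLinearMap.comp_apply, ContinuousLinearMap.id_apply] at hv hw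
    rw [hv, hw, hvw]
  exact ⟨(LinearEquiv.ofInjectiveEndo (manDeriv π z : R3 →ₗ[ℝ] R3) hinj).toContinuousLinearEquiv, by
    ext1 v; rfl⟩

lemma liftDeriv_comp (h : IsHenonCovering E π f) (z : S3) :
    (liftDeriv π f z).comp (manDeriv π z) = vecDeriv f z := by
  rw [liftDeriv, ContinuousLinearMap.comp_assoc, (h.isInvertible z).inverse_comp_self,
    ContinuousLinearMap.comp_id]

lemma liftDeriv_unique (h : IsHenonCovering E π f) {z : S3} {L : R3 →L[ℝ] R4}
    (hL : L.comp (manDeriv π z) = vecDeriv f z) : L = liftDeriv π f z := by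
  rw [liftDeriv, ← hL, ContinuousLinearMap.comp_assoc, (h.isInvertible z).self_comp_inverse,
    ContinuousLinearMap.comp_id]

lemma liftDeriv_manDeriv (h : IsHenonCovering E π f) (z : S3) (v : R3) :
    liftDeriv π f z (manDeriv π z v) = vecDeriv f z v :=
  DFunLike.congr_fun (h.liftDeriv_comp z) v

/-- Symmetries relate the lifts of tangent vectors to different points of a fibre. -/
lemma exists_symmetry (h : IsHenonCovering E π f) {z z' : S3} (hz : π z = π z') :
    ∃ ρ : R4 →L[ℝ] R4, IsHenonSymmetry ρ ∧ f z' = ρ (f z) ∧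
      ∀ v, liftDeriv π f z' v = ρ (liftDeriv π f z v) := by
  obtain ⟨g, ρ, hg, hπ, rfl, hf, hρ⟩ := h.deck z z' hz
  refine ⟨ρ, hρ, hf z, fun v => ?_⟩
  obtain ⟨w, rfl⟩ := (h.isInvertible z).surjective v
  have h1 : manDeriv π z = (manDeriv π (g z)).comp (manDeriv g z) := by
    rw [← manDeriv_comp h.smooth_proj.contMDiffAt hg.contMDiffAt]
    simp only [hπ]
  have h2 : (vecDeriv f (g z)).comp (manDeriv g z) = ρ.comp (vecDeriv f z) := by
    rw [← vecDeriv_comp h.smooth.contMDiffAt hg.contMDiffAt]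
    simp only [hf]
    have h3 := mfderiv_comp z (ρ.differentiableAt (x := f z)).mdifferentiableAt
      (h.smooth.contMDiffAt.mdifferentiableAt (x := z) (by simp))
    rw [mfderiv_eq_fderiv, ρ.fderiv] at h3
    exact h3
  rw [h.liftDeriv_manDeriv z, h1, ContinuousLinearMap.comp_apply, h.liftDeriv_manDeriv,
    ← ContinuousLinearMap.comp_apply, h2, ContinuousLinearMap.comp_apply]

end IsHenonCovering

end Covering

namespace IsHenonCover

variable {E : ℝ} {π : S3 → M} {f : S3 → R4} {α : OneForm M}

lemma at_eq (h : IsHenonCover E π f α) (z : S3) :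
    α.at (π z) = (liouville (f z)).comp (liftDeriv π f z) := by
  ext v
  obtain ⟨w, rfl⟩ := (h.isInvertible z).surjective v
  rw [ContinuousLinearMap.comp_apply, h.liftDeriv_manDeriv]
  exact DFunLike.congr_fun (h.form_eq z) w

/-- Near each point, `α` has a model: the composition of `f` with a local section. -/
lemma exists_model (h : IsHenonCover E π f α) (z : S3) : ∃ F : M → R4, IsLiouvilleModel α F (π z) ∧
    (∀ᶠ w in 𝓝 z, F (π w) = f w ∧ vecDeriv F (π w) = liftDeriv π f w) ∧
    ∀ᶠ q in 𝓝 (π z), F q ∈ henonSphere E := by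
  obtain ⟨σ, h1, h2⟩ := h.exists_section z
  have hsm : ∀ᶠ q in 𝓝 (π z), ContMDiffAt (𝓡 3) 𝓘(ℝ, R4) ∞ (fun q => f (σ q)) q := by
    filter_upwards [h1] with q hq
    exact h.smooth.contMDiffAt.comp q hq.1
  have hσz : σ (π z) = z := h2.self_of_nhds
  have hlift : ∀ᶠ w in 𝓝 z, f (σ (π w)) = f w ∧
      vecDeriv (fun q => f (σ q)) (π w) = liftDeriv π f w := by
    filter_upwards [h2.eventually_nhds, h.smooth_proj.continuous.continuousAt.eventually hsm]
      with w hw hw'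
    refine ⟨by rw [hw.self_of_nhds], h.liftDeriv_unique ?_⟩
    rw [← vecDeriv_comp hw' h.smooth_proj.contMDiffAt]
    exact vecDeriv_congr (hw.mono fun q hq => by simp only [hq])
  refine ⟨fun q => f (σ q), ⟨hsm, ?_⟩, hlift, Filter.Eventually.of_forall fun q => h.mem _⟩
  have hσc : Filter.Tendsto σ (𝓝 (π z)) (𝓝 z) := by
    have := h1.self_of_nhds.1.continuousAt
    rwa [ContinuousAt, hσz] at this
  filter_upwards [h1, hσc.eventually hlift] with q hq hq'
  rw [hq.2] at hq'
  rw [hq'.2]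
  conv_lhs => rw [← hq.2]
  rw [h.at_eq]

lemma inner_vecDeriv (h : IsHenonCover E π f α) (z : S3) (v : R3) :
    inner ℝ (henonGrad (f z)) (vecDeriv f z v) = 0 := by
  have h1 : MDifferentiableAt 𝓘(ℝ, R4) 𝓘(ℝ, ℝ) henonHeiles (f z) :=
    ((contDiff_henonHeiles (n := 1)).differentiable (by simp) _).mdifferentiableAt
  have h2 := mfderiv_comp z h1 (h.smooth.contMDiffAt.mdifferentiableAt (by simp))
  have h3 : (henonHeiles ∘ f) = fun _ => E := funext fun w => (h.mem w).1
  rw [h3, mfderiv_const, mfderiv_eq_fderiv] at h2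
  rw [← fderiv_henonHeiles_apply]
  exact (DFunLike.congr_fun h2 v).symm

lemma inner_liftDeriv (h : IsHenonCover E π f α) (z : S3) (v : R3) :
    inner ℝ (henonGrad (f z)) (liftDeriv π f z v) = 0 := by
  obtain ⟨w, rfl⟩ := (h.isInvertible z).surjective v
  rw [h.liftDeriv_manDeriv]
  exact h.inner_vecDeriv z w

lemma liftDeriv_injective (h : IsHenonCover E π f α) (z : S3) :
    Function.Injective (liftDeriv π f z) := by
  intro v w hvw
  obtain ⟨v, rfl⟩ := (h.isInvertible z).surjective v
  obtain ⟨w, rfl⟩ := (h.isInvertible z).surjective w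
  rw [h.liftDeriv_manDeriv, h.liftDeriv_manDeriv] at hvw
  rw [h.immersion z hvw]

/-- The image of the derivative is the tangent space of the energy level, for reasons of dimension. -/
lemma exists_liftDeriv_eq (h : IsHenonCover E π f α) (h0 : 0 < E) (hE : E < 1 / 6) (z : S3) {y : R4}
    (hy : inner ℝ (henonGrad (f z)) y = 0) : ∃ v, liftDeriv π f z v = y := by
  have hN : henonGrad (f z) ≠ 0 := fun hN => by
    have := inner_henonGrad_self_pos h0 hE (h.mem z)
    rw [hN, inner_zero_left] at this
    exact lt_irrefl _ this
  have : Fact (Module.finrank ℝ R4 = 3 + 1) := ⟨by simp⟩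
  have hle : LinearMap.range (liftDeriv π f z : R3 →ₗ[ℝ] R4) ≤ (ℝ ∙ henonGrad (f z))ᗮ := by
    rintro _ ⟨v, rfl⟩
    exact Submodule.mem_orthogonal_singleton_iff_inner_right.2 (h.inner_liftDeriv z v)
  have heq := Submodule.eq_of_le_of_finrank_eq hle (by
    rw [Submodule.finrank_orthogonal_span_singleton (n := 3) hN,
      LinearMap.finrank_range_of_inj (h.liftDeriv_injective z)]
    simp)
  have : y ∈ LinearMap.range (liftDeriv π f z : R3 →ₗ[ℝ] R4) := by
    rw [heq]
    exact Submodule.mem_orthogonal_singleton_iff_inner_right.2 hy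
  exact this

variable [IsManifold (𝓡 3) ∞ M]

lemma dAt_eq (h : IsHenonCover E π f α) (z : S3) (v w : R3) :
    α.dAt (π z) v w = omega (liftDeriv π f z v) (liftDeriv π f z w) := by
  obtain ⟨F, hF, hF2, -⟩ := h.exists_model z
  rw [hF.dAt_eq, hF2.self_of_nhds.2]

theorem isContactForm (h : IsHenonCover E π f α) (h0 : 0 < E) (hE : E < 1 / 6) : IsContactForm α where
  smooth := IsLiouvilleModel.isSmooth fun p => by
    obtain ⟨z, rfl⟩ := h.surjective p
    obtain ⟨F, hF, -⟩ := h.exists_model z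
    exact ⟨F, hF⟩
  wedge_ne_zero p := by
    obtain ⟨z, rfl⟩ := h.surjective p
    set N := henonGrad (f z) with hN
    have hNf := inner_henonGrad_self_pos h0 hE (h.mem z)
    -- evaluation on `mulI N, mulJ N, mulK N`: only the term `λ₀(iN) ω₀(jN, kN)` survives
    obtain ⟨u, hu⟩ := h.exists_liftDeriv_eq h0 hE z (y := mulI N) (by simp [inner_R4, mulI]; ring)
    obtain ⟨v, hv⟩ := h.exists_liftDeriv_eq h0 hE z (y := mulJ N) (by simp [inner_R4, mulJ]; ring)
    obtain ⟨w, hw⟩ := h.exists_liftDeriv_eq h0 hE z (y := mulK N)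
      (by simp [inner_R4, mulK, mulI, mulJ]; ring)
    refine ⟨u, v, w, ?_⟩
    have e1 : α.at (π z) u = inner ℝ N (f z) / 2 := by
      rw [h.at_eq, ContinuousLinearMap.comp_apply, hu, liouville_apply]
      simp [omega, mulI, inner_R4]; ring
    have e2 : α.dAt (π z) v w = ‖N‖ ^ 2 := by
      rw [h.dAt_eq, hv, hw, norm_sq_R4]
      simp [omega, mulI, mulJ, mulK]; ring
    have e3 : α.dAt (π z) w u = 0 := by
      rw [h.dAt_eq, hu, hw]
      simp [omega, mulI, mulJ, mulK]; ring
    have e4 : α.dAt (π z) u v = 0 := by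
      rw [h.dAt_eq, hu, hv]
      simp [omega, mulI, mulJ]; ring
    change α.at (π z) u * α.dAt (π z) v w + α.at (π z) v * α.dAt (π z) w u +
      α.at (π z) w * α.dAt (π z) u v ≠ 0
    rw [e1, e2, e3, e4]
    have hN0 : N ≠ 0 := fun h => by rw [← hN, h, inner_zero_left] at hNf; exact lt_irrefl _ hNf
    have : 0 < ‖N‖ := norm_pos_iff.2 hN0
    have h2 : 0 < inner ℝ N (f z) / 2 * ‖N‖ ^ 2 := mul_pos (half_pos hNf) (by positivity)
    simpa using h2.ne'

/-- The Reeb vector field is, up to a positive factor, the Hamiltonian vector field. -/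
lemma liftDeriv_reeb (h : IsHenonCover E π f α) (h0 : 0 < E) (hE : E < 1 / 6)
    {R : ∀ p : M, TangentSpace (𝓡 3) p} (hR : IsReebField α R) (z : S3) :
    liftDeriv π f z (R (π z)) = (2 / inner ℝ (henonGrad (f z)) (f z)) • mulI (henonGrad (f z)) := by
  have hNf := inner_henonGrad_self_pos h0 hE (h.mem z)
  set N := henonGrad (f z) with hN
  have hN0 : N ≠ 0 := fun h => by rw [h, inner_zero_left] at hNf; exact lt_irrefl _ hNf
  have hn : (0 : ℝ) < ‖N‖ ^ 2 := by
    have : 0 < ‖N‖ := norm_pos_iff.2 hN0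
    positivity
  set y := liftDeriv π f z (R (π z)) with hy
  have h1 : liouville (f z) y = 1 := by
    exact (DFunLike.congr_fun (h.at_eq z) (R (π z))).symm.trans (hR (π z)).1
  -- the component of `mulI y` tangent to the energy level vanishes
  set c := inner ℝ N (mulI y) / ‖N‖ ^ 2 with hc
  have h2 : inner ℝ N (mulI y - c • N) = 0 := by
    rw [inner_sub_right, inner_smul_right, real_inner_self_eq_norm_sq, hc]
    field_simp
    ring
  obtain ⟨w, hw⟩ := h.exists_liftDeriv_eq h0 hE z h2
  have h3 : omega y (mulI y - c • N) = 0 := by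
    rw [← hw]
    exact (h.dAt_eq z (R (π z)) w).symm.trans ((hR (π z)).2 w)
  have h4 : mulI y - c • N = 0 := by
    rw [← inner_self_eq_zero (𝕜 := ℝ)]
    have h5 : omega y (mulI y - c • N) = inner ℝ (mulI y) (mulI y - c • N) := by
      simp [omega, mulI, inner_R4]; ring
    rw [inner_sub_left, inner_smul_left, h2, ← h5, h3]
    simp
  have h6 : y = (-c) • mulI N := by
    have := congrArg mulI (sub_eq_zero.1 h4)
    rw [mulI_mulI, map_smul] at this
    rw [neg_smul, ← this, neg_neg]
  have h7 : -c * (inner ℝ N (f z) / 2) = 1 := by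
    rw [← h1, h6, map_smul, smul_eq_mul, liouville_apply]
    congr 1
    simp [omega, mulI, inner_R4]; ring
  rw [h6]
  congr 1
  field_simp
  linarith

lemma exists_isReebField (h : IsHenonCover E π f α) (h0 : 0 < E) (hE : E < 1 / 6) :
    ∃ R : ∀ p : M, TangentSpace (𝓡 3) p, IsReebField α R := by
  have : ∀ p : M, ∃ v : R3, α.at p v = 1 ∧ ∀ w, α.dAt p v w = 0 := by
    intro p
    obtain ⟨z, rfl⟩ := h.surjective p
    have hNf := inner_henonGrad_self_pos h0 hE (h.mem z)
    obtain ⟨v, hv⟩ := h.exists_liftDeriv_eq h0 hE z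
      (y := (2 / inner ℝ (henonGrad (f z)) (f z)) • mulI (henonGrad (f z)))
      (by rw [inner_smul_right, inner_mulI_self, mul_zero])
    refine ⟨v, ?_, fun w => ?_⟩
    · rw [h.at_eq, ContinuousLinearMap.comp_apply, hv, map_smul, liouville_apply, smul_eq_mul]
      have : omega (f z) (mulI (henonGrad (f z))) = inner ℝ (henonGrad (f z)) (f z) := by
        simp [omega, mulI, inner_R4]; ring
      rw [this]
      field_simp
    · rw [h.dAt_eq, hv, omega_smul_left]
      have h1 := h.inner_liftDeriv z w
      have : omega (mulI (henonGrad (f z))) (liftDeriv π f z w) = 0 := by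
        rw [omega_mulI_left, h1, neg_zero]
      rw [this, mul_zero]
  choose R hR using this
  exact ⟨R, fun p => ⟨(hR p).1, (hR p).2⟩⟩

end IsHenonCover

end Cover

/-! ### A global section of the contact structure -/

section Chern

/-- A nowhere vanishing section of the contact structure of a hypersurface transverse to the radial
vector field: the projection of `mulJ p` to the tangent space along the radial direction. -/
def contactSection (p : R4) : R4 :=
  mulJ p - (inner ℝ (henonGrad p) (mulJ p) / inner ℝ (henonGrad p) p) • p

lemma inner_henonGrad_contactSection {p : R4} (hp : inner ℝ (henonGrad p) p ≠ 0) :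
    inner ℝ (henonGrad p) (contactSection p) = 0 := by
  rw [contactSection, inner_sub_right, inner_smul_right]
  field_simp
  ring

lemma liouville_contactSection (p : R4) : liouville p (contactSection p) = 0 := by
  have h : omega p (mulJ p) = 0 := by simp [omega, mulJ]; ring
  rw [contactSection, liouville_apply, omega_sub_right, omega_smul_right, omega_self, h]
  simp

lemma contactSection_ne_zero {p : R4} (hp : p ≠ 0) : contactSection p ≠ 0 := by
  intro h
  have h1 := congrArg (fun q => inner ℝ (mulJ p) q) h
  have h2 : inner ℝ (mulJ p) p = 0 := by simp [inner_R4, mulJ]; ring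
  have h3 : inner ℝ (mulJ p) (mulJ p) = ‖p‖ ^ 2 := by rw [norm_sq_R4]; simp only [inner_R4]; simp [mulJ]; ring
  simp only [contactSection, inner_sub_right, inner_smul_right, h2, h3, inner_zero_right] at h1
  have : 0 < ‖p‖ := norm_pos_iff.2 hp
  have : 0 < ‖p‖ ^ 2 := by positivity
  linarith

lemma continuousAt_contactSection {p : R4} (hp : inner ℝ (henonGrad p) p ≠ 0) :
    ContinuousAt contactSection p := by
  have hg : Continuous henonGrad := contDiff_henonGrad (n := 0).continuous
  have h1 : ContinuousAt (fun p => inner ℝ (henonGrad p) (mulJ p)) p :=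
    (hg.inner mulJ.continuous).continuousAt
  have h2 : ContinuousAt (fun p => inner ℝ (henonGrad p) p) p :=
    (hg.inner continuous_id).continuousAt
  exact mulJ.continuous.continuousAt.sub ((h1.div h2 hp).smul continuousAt_id)

lemma IsHenonSymmetry.contactSection {ρ : R4 →L[ℝ] R4} (hρ : IsHenonSymmetry ρ) (p : R4) :
    contactSection (ρ p) = ρ (contactSection p) := by
  simp only [_root_.contactSection, hρ.grad, hρ.mulJ, hρ.inner, map_sub, map_smul]

namespace IsHenonCover

variable {M : Type} [TopologicalSpace M] [ChartedSpace R3 M]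
variable {E : ℝ} {π : S3 → M} {f : S3 → R4} {α : OneForm M}

lemma liftDeriv_contactSection (h : IsHenonCover E π f α) {z z' : S3} (hz : π z = π z') {v : R3}
    (hv : liftDeriv π f z v = contactSection (f z)) :
    liftDeriv π f z' v = contactSection (f z') := by
  obtain ⟨ρ, hρ, hf, hlift⟩ := h.exists_symmetry hz
  rw [hlift, hv, hf, hρ.contactSection]

lemma eventually_of_comp (h : IsHenonCover E π f α) {z : S3} {P : M → Prop}
    (hP : ∀ᶠ w in 𝓝 z, P (π w)) : ∀ᶠ q in 𝓝 (π z), P q :=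
  h.cov.isLocalHomeomorph.isOpenMap.nhds_le z hP

variable [IsManifold (𝓡 3) ∞ M]

/-- The contact structure has a global nowhere vanishing section. -/
theorem chernClassVanishesOnSpheres (h : IsHenonCover E π f α) (h0 : 0 < E) (hE : E < 1 / 6) :
    ChernClassVanishesOnSpheres α := by
  have hNf : ∀ z, inner ℝ (henonGrad (f z)) (f z) ≠ 0 := fun z =>
    (inner_henonGrad_self_pos h0 hE (h.mem z)).ne'
  have hex : ∀ p : M, ∃ v : R3, ∀ z, π z = p → liftDeriv π f z v = contactSection (f z) := by
    intro p
    obtain ⟨z, rfl⟩ := h.surjective p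
    obtain ⟨v, hv⟩ := h.exists_liftDeriv_eq h0 hE z (inner_henonGrad_contactSection (hNf z))
    exact ⟨v, fun z' hz' => h.liftDeriv_contactSection hz'.symm hv⟩
  choose s hs using hex
  intro u hu
  refine ⟨fun z => s (u z), ?_, fun z => ?_⟩
  · rw [continuous_iff_continuousAt]
    intro z₀
    obtain ⟨ζ, hζ⟩ := h.surjective (u z₀)
    obtain ⟨F, hF, hF2, -⟩ := h.exists_model ζ
    have hFζ := hF2.self_of_nhds
    have hev : ∀ᶠ q in 𝓝 (π ζ), vecDeriv F q (s q) = contactSection (F q) := by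
      apply h.eventually_of_comp
      filter_upwards [hF2] with w hw
      rw [hw.1, hw.2]
      exact hs _ w rfl
    have hsm := hF.smooth
    rw [hζ] at hev hsm hFζ
    apply continuousAt_of_vecDeriv hu.continuousAt hsm
    · rw [hFζ.2]
      exact h.liftDeriv_injective ζ
    · have h1 : ContinuousAt (fun z => contactSection (F (u z))) z₀ := by
        refine ContinuousAt.comp (f := fun z => F (u z)) (g := contactSection) ?_
          (ContinuousAt.comp (f := u) hsm.self_of_nhds.continuousAt hu.continuousAt)
        simp only [hFζ.1]
        exact continuousAt_contactSection (hNf ζ)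
      refine h1.congr ?_
      filter_upwards [hu.continuousAt.eventually hev] with z hz
      exact hz.symm
  · obtain ⟨ζ, hζ⟩ := h.surjective (u z)
    have h1 := hs (u z) ζ hζ
    constructor
    · have h2 : α.at (u z) (s (u z)) = 0 := by
        rw [← hζ, h.at_eq, ContinuousLinearMap.comp_apply, hζ, h1, liouville_contactSection]
      exact h2
    · intro h3
      have h4 : s (u z) = 0 := h3
      rw [h4, map_zero] at h1
      exact contactSection_ne_zero (ne_zero_of_mem_henonSphere h0 (h.mem ζ)) h1.symm

end IsHenonCover
end Chern

/-! ### The linearized Reeb flow -/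

/-- The factor between the Hamiltonian vector field and the Reeb vector field. -/
def reebFactor (p : R4) : ℝ := 2 / inner ℝ (henonGrad p) p

/-- The Reeb vector field of the energy level, extended to a neighbourhood. -/
def reebVector (p : R4) : R4 := reebFactor p • mulI (henonGrad p)

lemma contDiffAt_reebFactor {p : R4} (hp : inner ℝ (henonGrad p) p ≠ 0) {n : WithTop ℕ∞} :
    ContDiffAt ℝ n reebFactor p := by
  have h : ContDiff ℝ n fun p : R4 => inner ℝ (henonGrad p) p := contDiff_henonGrad.inner ℝ contDiff_id
  exact contDiffAt_const.div h.contDiffAt hp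

lemma differentiableAt_reebVector {p : R4} (hp : inner ℝ (henonGrad p) p ≠ 0) :
    DifferentiableAt ℝ reebVector p ∧ ∀ v, fderiv ℝ reebVector p v =
      reebFactor p • mulI (henonHess p v) + fderiv ℝ reebFactor p v • mulI (henonGrad p) := by
  have h1 := ((contDiffAt_reebFactor hp (n := 1)).differentiableAt (by simp)).hasFDerivAt
  have h2 := mulI.hasFDerivAt.comp p
    ((contDiff_henonGrad (n := 1)).differentiable (by simp) p).hasFDerivAt
  have h3 : HasFDerivAt reebVector _ p := h1.smul h2
  refine ⟨h3.differentiableAt, fun v => ?_⟩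
  rw [h3.fderiv, ← fderiv_henonGrad_apply]
  rfl

/-- The variational equation: along a solution, the derivative of a smooth family of solutions with
respect to the parameter solves the linearized equation. -/
lemma hasDerivAt_variation {X Y : Type*} [NormedAddCommGroup X] [NormedSpace ℝ X] [NormedAddCommGroup Y]
    [NormedSpace ℝ Y] {Ψ : ℝ × X → Y} {t₀ : ℝ} {ξ₀ : X} (η : X) {W : Y → Y}
    (hΨ : ContDiffAt ℝ ∞ Ψ (t₀, ξ₀)) (hW : DifferentiableAt ℝ W (Ψ (t₀, ξ₀)))
    (hode : ∀ᶠ q in 𝓝 (t₀, ξ₀), fderiv ℝ Ψ q (1, 0) = W (Ψ q)) :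
    HasDerivAt (fun t => fderiv ℝ Ψ (t, ξ₀) (0, η))
      (fderiv ℝ W (Ψ (t₀, ξ₀)) (fderiv ℝ Ψ (t₀, ξ₀) (0, η))) t₀ := by
  set D := fderiv ℝ (fderiv ℝ Ψ) (t₀, ξ₀) with hD
  have h1 : HasFDerivAt (fderiv ℝ Ψ) D (t₀, ξ₀) :=
    ((hΨ.fderiv_right (m := ∞) (by simp)).differentiableAt (by simp)).hasFDerivAt
  have happ : ∀ w : ℝ × X, HasFDerivAt (fun q => fderiv ℝ Ψ q w) (D.flip w) (t₀, ξ₀) := fun w =>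
    (ContinuousLinearMap.apply ℝ Y w).hasFDerivAt.comp (t₀, ξ₀) h1
  have h2 : HasDerivAt (fun t : ℝ => ((t, ξ₀) : ℝ × X)) (1, 0) t₀ :=
    (hasDerivAt_id t₀).prodMk (hasDerivAt_const t₀ ξ₀)
  have h3 : HasDerivAt (fun t => fderiv ℝ Ψ (t, ξ₀) (0, η)) (D.flip (0, η) (1, 0)) t₀ :=
    HasFDerivAt.comp_hasDerivAt (l := fun q => fderiv ℝ Ψ q (0, η)) t₀ (happ (0, η)) h2
  refine h3.congr_deriv ?_
  have hsymm : D (1, 0) (0, η) = D (0, η) (1, 0) :=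
    (hΨ.isSymmSndFDerivAt (by
      rw [minSmoothness_of_isRCLikeNormedField]; exact WithTop.coe_le_coe.2 le_top)).eq _ _
  have h5 : HasFDerivAt (fun q => W (Ψ q))
      ((fderiv ℝ W (Ψ (t₀, ξ₀))).comp (fderiv ℝ Ψ (t₀, ξ₀))) (t₀, ξ₀) :=
    hW.hasFDerivAt.comp _ (hΨ.differentiableAt (by simp)).hasFDerivAt
  have h6 := ((happ (1, 0)).congr_of_eventuallyEq (hode.mono fun q hq => hq.symm)).unique h5
  have h7 := DFunLike.congr_fun h6 (0, η)
  rw [ContinuousLinearMap.flip_apply, ContinuousLinearMap.comp_apply] at h7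
  rw [ContinuousLinearMap.flip_apply, hsymm, h7]

section Flow

variable {M : Type} [TopologicalSpace M] [ChartedSpace R3 M]

lemma hasDerivAt_comp_integralCurve {γ : ℝ → M} {R : ∀ p : M, TangentSpace (𝓡 3) p}
    (hγ : IsMIntegralCurve (I := 𝓡 3) γ R) {F : M → R4} {s : ℝ}
    (hF : ContMDiffAt (𝓡 3) 𝓘(ℝ, R4) ∞ F (γ s)) :
    HasDerivAt (fun t => F (γ t)) (vecDeriv F (γ s) (R (γ s))) s := by
  have h1 := (hF.mdifferentiableAt (by simp)).hasMFDerivAt.comp s (hγ s)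
  have h2 : HasFDerivAt (fun t => F (γ t)) ((vecDeriv F (γ s)).comp
      ((1 : ℝ →L[ℝ] ℝ).smulRight (R (γ s) : R3))) s := hasMFDerivAt_iff_hasFDerivAt.1 h1
  refine h2.hasDerivAt.congr_deriv ?_
  change vecDeriv F (γ s) ((1 : ℝ) • (R (γ s) : R3)) = _
  rw [one_smul]

variable [IsManifold (𝓡 3) ∞ M]

/-- The orbits of the flow and their variations in a smooth map `F` that transforms the generating vector
field to `W`. -/
lemma hasDerivAt_flow {φ : ℝ → M → M}
    (hφ : ContMDiff (𝓘(ℝ, ℝ).prod (𝓡 3)) (𝓡 3) ∞ (fun q : ℝ × M => φ q.1 q.2))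
    {R : ∀ p : M, TangentSpace (𝓡 3) p}
    (hR : ∀ p : M, IsMIntegralCurve (I := 𝓡 3) (fun t => φ t p) R) {F : M → R4} {W : R4 → R4}
    {x : M} {T t₀ : ℝ} (hF : ∀ᶠ q in 𝓝 (φ (T * t₀) x), ContMDiffAt (𝓡 3) 𝓘(ℝ, R4) ∞ F q)
    (hFR : ∀ᶠ q in 𝓝 (φ (T * t₀) x), vecDeriv F q (R q) = W (F q))
    (hW : DifferentiableAt ℝ W (F (φ (T * t₀) x))) (w₀ : R3) :
    HasDerivAt (fun t => F (φ (T * t) x)) (T • W (F (φ (T * t₀) x))) t₀ ∧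
      HasDerivAt (fun t => vecDeriv F (φ (T * t) x) (manDeriv (φ (T * t)) x w₀))
        (T • fderiv ℝ W (F (φ (T * t₀) x)) (vecDeriv F (φ (T * t₀) x) (manDeriv (φ (T * t₀)) x w₀))) t₀ := by
  have hlin : ∀ t : ℝ, HasDerivAt (fun t : ℝ => T * t) T t := fun t => by
    simpa using (hasDerivAt_id t).const_mul T
  -- the time derivative at all nearby points
  have htime : ∀ t q, ContMDiffAt (𝓡 3) 𝓘(ℝ, R4) ∞ F (φ (T * t) q) →
      HasDerivAt (fun t => F (φ (T * t) q)) (T • vecDeriv F (φ (T * t) q) (R (φ (T * t) q))) t :=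
    fun t q h => (hasDerivAt_comp_integralCurve (hR q) h).scomp t (hlin t)
  refine ⟨by rw [← hFR.self_of_nhds]; exact htime t₀ x hF.self_of_nhds, ?_⟩
  set e := extChartAt (𝓡 3) x with he
  have hx := mem_extChartAt_source (I := 𝓡 3) x
  have hex : e.symm (e x) = x := e.left_inv hx
  obtain ⟨η, hη⟩ : ∃ η, chartSymmDeriv x (e x) η = w₀ := by
    have h1 := mfderiv_comp x (I' := 𝓘(ℝ, R3)) (I'' := 𝓡 3) (g := e.symm) (f := e)
      ((contMDiffAt_extChartAt_symm_model (e.map_source hx)).mdifferentiableAt (by simp))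
      (mdifferentiableAt_extChartAt (mem_chart_source R3 x))
    have h2 : e.symm ∘ e =ᶠ[𝓝 x] id := by
      filter_upwards [(isOpen_extChartAt_source (I := 𝓡 3) x).mem_nhds hx] with y hy
      exact e.left_inv hy
    rw [h2.mfderiv_eq, mfderiv_id] at h1
    exact ⟨chartDeriv x x w₀, (DFunLike.congr_fun h1 w₀).symm⟩
  let Ψ : ℝ × R3 → R4 := fun q => F (φ (T * q.1) (e.symm q.2))
  -- the flow in the chart at the initial point
  have hχ : ∀ q : ℝ × R3, q.2 ∈ e.target →
      ContMDiffAt 𝓘(ℝ, ℝ × R3) (𝓡 3) ∞ (fun q : ℝ × R3 => φ (T * q.1) (e.symm q.2)) q := by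
    intro q hq
    have h1 : ContMDiffAt 𝓘(ℝ, ℝ × R3) 𝓘(ℝ, ℝ) ∞ (fun q : ℝ × R3 => T * q.1) q :=
      (contDiff_const.mul contDiff_fst).contMDiff.contMDiffAt
    have h2 : ContMDiffAt 𝓘(ℝ, ℝ × R3) (𝓡 3) ∞ (fun q : ℝ × R3 => e.symm q.2) q :=
      ContMDiffAt.comp q (g := e.symm) (contMDiffAt_extChartAt_symm_model hq)
        contDiff_snd.contMDiff.contMDiffAt
    exact ContMDiffAt.comp q (g := fun q : ℝ × M => φ q.1 q.2) hφ.contMDiffAt (h1.prodMk h2)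
  have hΨ : ∀ q : ℝ × R3, q.2 ∈ e.target →
      ContMDiffAt (𝓡 3) 𝓘(ℝ, R4) ∞ F (φ (T * q.1) (e.symm q.2)) → ContDiffAt ℝ ∞ Ψ q :=
    fun q hq hFq => (ContMDiffAt.comp q hFq (hχ q hq)).contDiffAt
  have hev : ∀ {P : M → Prop}, (∀ᶠ q in 𝓝 (φ (T * t₀) x), P q) →
      ∀ᶠ q : ℝ × R3 in 𝓝 (t₀, e x), P (φ (T * q.1) (e.symm q.2)) := by
    intro P hP
    have := (hχ (t₀, e x) (e.map_source hx)).continuousAt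
    rw [ContinuousAt] at this
    simp only [hex] at this
    exact this.eventually hP
  have htarget : ∀ᶠ q : ℝ × R3 in 𝓝 (t₀, e x), q.2 ∈ e.target :=
    continuousAt_snd.eventually ((isOpen_extChartAt_target x).mem_nhds (e.map_source hx))
  have hode : ∀ᶠ q in 𝓝 (t₀, e x), fderiv ℝ Ψ q (1, 0) = T • W (Ψ q) := by
    filter_upwards [htarget, hev hF, hev hFR] with q hq hFq hRq
    have h1 : HasDerivAt (fun t : ℝ => ((t, q.2) : ℝ × R3)) (1, 0) q.1 :=
      (hasDerivAt_id q.1).prodMk (hasDerivAt_const q.1 q.2)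
    have h2 := HasFDerivAt.comp_hasDerivAt (l := Ψ) (f := fun t : ℝ => ((t, q.2) : ℝ × R3)) q.1
      ((hΨ q hq hFq).differentiableAt (by simp)).hasFDerivAt h1
    have h3 := htime q.1 (e.symm q.2) hFq
    rw [hRq] at h3
    exact h2.unique h3
  have hΨ0 : Ψ (t₀, e x) = F (φ (T * t₀) x) := by simp only [Ψ, hex]
  have hspace : ∀ᶠ t in 𝓝 t₀, fderiv ℝ Ψ (t, e x) (0, η) =
      vecDeriv F (φ (T * t) x) (manDeriv (φ (T * t)) x w₀) := by
    have hc : Filter.Tendsto (fun t : ℝ => ((t, e x) : ℝ × R3)) (𝓝 t₀) (𝓝 (t₀, e x)) :=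
      Continuous.tendsto (f := fun t : ℝ => ((t, e x) : ℝ × R3)) (by fun_prop) t₀
    filter_upwards [hc.eventually (hev hF)] with t ht
    have ht' : ContMDiffAt (𝓡 3) 𝓘(ℝ, R4) ∞ F (φ (T * t) x) := by simpa only [hex] using ht
    have hφt : ContMDiffAt (𝓡 3) (𝓡 3) ∞ (φ (T * t)) x :=
      ContMDiffAt.comp x (g := fun q : ℝ × M => φ q.1 q.2) (f := fun y : M => ((T * t, y) : ℝ × M))
        hφ.contMDiffAt (contMDiffAt_const.prodMk contMDiffAt_id)
    have h1 : HasFDerivAt (fun ξ : R3 => ((t, ξ) : ℝ × R3))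
        ((0 : R3 →L[ℝ] ℝ).prod (ContinuousLinearMap.id ℝ R3)) (e x) :=
      (hasFDerivAt_const t (e x)).prodMk (hasFDerivAt_id (e x))
    have h2 := HasFDerivAt.comp (g := Ψ) (e x)
      ((hΨ (t, e x) (e.map_source hx) ht).differentiableAt (by simp)).hasFDerivAt h1
    have h3 := fderiv_comp_extChartAt_symm (F := fun q => F (φ (T * t) q)) (p₀ := x) (x := e x)
      (e.map_source hx) (by rw [← he, hex]; exact ht'.comp x hφt)
    have h4 : fderiv ℝ (fun ξ => F (φ (T * t) (e.symm ξ))) (e x) = _ := h2.fderiv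
    rw [← he, h4, hex, vecDeriv_comp ht' hφt] at h3
    have h5 := DFunLike.congr_fun h3 η
    simp only [ContinuousLinearMap.comp_apply, hη] at h5
    simpa using h5
  have hmain := hasDerivAt_variation (W := fun p => T • W p) η
    (hΨ (t₀, e x) (e.map_source hx) (hev hF).self_of_nhds) (by rw [hΨ0]; exact hW.const_smul T) hode
  rw [hΨ0, hspace.self_of_nhds, fderiv_fun_const_smul hW] at hmain
  exact hmain.congr_of_eventuallyEq (hspace.mono fun t ht => ht.symm)

end Flow

/-! ### The index of the closed Reeb orbits -/

lemma continuous_omega : Continuous fun q : R4 × R4 => omega q.1 q.2 := by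
  unfold omega
  fun_prop

lemma hasDerivAt_omega {A B : ℝ → R4} {A' B' : R4} {t : ℝ} (hA : HasDerivAt A A' t)
    (hB : HasDerivAt B B' t) :
    HasDerivAt (fun t => omega (A t) (B t)) (omega A' (B t) + omega (A t) B') t := by
  have h1 := (liouvilleL.hasFDerivAt.comp_hasDerivAt t hA).clm_apply hB
  have h2 : ∀ v w, omega v w = 2 * liouvilleL v w := fun v w => by
    rw [liouvilleL_apply, liouville_apply]; ring
  simp only [h2, ← mul_add]
  exact h1.const_mul 2

lemma continuous_henonHess : Continuous fun q : R4 × R4 => henonHess q.1 q.2 := by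
  simp only [henonHess_apply]
  refine (PiLp.continuous_toLp 2 _).comp (continuous_pi fun i => ?_)
  fin_cases i <;> simp <;> fun_prop

/-- Cramer's rule for the coordinates of a vector modulo the orbit direction in a symplectic frame. -/
lemma frameCoord_eq_of_symplectic {m u e₁ e₂ : R4} (hm : m ≠ 0) (hu : inner ℝ m u = 0)
    (h₁ : inner ℝ m e₁ = 0) (h₂ : inner ℝ m e₂ = 0) (he : omega e₁ e₂ = 1) :
    frameCoord m u = omega u e₂ * frameCoord m e₁ + omega e₁ u * frameCoord m e₂ := by
  have hn : (‖m‖ ^ 2 : ℝ) ≠ 0 := by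
    have : 0 < ‖m‖ := norm_pos_iff.2 hm
    positivity
  have k1 := im_conj_frameCoord_mul h₁ h₂
  have k2 := im_conj_frameCoord_mul hu h₂
  have k3 := im_conj_frameCoord_mul h₁ hu
  rw [he, mul_one] at k1
  generalize ‖m‖ ^ 2 = n at *
  generalize frameCoord m e₁ = a at *
  generalize frameCoord m e₂ = b at *
  generalize frameCoord m u = c at *
  generalize omega u e₂ = r at *
  generalize omega e₁ u = s at *
  simp at k1 k2 k3
  apply Complex.ext
  · apply mul_left_cancel₀ hn
    simp only [Complex.add_re, Complex.mul_re, Complex.ofReal_re, Complex.ofReal_im, zero_mul, sub_zero]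
    linear_combination (-c.re) * k1 + a.re * k2 + b.re * k3
  · apply mul_left_cancel₀ hn
    simp only [Complex.add_im, Complex.mul_im, Complex.ofReal_re, Complex.ofReal_im, zero_mul, add_zero]
    linear_combination (-c.im) * k1 + a.im * k2 + b.im * k3

/-- The coordinates of two vectors in a symplectic frame span an area equal to their symplectic
product. -/
lemma omega_mul_sub_eq_of_symplectic {m p q e₁ e₂ : R4} (hm : m ≠ 0) (hp : inner ℝ m p = 0)
    (hq : inner ℝ m q = 0) (h₁ : inner ℝ m e₁ = 0) (h₂ : inner ℝ m e₂ = 0) (he : omega e₁ e₂ = 1) :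
    omega p e₂ * omega e₁ q - omega e₁ p * omega q e₂ = omega p q := by
  have hn : (‖m‖ ^ 2 : ℝ) ≠ 0 := by
    have : 0 < ‖m‖ := norm_pos_iff.2 hm
    positivity
  have k1 := im_conj_frameCoord_mul h₁ h₂
  have k2 := im_conj_frameCoord_mul hp hq
  have e1 := frameCoord_eq_of_symplectic hm hp h₁ h₂ he
  have e2 := frameCoord_eq_of_symplectic hm hq h₁ h₂ he
  rw [he, mul_one] at k1
  rw [e1, e2] at k2
  apply mul_left_cancel₀ hn
  rw [← k2, ← k1]
  simp
  ring

namespace IsHenonCover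

variable {M : Type} [TopologicalSpace M] [ChartedSpace R3 M] [IsManifold (𝓡 3) ∞ M]
variable {E : ℝ} {π : S3 → M} {f : S3 → R4} {α : OneForm M}

/-- The lift of a solution to the energy surface and the linearized flow along it solve the Hamiltonian
equation, reparametrized, and its linearization. -/
lemma hasDerivAt_lift (h : IsHenonCover E π f α) (h0 : 0 < E) (hE : E < 1 / 6) {φ : ℝ → M → M}
    (hφ : IsReebFlow α φ) {x : M} {T : ℝ} {ζ : ℝ → S3} (hζ : Continuous ζ)
    (hπζ : ∀ t, π (ζ t) = φ (T * t) x) (w : R3) (t : ℝ) :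
    HasDerivAt (fun t => f (ζ t)) (T • reebVector (f (ζ t))) t ∧
      HasDerivAt (fun t => liftDeriv π f (ζ t) (manDeriv (φ (T * t)) x w))
        (T • fderiv ℝ reebVector (f (ζ t)) (liftDeriv π f (ζ t) (manDeriv (φ (T * t)) x w))) t := by
  obtain ⟨R, hR, hint⟩ := hφ.integralCurve
  obtain ⟨F, hF, hF2, -⟩ := h.exists_model (ζ t)
  have hFR : ∀ᶠ q in 𝓝 (π (ζ t)), vecDeriv F q (R q) = reebVector (F q) := by
    apply h.eventually_of_comp
    filter_upwards [hF2] with z hz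
    rw [hz.1, hz.2]
    exact h.liftDeriv_reeb h0 hE hR z
  have hFt := hF2.self_of_nhds
  have hsm := hF.smooth
  have hev : ∀ᶠ s in 𝓝 t, F (φ (T * s) x) = f (ζ s) ∧
      vecDeriv F (φ (T * s) x) = liftDeriv π f (ζ s) := by
    filter_upwards [hζ.continuousAt.eventually hF2] with s hs
    rwa [← hπζ]
  rw [hπζ] at hFR hsm
  have hd := (differentiableAt_reebVector (inner_henonGrad_self_pos h0 hE (h.mem (ζ t))).ne').1
  rw [← hev.self_of_nhds.1] at hd
  obtain ⟨h1, h2⟩ := hasDerivAt_flow hφ.smooth hint hsm hFR hd w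
  rw [hev.self_of_nhds.1] at h1 h2
  rw [hev.self_of_nhds.2] at h2
  refine ⟨h1.congr_of_eventuallyEq (hev.mono fun s hs => hs.1.symm),
    h2.congr_of_eventuallyEq (hev.mono fun s hs => ?_)⟩
  simp only [hs.2]

/-- The image in `ℝ⁴` of a continuous family of tangent vectors over a map that lifts to `S³`. -/
lemma continuous_liftDeriv (h : IsHenonCover E π f α) {Z : Type*} [TopologicalSpace Z] {u : Z → M}
    {U : Z → S3} (hU : Continuous U) (hπU : ∀ z, π (U z) = u z)
    {e : ∀ z, TangentSpace (𝓡 3) (u z)}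
    (he : Continuous (fun z => (⟨u z, e z⟩ : TangentBundle (𝓡 3) M))) :
    Continuous fun z => liftDeriv π f (U z) (e z) := by
  rw [continuous_iff_continuousAt]
  intro z₀
  obtain ⟨F, hF, hF2, -⟩ := h.exists_model (U z₀)
  have hsm := hF.smooth
  rw [hπU] at hsm
  refine (continuousAt_vecDeriv he.continuousAt hsm).congr ?_
  filter_upwards [hU.continuousAt.eventually hF2] with z hz
  rw [← hz.2, hπU]

/-- The orbit of the Hamiltonian flow through a closed Reeb orbit, with a solution of the linearized
equation. -/
lemma isConvexOrbit (h : IsHenonCover E π f α) (h0 : 0 < E) (hE : E < 1 / 6) {φ : ℝ → M → M}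
    (hφ : IsReebFlow α φ) {x : M} {T : ℝ} (hT : 0 < T) {ζ : ℝ → S3} (hζ : Continuous ζ)
    (hπζ : ∀ t, π (ζ t) = φ (T * t) x) (w : R3)
    (hne : ∀ t, frameCoord (henonGrad (f (ζ t)))
      (liftDeriv π f (ζ t) (manDeriv (φ (T * t)) x w)) ≠ 0) :
    IsConvexOrbit (fun t => f (ζ t)) (fun t => henonGrad (f (ζ t)))
      (fun t => liftDeriv π f (ζ t) (manDeriv (φ (T * t)) x w)) (fun t => henonHess (f (ζ t)))
      (fun t => T * reebFactor (f (ζ t)))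
      (fun t => T * fderiv ℝ reebFactor (f (ζ t)) (liftDeriv π f (ζ t) (manDeriv (φ (T * t)) x w))) := by
  have hpos : ∀ t, 0 < inner ℝ (henonGrad (f (ζ t))) (f (ζ t)) := fun t =>
    inner_henonGrad_self_pos h0 hE (h.mem (ζ t))
  have hγ : ∀ t, HasDerivAt (fun t => f (ζ t))
      ((T * reebFactor (f (ζ t))) • mulI (henonGrad (f (ζ t)))) t := fun t => by
    refine (h.hasDerivAt_lift h0 hE hφ hζ hπζ w t).1.congr_deriv ?_
    rw [reebVector, smul_smul]
  have hγc : Continuous fun t => f (ζ t) := h.smooth.continuous.comp hζ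
  have hNc : Continuous fun t => henonGrad (f (ζ t)) :=
    (contDiff_henonGrad (n := 0)).continuous.comp hγc
  have hgc : Continuous fun t => T * reebFactor (f (ζ t)) := by
    refine continuous_const.mul (continuous_iff_continuousAt.2 fun t => ?_)
    exact ContinuousAt.comp (f := fun t => f (ζ t))
      (contDiffAt_reebFactor (hpos t).ne' (n := 0)).continuousAt hγc.continuousAt
  have hv : ∀ t, HasDerivAt (fun t => liftDeriv π f (ζ t) (manDeriv (φ (T * t)) x w)) _ t := fun t =>
    (h.hasDerivAt_lift h0 hE hφ hζ hπζ w t).2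
  have hvc : Continuous fun t => liftDeriv π f (ζ t) (manDeriv (φ (T * t)) x w) :=
    continuous_iff_continuousAt.2 fun t => (hv t).continuousAt
  constructor
  · exact fun t => mul_pos hT (div_pos two_pos (hpos t))
  · exact hgc
  · exact hγ
  · intro t
    have h1 := ((contDiff_henonGrad (n := 1)).differentiable (by simp) (f (ζ t))).hasFDerivAt
    have h2 := HasFDerivAt.comp_hasDerivAt (f := fun t => f (ζ t)) t h1 (hγ t)
    refine h2.congr_deriv ?_
    rw [fderiv_henonGrad_apply, map_smul]
  · exact hgc.smul (continuous_henonHess.comp (hγc.prodMk (mulI.continuous.comp hNc)))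
  · intro t
    refine (hv t).congr_deriv ?_
    rw [(differentiableAt_reebVector (hpos t).ne').2, smul_add, smul_smul, smul_smul]
  · refine (hgc.smul (mulI.continuous.comp (continuous_henonHess.comp (hγc.prodMk hvc)))).add ?_
    have hc : Continuous fun t => fderiv ℝ reebFactor (f (ζ t)) := by
      refine continuous_iff_continuousAt.2 fun t => ?_
      exact ContinuousAt.comp (f := fun t => f (ζ t))
        ((contDiffAt_reebFactor (hpos t).ne' (n := 1)).fderiv_right (m := 0) (by simp)).continuousAt
        hγc.continuousAt
    exact (continuous_const.mul (hc.clm_apply hvc)).smul (mulI.continuous.comp hNc)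
  · exact fun t u w => henonHess_symm _ u w
  · exact fun t u hu hu0 => inner_henonHess_pos h0 hE (h.mem (ζ t)) hu hu0
  · exact fun t => h.inner_liftDeriv (ζ t) _
  · exact hne

/-- The linearized flow preserves `dα`. -/
lemma omega_liftDeriv_flow (h : IsHenonCover E π f α) (h0 : 0 < E) (hE : E < 1 / 6) {φ : ℝ → M → M}
    (hφ : IsReebFlow α φ) {x : M} {T : ℝ} {ζ : ℝ → S3} (hζ : Continuous ζ)
    (hπζ : ∀ t, π (ζ t) = φ (T * t) x) (a b : R3) (t : ℝ) :
    omega (liftDeriv π f (ζ t) (manDeriv (φ (T * t)) x a))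
      (liftDeriv π f (ζ t) (manDeriv (φ (T * t)) x b)) =
    omega (liftDeriv π f (ζ 0) a) (liftDeriv π f (ζ 0) b) := by
  set A := fun t => liftDeriv π f (ζ t) (manDeriv (φ (T * t)) x a) with hA
  set B := fun t => liftDeriv π f (ζ t) (manDeriv (φ (T * t)) x b) with hB
  have hd : ∀ t, HasDerivAt (fun t => omega (A t) (B t)) 0 t := by
    intro t
    have hpos := inner_henonGrad_self_pos h0 hE (h.mem (ζ t))
    have h1 : HasDerivAt A _ t := (h.hasDerivAt_lift h0 hE hφ hζ hπζ a t).2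
    have h2 : HasDerivAt B _ t := (h.hasDerivAt_lift h0 hE hφ hζ hπζ b t).2
    refine (hasDerivAt_omega h1 h2).congr_deriv ?_
    have hAt : inner ℝ (henonGrad (f (ζ t))) (A t) = 0 := h.inner_liftDeriv (ζ t) _
    have hBt : inner ℝ (henonGrad (f (ζ t))) (B t) = 0 := h.inner_liftDeriv (ζ t) _
    change omega (T • fderiv ℝ reebVector (f (ζ t)) (A t)) (B t) +
      omega (A t) (T • fderiv ℝ reebVector (f (ζ t)) (B t)) = 0
    rw [(differentiableAt_reebVector hpos.ne').2, (differentiableAt_reebVector hpos.ne').2, omega_smul_left,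
      omega_smul_right, omega_add_left, omega_add_right, omega_smul_left, omega_smul_left,
      omega_smul_right, omega_smul_right, omega_mulI_left, omega_mulI_left, omega_mulI_right,
      omega_mulI_right, hBt, real_inner_comm (henonGrad (f (ζ t))) (A t), hAt, henonHess_symm]
    ring
  have h1 := is_const_of_deriv_eq_zero (fun t => (hd t).differentiableAt) (fun t => (hd t).deriv) t 0
  refine h1.trans ?_
  have h2 : manDeriv (φ (T * 0)) x = ContinuousLinearMap.id ℝ R3 := by
    rw [mul_zero, show φ 0 = fun q => q from funext hφ.zero, manDeriv_id]
  simp only [hA, hB, h2, ContinuousLinearMap.id_apply]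

/-- The closed orbits have index at least `3`: over a capping disk the projection to the coordinates
`frameCoord` is a trivialization isotopic to the given one, and the convexity of the energy surface
forces every solution of the linearized equation to turn by more than `2π` in it. -/
theorem three_le_index (h : IsHenonCover E π f α) (h0 : 0 < E) (hE : E < 1 / 6) {φ : ℝ → M → M}
    (hφ : IsReebFlow α φ) {x : M} {T : ℝ} (hT : 0 < T) {u : ClosedDisk → M}
    (hu : IsCappingDisk φ x T u) {e₁ e₂ : ∀ z : ClosedDisk, TangentSpace (𝓡 3) (u z)}
    (he : IsSymplecticFrame α u e₁ e₂) : 3 ≤ conleyZehnderIndex (linearizedPath α φ x T u e₁ e₂) := by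
  have hconv : Convex ℝ (Metric.closedBall (0 : ℂ) 1) := convex_closedBall _ _
  have : ContractibleSpace ClosedDisk := hconv.contractibleSpace ⟨0, by simp⟩
  have : LocallyPathConnectedSpace ClosedDisk := hconv.locallyPathConnectedSpace
  obtain ⟨ζ₀, hζ₀⟩ := h.surjective (u (diskBoundary 0))
  obtain ⟨U, ⟨-, hU⟩, -⟩ := h.cov.existsUnique_continuousMap_lifts ⟨u, hu.1⟩ (diskBoundary 0) ζ₀ hζ₀
  have hπU : ∀ z, π (U z) = u z := fun z => congrFun hU z
  set ζ : ℝ → S3 := fun t => U (diskBoundary t) with hζdef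
  have hζ : Continuous ζ := U.continuous.comp continuous_diskBoundary
  have hπζ : ∀ t, π (ζ t) = φ (T * t) x := fun t => (hπU _).trans (hu.2 t)
  set ε₁ : ClosedDisk → R3 := e₁ with hε₁
  set ε₂ : ClosedDisk → R3 := e₂ with hε₂
  set E₁ : ClosedDisk → R4 := fun z => liftDeriv π f (U z) (ε₁ z) with hE₁
  set E₂ : ClosedDisk → R4 := fun z => liftDeriv π f (U z) (ε₂ z) with hE₂
  have hE₁c : Continuous E₁ := h.continuous_liftDeriv U.continuous hπU he.continuous_fst
  have hE₂c : Continuous E₂ := h.continuous_liftDeriv U.continuous hπU he.continuous_snd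
  have hd : ∀ z v w, α.dAt (u z) v w = omega (liftDeriv π f (U z) v) (liftDeriv π f (U z) w) :=
    fun z v w => by rw [← hπU, h.dAt_eq]
  have hω : ∀ z, omega (E₁ z) (E₂ z) = 1 := fun z => (hd z _ _).symm.trans (he.symplectic z)
  have hNE : ∀ z v, inner ℝ (henonGrad (f (U z))) (liftDeriv π f (U z) v) = 0 := fun z v =>
    h.inner_liftDeriv (U z) v
  have hN0 : ∀ z, henonGrad (f (U z)) ≠ 0 := fun z e => by
    have := inner_henonGrad_self_pos h0 hE (h.mem (U z))
    rw [e, inner_zero_left] at this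
    exact lt_irrefl _ this
  have hNc : Continuous fun z => henonGrad (f (U z)) :=
    (contDiff_henonGrad (n := 0)).continuous.comp (h.smooth.continuous.comp U.continuous)
  have hdet : ∀ z, 0 < (starRingEnd ℂ (frameCoord (henonGrad (f (U z))) (E₁ z)) *
      frameCoord (henonGrad (f (U z))) (E₂ z)).im := fun z => by
    rw [im_conj_frameCoord_mul (hNE z _) (hNE z _), hω, mul_one]
    have := norm_pos_iff.2 (hN0 z)
    positivity
  -- the solutions of the linearized equation, as functions of the initial vector
  set V : R3 → ℝ → R4 := fun w t => liftDeriv π f (ζ t) (manDeriv (φ (T * t)) x w) with hV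
  have hVc : ∀ w, Continuous (V w) := fun w => continuous_iff_continuousAt.2 fun t =>
    (h.hasDerivAt_lift h0 hE hφ hζ hπζ w t).2.continuousAt
  have hVN : ∀ w t, inner ℝ (henonGrad (f (ζ t))) (V w t) = 0 := fun w t => h.inner_liftDeriv _ _
  set a := ε₁ (diskBoundary 0) with ha
  set b := ε₂ (diskBoundary 0) with hb
  have hVab : ∀ t, omega (V a t) (V b t) = 1 := fun t =>
    (h.omega_liftDeriv_flow h0 hE hφ hζ hπζ a b t).trans (hω (diskBoundary 0))
  have hVlin : ∀ (v : ℂ) t, V (v.re • a + v.im • b) t = v.re • V a t + v.im • V b t := fun v t => by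
    simp only [hV, map_add, map_smul]
  -- their coordinates in the symplectic frame
  let P : R3 → ℝ → ℂ := fun w t =>
    ⟨omega (V w t) (E₂ (diskBoundary t)), omega (E₁ (diskBoundary t)) (V w t)⟩
  have hPc : ∀ w, Continuous (P w) := fun w => by
    have h1 : Continuous fun t => omega (V w t) (E₂ (diskBoundary t)) :=
      continuous_omega.comp ((hVc w).prodMk (hE₂c.comp continuous_diskBoundary))
    have h2 : Continuous fun t => omega (E₁ (diskBoundary t)) (V w t) :=
      continuous_omega.comp ((hE₁c.comp continuous_diskBoundary).prodMk (hVc w))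
    exact Complex.equivRealProdCLM.symm.continuous.comp (h1.prodMk h2)
  have hlin : ∀ t v, linearizedPath α φ x T u e₁ e₂ t v = P (v.re • a + v.im • b) t := fun t v =>
    Complex.ext (hd (diskBoundary t) _ _) (hd (diskBoundary t) _ _)
  -- the change from the symplectic to the quaternionic frame, both of which extend over the disk
  have hframe : ∀ w t, frameCoord (henonGrad (f (ζ t))) (V w t) =
      (P w t).re * frameCoord (henonGrad (f (ζ t))) (E₁ (diskBoundary t)) +
        (P w t).im * frameCoord (henonGrad (f (ζ t))) (E₂ (diskBoundary t)) := fun w t =>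
    frameCoord_eq_of_symplectic (hN0 (diskBoundary t)) (hVN w t) (hNE _ _) (hNE _ _) (hω _)
  have hne : ∀ v : ℂ, v ≠ 0 → ∀ t, frameCoord (henonGrad (f (ζ t))) (V (v.re • a + v.im • b) t) ≠ 0 := by
    intro v hv t hzero
    have hn : (‖henonGrad (f (ζ t))‖ ^ 2 : ℝ) ≠ 0 := by
      have := norm_pos_iff.2 (hN0 (diskBoundary t))
      positivity
    have key : ∀ w, omega (V (v.re • a + v.im • b) t) (V w t) = 0 := fun w => by
      have h1 := im_conj_frameCoord_mul (hVN (v.re • a + v.im • b) t) (hVN w t)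
      rw [hzero, map_zero, zero_mul, Complex.zero_im] at h1
      exact (mul_eq_zero.1 h1.symm).resolve_left hn
    have ka := key a
    have kb := key b
    rw [hVlin, omega_add_left, omega_smul_left, omega_smul_left, omega_self, omega_swap (V b t),
      hVab] at ka
    rw [hVlin, omega_add_left, omega_smul_left, omega_smul_left, omega_self, hVab] at kb
    apply hv
    apply Complex.ext <;> simp <;> linarith
  refine three_le_conleyZehnderIndex (z₁ := P a) (z₂ := P b) (fun t v => ?_) (hPc a).continuousOn
    (hPc b).continuousOn (fun t _ => ?_) fun v hv θ hθ => ?_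
  · rw [hlin]
    apply Complex.ext
    · simp only [P]
      rw [hVlin, omega_add_left, omega_smul_left, omega_smul_left]
      simp
    · simp only [P]
      rw [hVlin, omega_add_right, omega_smul_right, omega_smul_right]
      simp
  · have h1 := omega_mul_sub_eq_of_symplectic (hN0 (diskBoundary t)) (hVN a t) (hVN b t)
      (hNE (diskBoundary t) (ε₁ _)) (hNE (diskBoundary t) (ε₂ _)) (hω (diskBoundary t))
    rw [hVab] at h1
    have h2 : (starRingEnd ℂ (P a t) * P b t).im =
        omega (V a t) (E₂ (diskBoundary t)) * omega (E₁ (diskBoundary t)) (V b t) -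
          omega (E₁ (diskBoundary t)) (V a t) * omega (V b t) (E₂ (diskBoundary t)) := by
      simp [P]; ring
    rw [h2]
    have h3 : omega (V a t) (E₂ (diskBoundary t)) * omega (E₁ (diskBoundary t)) (V b t) -
          omega (E₁ (diskBoundary t)) (V a t) * omega (V b t) (E₂ (diskBoundary t)) = 1 := h1
    rw [h3]
    exact one_pos
  · have hθ' : IsArgOn (P (v.re • a + v.im • b)) θ (Set.Icc 0 1) :=
      ⟨hθ.cont, fun t ht => by rw [← hlin]; exact hθ.eq t ht⟩
    have hc : ∀ {e : ClosedDisk → R4}, Continuous e →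
        Continuous fun z => frameCoord (henonGrad (f (U z))) (e z) := fun he =>
      continuous_frameCoord.comp (hNc.prodMk he)
    refine two_pi_lt_of_frame_change (hc hE₁c) (hc hE₂c) hdet (hPc (v.re • a + v.im • b)).continuousOn
      (fun t _ hz => hne v hv t ?_) hθ' fun Θ hΘ => ?_
    · rw [hframe, hz]
      simp
    · have horb := h.isConvexOrbit h0 hE hφ hT hζ hπζ (v.re • a + v.im • b) (hne v hv)
      refine horb.two_pi_lt_of_closed (fun s t hst => ?_) (fun s t hst => ?_) ?_ (Θ := Θ) ?_
      · exact inner_henonGrad_sub_neg h0 hE (h.mem _) (henonSphere_subset_henonBody (h.mem _)) hst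
      · exact congrArg henonGrad hst
      · simp only [hζdef, diskBoundary_one]
      · refine ⟨hΘ.cont, fun t ht => ?_⟩
        have h1 := hΘ.eq t ht
        rw [← hframe] at h1
        exact h1

theorem isDynamicallyConvex [CompactSpace M] [T2Space M] (h : IsHenonCover E π f α) (h0 : 0 < E)
    (hE : E < 1 / 6) : IsDynamicallyConvex α where
  contact := h.isContactForm h0 hE
  chern := h.chernClassVanishesOnSpheres h0 hE
  index _ hφ _ _ hT _ _ hu _ _ he := h.three_le_index h0 hE hφ hT hu he

end IsHenonCover

/-! ### The lens space -/

/-- The composition of a chart of one manifold and the inverse of a chart of another one is smooth. -/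
lemma contMDiffAt_chart_symm_comp_chart {M₁ M₂ : Type*} [TopologicalSpace M₁] [ChartedSpace R3 M₁]
    [IsManifold (𝓡 3) ∞ M₁] [TopologicalSpace M₂] [ChartedSpace R3 M₂] [IsManifold (𝓡 3) ∞ M₂] {x p : M₁}
    {y : M₂} (hp : p ∈ (chartAt R3 x).source) (hq : chartAt R3 x p ∈ (chartAt R3 y).target) :
    ContMDiffAt (𝓡 3) (𝓡 3) ∞ (fun q => (chartAt R3 y).symm (chartAt R3 x q)) p := by
  have c1 : ContMDiffAt (𝓡 3) 𝓘(ℝ, R3) ∞ (chartAt R3 x) p :=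
    (contMDiffOn_chart (I := 𝓡 3) (x := x)).contMDiffAt ((chartAt R3 x).open_source.mem_nhds hp)
  have c2 : ContMDiffAt 𝓘(ℝ, R3) (𝓡 3) ∞ (chartAt R3 y).symm (chartAt R3 x p) :=
    (contMDiffOn_chart_symm (I := 𝓡 3) (x := y)).contMDiffAt ((chartAt R3 y).open_target.mem_nhds hq)
  exact c2.comp p c1

section Quotient

variable {G : Type*} [Group G] [MulAction G S3] [ProperlyDiscontinuousSMul G S3]
  [ContinuousConstSMul G S3] [IsCancelSMul G S3]

/-- The projection to the orbit space of a free, properly discontinuous, smooth action is smooth and has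
smooth local sections. -/
lemma contMDiff_orbitQuotient_mk [IsManifold (𝓡 3) ∞ (MulAction.orbitRel.Quotient G S3)]
    (hG : ∀ g : G, ContMDiff (𝓡 3) (𝓡 3) ∞ (fun z : S3 => g • z)) (z : S3) :
    ContMDiffAt (𝓡 3) (𝓡 3) ∞ (Quotient.mk (MulAction.orbitRel G S3)) z ∧
    ∃ σ : MulAction.orbitRel.Quotient G S3 → S3,
      (∀ᶠ q in 𝓝 (Quotient.mk (MulAction.orbitRel G S3) z), ContMDiffAt (𝓡 3) (𝓡 3) ∞ σ q ∧
        Quotient.mk (MulAction.orbitRel G S3) (σ q) = q) ∧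
      ∀ᶠ w in 𝓝 z, σ (Quotient.mk (MulAction.orbitRel G S3) w) = w := by
  have hq : IsQuotientCoveringMap (Quotient.mk (MulAction.orbitRel G S3)) G :=
    isQuotientCoveringMap_quotientMk_of_properlyDiscontinuousSMul
  have hl := hq.isCoveringMap.isLocalHomeomorph
  set π : S3 → MulAction.orbitRel.Quotient G S3 := Quotient.mk (MulAction.orbitRel G S3) with hπ
  have hsurj : Function.Surjective π := Quotient.mk_surjective
  obtain ⟨z₀, hchart', hπz₀⟩ : ∃ z₀, chartAt R3 (π z) = (hl.localInverseAt z₀).trans (chartAt R3 z₀) ∧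
      π z₀ = π z :=
    ⟨hsurj.hasRightInverse.choose (π z), rfl, hsurj.hasRightInverse.choose_spec (π z)⟩
  obtain ⟨g, hg⟩ : ∃ g : G, g • z = z₀ := hq.apply_eq_iff_mem_orbit.1 hπz₀
  obtain ⟨τ, hτ⟩ : ∃ τ, τ = hl.localInverseAt z₀ := ⟨_, rfl⟩
  have hchart : chartAt R3 (π z) = τ.trans (chartAt R3 z₀) := by rw [hτ, hchart']
  have hτsymm : ∀ w, τ.symm w = π w := fun w => by rw [hτ, IsLocalHomeomorph.localInverseAt_symm]
  have hz₀τ : z₀ ∈ τ.target := hτ ▸ hl.self_mem_localInverseAt_target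
  have hev : ∀ᶠ w in 𝓝 z, g • w ∈ τ.target ∧ g • w ∈ (chartAt R3 z₀).source := by
    have hc : ContinuousAt (fun w : S3 => g • w) z := (continuous_const_smul g).continuousAt
    refine hc.eventually ((τ.open_target.inter (chartAt R3 z₀).open_source).mem_nhds ?_)
    change g • z ∈ _
    rw [hg]
    exact ⟨hz₀τ, mem_chart_source R3 z₀⟩
  have hmk : ∀ w, π w = π (g • w) := fun w => (hq.map_smul g).symm
  refine ⟨?_, fun q => g⁻¹ • τ q, ?_, ?_⟩
  · have h1 : ContMDiffAt (𝓡 3) (𝓡 3) ∞ (fun w => (chartAt R3 (π z)).symm (chartAt R3 z₀ (g • w))) z := by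
      have h2 : chartAt R3 (π z) (π z) = chartAt R3 z₀ (g • z) := by
        rw [hchart, OpenPartialHomeomorph.coe_trans, Function.comp_apply, hg]
        congr 1
        rw [← hπz₀, hτ, IsLocalHomeomorph.localInverseAt_apply_self]
      have h3 : chartAt R3 z₀ (g • z) ∈ (chartAt R3 (π z)).target := by
        rw [← h2]
        exact mem_chart_target R3 (π z)
      exact (contMDiffAt_chart_symm_comp_chart hev.self_of_nhds.2 h3).comp z (hG g).contMDiffAt
    refine h1.congr_of_eventuallyEq ?_
    filter_upwards [hev] with w hw
    rw [hchart, OpenPartialHomeomorph.coe_trans_symm, Function.comp_apply,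
      (chartAt R3 z₀).left_inv hw.2, hτsymm, ← hmk]
  · filter_upwards [(chartAt R3 (π z)).open_source.mem_nhds (mem_chart_source R3 (π z))] with q hqs
    have hqs' : q ∈ τ.source ∧ τ q ∈ (chartAt R3 z₀).source := by
      rw [hchart, OpenPartialHomeomorph.trans_source] at hqs
      exact hqs
    constructor
    · have h2 : chartAt R3 (π z) q ∈ (chartAt R3 z₀).target := by
        rw [hchart]
        exact (chartAt R3 z₀).map_source hqs'.2
      have h1 := contMDiffAt_chart_symm_comp_chart (y := z₀) hqs h2
      refine (hG g⁻¹).contMDiffAt.comp q (h1.congr_of_eventuallyEq ?_)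
      filter_upwards [(chartAt R3 (π z)).open_source.mem_nhds hqs] with q' hq'
      rw [hchart, OpenPartialHomeomorph.trans_source] at hq'
      rw [hchart]
      exact ((chartAt R3 z₀).left_inv hq'.2).symm
    · rw [hq.map_smul, ← hτsymm, τ.left_inv hqs'.1]
  · filter_upwards [hev] with w hw
    rw [hmk w, ← hτsymm, τ.right_inv hw.1, inv_smul_smul]

end Quotient

lemma isHenonSymmetry_id : IsHenonSymmetry (ContinuousLinearMap.id ℝ R4) := by
  constructor <;> intros <;> rfl

/-- The rotation of order three as a linear map. -/
def henonRotationL : R4 →L[ℝ] R4 := LinearMap.toContinuousLinearMap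
  { toFun := henonRotation
    map_add' := fun p q => by ext i; fin_cases i <;> simp [henonRotation] <;> ring
    map_smul' := henonRotation_smul }

lemma henonRotationL_apply (p : R4) : henonRotationL p = henonRotation p := rfl

lemma isHenonSymmetry_henonRotationL : IsHenonSymmetry henonRotationL := by
  have h3 : √3 ^ 2 = 3 := Real.sq_sqrt (by norm_num)
  constructor
  · intro p q
    simp only [henonRotationL_apply, henonRotation_eq, inner_R4]
    simp
    linear_combination (1 / 4 * (p 0 * q 0 + p 1 * q 1 + p 2 * q 2 + p 3 * q 3)) * h3
  · intro p q
    simp only [henonRotationL_apply, henonRotation_eq, omega]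
    simp
    linear_combination (1 / 4 * ((p 2 * q 0 - p 0 * q 2) + (p 3 * q 1 - p 1 * q 3))) * h3
  · intro p
    simp only [henonRotationL_apply, henonRotation_eq, henonGrad]
    ext i
    fin_cases i
    · simp
      linear_combination (-(1 / 2) * p 0 * p 1) * h3
    · simp
      linear_combination (1 / 4 * (p 1 ^ 2 - p 0 ^ 2)) * h3
    · simp
    · simp
  · intro p
    simp only [henonRotationL_apply, henonRotation_eq, mulJ_apply]
    ext i
    fin_cases i <;> simp <;> ring

lemma IsHenonSymmetry.comp {ρ ρ' : R4 →L[ℝ] R4} (h : IsHenonSymmetry ρ) (h' : IsHenonSymmetry ρ') :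
    IsHenonSymmetry (ρ.comp ρ') := by
  constructor
  · intro p q; simp only [ContinuousLinearMap.comp_apply, h.inner, h'.inner]
  · intro p q; simp only [ContinuousLinearMap.comp_apply, h.omega, h'.omega]
  · intro p; simp only [ContinuousLinearMap.comp_apply, h.grad, h'.grad]
  · intro p; simp only [ContinuousLinearMap.comp_apply, h.mulJ, h'.mulJ]

lemma exists_symmetry_of_lensGroup (E : ℝ) (g : lensGroup 3 2) : ∃ ρ : R4 →L[ℝ] R4,
    (∀ w, henonRadial E (g • w) = ρ (henonRadial E w)) ∧ IsHenonSymmetry ρ := by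
  obtain ⟨g, hg⟩ := g
  have hfin : IsOfFinOrder (lensGenerator 3 2) := isOfFinOrder_iff_pow_eq_one.2 ⟨3, by norm_num, by
    have := lensGenerator_zpow_eq_one (p := 3) (q := 2) (by norm_num) (k := 3) (by norm_num)
    exact_mod_cast this⟩
  obtain ⟨n, rfl⟩ := (hfin.mem_powers_iff_mem_zpowers).2 hg
  suffices h : ∃ ρ : R4 →L[ℝ] R4, (∀ w : S3, henonRadial E (lensGenerator 3 2 ^ n • w) =
      ρ (henonRadial E w)) ∧ IsHenonSymmetry ρ from h
  clear hg
  induction n with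
  | zero => exact ⟨_, fun w => by rw [pow_zero, one_smul]; rfl, isHenonSymmetry_id⟩
  | succ n ih =>
    obtain ⟨ρ, h1, h2⟩ := ih
    refine ⟨ρ.comp henonRotationL, fun w => ?_, h2.comp isHenonSymmetry_henonRotationL⟩
    rw [pow_succ, mul_smul, h1, henonRadial_lensGenerator]
    rfl

lemma isHenonCovering_lensProj {E : ℝ} (h0 : 0 < E) (hE : E < 1 / 6) :
    IsHenonCovering E (lensProj 3 2) (henonRadial E) := by
  have hG : ∀ g : lensGroup 3 2, ContMDiff (𝓡 3) (𝓡 3) ∞ (fun z : S3 => g • z) := fun g =>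
    contMDiff_smul_sphere (g : R4 ≃ₗᵢ[ℝ] R4)
  have hq : IsQuotientCoveringMap (lensProj 3 2) (lensGroup 3 2) :=
    isQuotientCoveringMap_quotientMk_of_properlyDiscontinuousSMul
  have hf := isSphereParametrization_henonRadial h0 hE
  refine ⟨hq.isCoveringMap, Quotient.mk_surjective, fun z => (contMDiff_orbitQuotient_mk hG z).1,
    fun z => (contMDiff_orbitQuotient_mk hG z).2, hf.smooth, hf.immersion,
    fun z => hf.range_eq ▸ Set.mem_range_self z, fun z z' hz => ?_⟩
  obtain ⟨g, hg⟩ := hq.apply_eq_iff_mem_orbit.1 hz.symm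
  obtain ⟨ρ, h1, h2⟩ := exists_symmetry_of_lensGroup E g
  exact ⟨fun w => g • w, ρ, hG g, fun w => hq.map_smul g, hg, h1, h2⟩

/-- The one-form on the base of a covering whose pullback is the Liouville form. It is defined by a choice
of points in the fibres; symmetries of `λ₀` make it independent of the choice. -/
def coveredForm {M : Type} [TopologicalSpace M] [ChartedSpace R3 M] {π : S3 → M}
    (hπ : Function.Surjective π) (f : S3 → R4) : OneForm M := fun p =>
  ((liouville (f (Function.surjInv hπ p))).comp (liftDeriv π f (Function.surjInv hπ p)) : R3 →L[ℝ] ℝ)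

lemma IsHenonCovering.isHenonCover {M : Type} [TopologicalSpace M] [ChartedSpace R3 M] {E : ℝ}
    {π : S3 → M} {f : S3 → R4} (h : IsHenonCovering E π f) :
    IsHenonCover E π f (coveredForm h.surjective f) where
  toIsHenonCovering := h
  form_eq z := by
    ext v
    have h1 : (coveredForm h.surjective f).at (π z) =
      (liouville (f (Function.surjInv h.surjective (π z)))).comp
      (liftDeriv π f (Function.surjInv h.surjective (π z))) := rfl
    obtain ⟨ρ, hρ, hf, hlift⟩ := h.exists_symmetry (Function.surjInv_eq h.surjective (π z)).symm
    rw [ContinuousLinearMap.comp_apply, h1, ContinuousLinearMap.comp_apply,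
      ContinuousLinearMap.comp_apply, hf, hlift, h.liftDeriv_manDeriv, liouville_apply, liouville_apply,
      hρ.omega]

lemma IsSphereParametrization.isHenonCover {E : ℝ} {f : S3 → R4}
    (hf : IsSphereParametrization f (henonSphere E)) :
    IsHenonCover E (fun z => z) f (liouvillePullback f) where
  cov := isLocalHomeomorph_iff_isCoveringMap.1 (Homeomorph.refl S3).isLocalHomeomorph
  surjective := Function.surjective_id
  smooth_proj := contMDiff_id
  exists_section z := ⟨fun z => z, Filter.Eventually.of_forall fun q => ⟨contMDiffAt_id, rfl⟩,
    Filter.Eventually.of_forall fun _ => rfl⟩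
  smooth := hf.smooth
  immersion := hf.immersion
  mem z := hf.range_eq ▸ Set.mem_range_self z
  deck z z' hz := ⟨fun w => w, ContinuousLinearMap.id ℝ R4, contMDiff_id, fun _ => rfl, hz, fun _ => rfl,
    isHenonSymmetry_id⟩
  form_eq z := by
    rw [manDeriv_id]
    rfl

/-- The Reeb vector field on the energy surface is a positive multiple of the Hamiltonian vector field. -/
lemma exists_isReebField_isHamiltonianVector {E : ℝ} (h0 : 0 < E) (hE : E < 1 / 6) {f : S3 → R4}
    (hf : IsSphereParametrization f (henonSphere E)) :
    ∃ R : ∀ z : S3, TangentSpace (𝓡 3) z, IsReebField (liouvillePullback f) R ∧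
      ∀ z : S3, ∃ c : ℝ, 0 < c ∧
        IsHamiltonianVector henonHeiles (f z) (c • mfderiv (𝓡 3) 𝓘(ℝ, R4) f z (R z)) := by
  have h := hf.isHenonCover
  obtain ⟨R, hR⟩ := h.exists_isReebField h0 hE
  refine ⟨R, hR, fun z => ?_⟩
  have hpos := inner_henonGrad_self_pos h0 hE (h.mem z)
  refine ⟨inner ℝ (henonGrad (f z)) (f z) / 2, half_pos hpos, fun v => ?_⟩
  have h1 := h.liftDeriv_reeb h0 hE hR z
  have h2 : liftDeriv (fun z => z) f z = vecDeriv f z := by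
    have := h.liftDeriv_comp z
    rwa [manDeriv_id, ContinuousLinearMap.comp_id] at this
  rw [h2] at h1
  change omega ((inner ℝ (henonGrad (f z)) (f z) / 2) • vecDeriv f z (R z)) v = _
  rw [h1, smul_smul, div_mul_div_comm, mul_comm, div_self (by positivity), one_smul, omega_mulI_left,
    fderiv_henonHeiles_apply]

/-- The radial projection preserves the kernel of the Liouville form, so that the contact form on the lens
space defines the standard contact structure. -/
lemma lensContactStructure_eq {E : ℝ} (h0 : 0 < E) (hE : E < 1 / 6) {α : OneForm (LensSpace 3 2)}
    (h : IsHenonCover E (lensProj 3 2) (henonRadial E) α) :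
    {w : TangentBundle (𝓡 3) (LensSpace 3 2) | α w.proj w.snd = 0} = lensContactStructure 3 2 := by
  have key : ∀ (z : S3) (v : R3), α.at (lensProj 3 2 z) (manDeriv (lensProj 3 2) z v) =
      henonRadius E z ^ 2 * liouvillePullback (fun z => (z : R4)) z v := fun z v => by
    rw [← liouvillePullback_henonRadial h0 hE]
    exact DFunLike.congr_fun (h.form_eq z) v
  ext w
  constructor
  · intro hw
    obtain ⟨p, w⟩ := w
    obtain ⟨z, rfl⟩ := h.surjective p
    obtain ⟨v, hv⟩ := (h.isInvertible z).surjective w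
    refine ⟨⟨z, v⟩, ?_, ?_⟩
    · have h1 := key z v
      rw [hv] at h1
      have h2 : henonRadius E z ^ 2 * liouvillePullback (fun z => (z : R4)) z v = 0 := h1.symm.trans hw
      exact (mul_eq_zero.1 h2).resolve_left (pow_ne_zero 2 (henonRadius_pos h0 hE z).ne')
    · exact congrArg (fun w => (⟨lensProj 3 2 z, w⟩ : TangentBundle (𝓡 3) (LensSpace 3 2))) hv
  · rintro ⟨⟨z, v⟩, hv, rfl⟩
    have hv' : liouvillePullback (fun z => (z : R4)) z v = 0 := hv
    have h1 := key z v
    rw [hv', mul_zero] at h1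
    exact h1

end

theorem mainTheorem3 (E : ℝ) (hE₀ : 0 < E) (hE₁ : E < 1 / 6) :
    ∃ S : Set R4,
      -- `S = S_E` is the unique sphere-like component of the energy level
      IsSphereLikeComponent henonHeiles E S ∧
      (∀ S' : Set R4, IsSphereLikeComponent henonHeiles E S' → S' = S) ∧
      -- it is strictly convex
      IsStrictlyConvexHypersurface S ∧
      -- the Hamiltonian flow on `S_E` is, up to positive reparametrization, the Reeb flow of the
      -- dynamically convex contact form `λ₀|_{S_E}`
      (∀ f : S3 → R4, IsSphereParametrization f S →
        IsDynamicallyConvex (liouvillePullback f) ∧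
        ∃ R : ∀ z : S3, TangentSpace (𝓡 3) z, IsReebField (liouvillePullback f) R ∧
          ∀ z : S3, ∃ c : ℝ, 0 < c ∧
            IsHamiltonianVector henonHeiles (f z) (c • mfderiv (𝓡 3) 𝓘(ℝ, R4) f z (R z))) ∧
      -- under an equivariant diffeomorphism `S³ → S_E`, which identifies `S_E / ℤ₃` with `L(3,2)`,
      -- `λ₀|_{S_E}` descends to a dynamically convex contact form defining `ξ_std` on `L(3,2)`
      ∃ (f : S3 → R4) (α : OneForm (LensSpace 3 2)),
        IsSphereParametrization f S ∧
        (∀ z : S3, f (lensGenerator 3 2 • z) = henonRotation (f z)) ∧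
        OneForm.pullback (lensProj 3 2) α = liouvillePullback f ∧
        {w : TangentBundle (𝓡 3) (LensSpace 3 2) | α w.proj w.snd = 0} =
          lensContactStructure 3 2 ∧
        IsDynamicallyConvex α := by
  have hf := isSphereParametrization_henonRadial hE₀ hE₁
  have hc := (isHenonCovering_lensProj hE₀ hE₁).isHenonCover
  obtain ⟨h1, h2⟩ := isSphereLikeComponent_henonSphere hE₁ hf
  exact ⟨henonSphere E, h1, h2, isStrictlyConvexHypersurface_henonSphere hE₀ hE₁,
    fun f hf => ⟨hf.isHenonCover.isDynamicallyConvex hE₀ hE₁,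
      exists_isReebField_isHamiltonianVector hE₀ hE₁ hf⟩,
    henonRadial E, _, hf, henonRadial_lensGenerator E, funext hc.form_eq,
    lensContactStructure_eq hE₀ hE₁ hc, hc.isDynamicallyConvex hE₀ hE₁⟩
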